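/- For $k,l\in\mathbb N_0$, a partition of $k$ upper and $l$ lower points is a decomposition of the set of these $k+l$ points into non-empty blocks; it is non-crossing if, listing the points along a circle (upper points from left to right, then lower points from right to left), there are no points $a<b<c<d$ with $a,c$ in one block and $b,d$ in another one. It is a pairing if all its blocks have size two. For a real number $N$, let $\mathsf{NCPart}_N$ be the monoidal $*$-category with set of objects $\mathbb N_0$, whose morphisms $k\to l$ are the formal complex linear combinations of non-crossing partitions with $k$ upper and $l$ lower points. The tensor product is given on objects by addition and on partitions by putting them side by side; the composition of partitions is given by putting one below the other and replacing every arising block without upper and lower points by a factor $N$; the involution is the conjugate-linear extension of the reflection that exchanges upper and lower points. Let $\mathsf{NCPair}_N$ be the analogous category of non-crossing pairings, and let $\mathsf{NCPair}_N'$ be its full subcategory on the even numbers $2\mathbb N_0$. For a non-crossing partition $p$ of $k$ upper and $l$ lower points, let $\tilde p$ be the outline of $p$ drawn with thick lines: each point $x$ is doubled into two neighbouring points, called $x^-$ and $x^+$ in the order in which they occur along the circle, and $x^+$ is joined with $y^-$, where $y$ is the next point after $x$ along the circle that belongs to the same block as $x$ ($y=x$ if $\{x\}$ is a block). Let $\mathrm{bl}(p)$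 be the set of blocks of $p$ and $|b|$ the number of points of a block $b$. **Theorem.** Let $n>0$ be a real number (for instance a positive integer). For every non-crossing partition $p$ of $k$ upper and $l$ lower points, $\tilde p$ is a non-crossing pairing of $2k$ upper and $2l$ lower points, and there is a monoidal unitary functor $F\colon\mathsf{NCPart}_{n^2}\to\mathsf{NCPair}_n'$ with $F(k)=2k$ on objects and $$\mathsf{NCPart}_{n^2}(k,l)\to\mathsf{NCPair}_n(2k,2l),\qquad p\mapsto\Big(\prod_{b\in\mathrm{bl}(p)}n^{1-|b|/2}\Big)\tilde p$$ on partitions. That is, $F$ is a $\mathbb C$-linear functor which commutes with the involutions and is strictly monoidal: its structure isomorphisms $F(k)\otimes F(k')\to F(k\otimes k')$ and $0\to F(0)$ are the identities (in particular they are unitary). Hence $F$ preserves identities, composition (including all the loop factors $n^2$ and $n$), tensor products and involution. -/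

import Mathlib

/-! ## Partitions, non-crossing partitions, pairings and outlines -/

namespace PartitionCat

section

variable {α β γ : Type*}

/-- The number of blocks of `S` that contain no point of the form `f e`. -/
noncomputable def floating (f : α → β) (S : Setoid β) : ℕ :=
  {c ∈ S.classes | ∀ e, f e ∉ c}.ncard

/-- Put the partition `p` (upper points `α`, lower points `β`) above the partition `q`
(upper points `β`, lower points `γ`) and identify the lower points of `p` with the upper points
of `q`: the partition of all the points generated by the blocks of `p` and of `q`. -/
def glue (p : Setoid (α ⊕ β)) (q : Setoid (β ⊕ γ)) : Setoid (α ⊕ β ⊕ γ) :=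
  p.map (Sum.map id Sum.inl) ⊔ q.map Sum.inr

/-- The inclusion of the upper and the lower points into the points of a glued diagram. -/
def ends : α ⊕ γ → α ⊕ β ⊕ γ := Sum.map id Sum.inr

/-- The composition of two partitions (first `p` on top, then `q` below), without the scalar
factor: the partition induced on the upper points of `p` and the lower points of `q`. -/
def vcomp (p : Setoid (α ⊕ β)) (q : Setoid (β ⊕ γ)) : Setoid (α ⊕ γ) :=
  (glue p q).comap ends

/-- The number of blocks that arise in the composition of `p` and `q` and contain neither an upper
nor a lower point. -/
noncomputable def loops (p : Setoid (α ⊕ β)) (q : Setoid (β ⊕ γ)) : ℕ :=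
  floating (ends : α ⊕ γ → α ⊕ β ⊕ γ) (glue p q)

/-- The identity partition: every upper point is joined with the opposite lower point. -/
def idPart (α : Type*) : Setoid (α ⊕ α) := Setoid.ker (Sum.elim id id)

/-- Horizontal reflection. -/
def reflect (p : Setoid (α ⊕ β)) : Setoid (β ⊕ α) := p.comap Sum.swap

end

/-- Partitions of `k` upper and `l` lower points. -/
abbrev Diagram (k l : ℕ) : Type := Setoid (Fin k ⊕ Fin l)

namespace Diagram

variable {k l k' l' : ℕ}

/-- The position of the left diagram's points in a juxtaposition of two diagrams. -/
def inLeft (k k' l l' : ℕ) : Fin k ⊕ Fin l → Fin (k + k') ⊕ Fin (l + l') :=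
  Sum.map (Fin.castAdd k') (Fin.castAdd l')

/-- The position of the right diagram's points in a juxtaposition of two diagrams. -/
def inRight (k k' l l' : ℕ) : Fin k' ⊕ Fin l' → Fin (k + k') ⊕ Fin (l + l') :=
  Sum.map (Fin.natAdd k) (Fin.natAdd l)

/-- The tensor product of two partitions: `p` and `p'` side by side. -/
def tensor (p : Diagram k l) (p' : Diagram k' l') : Diagram (k + k') (l + l') :=
  p.map (inLeft k k' l l') ⊔ p'.map (inRight k k' l l')

/-- The place of a point on the boundary circle of the diagram: the upper points from left to
right, then the lower points from right to left. -/
def pos : Fin k ⊕ Fin l → ℕ :=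
  Sum.elim (fun i => (i : ℕ)) (fun j => k + (l - 1 - (j : ℕ)))

/-- A partition is non-crossing if no two of its blocks cross. -/
def IsNonCrossing (p : Diagram k l) : Prop :=
  ∀ a b c d, pos a < pos b → pos b < pos c → pos c < pos d → p a c → p b d → p a b

/-- A pairing is a partition all of whose blocks have size two. -/
def IsPairing (p : Diagram k l) : Prop :=
  ∀ x, {y | p x y}.ncard = 2

/-- The number of points strictly between `x` and `y` when moving around the boundary circle from
`x` to the next occurrence of `y` (for `x = y`: all other points). -/
def gap (x y : Fin k ⊕ Fin l) : ℕ := (pos y + (k + l - 1 - pos x)) % (k + l)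

/-- `y` is the point of the block of `x` that comes next after `x` on the boundary circle; it is `x`
itself if the block is a singleton. -/
def IsNext (p : Diagram k l) (x y : Fin k ⊕ Fin l) : Prop :=
  p x y ∧ ∀ z, p x z → gap x y ≤ gap x z

/-- Every point is doubled, into a left and a right copy; `base` returns the original point. -/
def base : Fin (2 * k) ⊕ Fin (2 * l) → Fin k ⊕ Fin l :=
  Sum.map (fun i => ⟨i / 2, by omega⟩) (fun j => ⟨j / 2, by omega⟩)

/-- The lines of the outline of a partition drawn with thick lines: moving around the boundary
circle, the second copy of a point `x` is joined with the first copy of the point that comes next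
after `x` in the block of `x`. The first copies are those at even places on the boundary circle. -/
def OutlineStep (p : Diagram k l) (u v : Fin (2 * k) ⊕ Fin (2 * l)) : Prop :=
  Odd (pos u) ∧ Even (pos v) ∧ IsNext p (base u) (base v)

/-- The outline of a partition: the partition of the doubled points generated by the lines of the
outline. -/
def outline (p : Diagram k l) : Diagram (2 * k) (2 * l) :=
  Relation.EqvGen.setoid (OutlineStep p)

/-- The product of `n ^ (1 - |b| / 2)` over all blocks `b` of a partition. -/
noncomputable def weight (n : ℝ) (p : Diagram k l) : ℝ :=
  ∏ᶠ b ∈ p.classes, n ^ (1 - (b.ncard : ℝ) / 2)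

end Diagram

end PartitionCat

/-! ## Properties of the operations on partitions, needed for the categories below -/

namespace PartitionCat

section Gluing

variable {α β γ δ : Type*}

theorem map_le_iff {r : Setoid α} {f : α → β} {s : Setoid β} :
    r.map f ≤ s ↔ r ≤ s.comap f := by
  constructor
  · intro h x y hxy
    exact h (Setoid.le_comap_map hxy)
  · intro h x y hxy
    induction hxy with
    | rel _ _ hab => obtain ⟨a, b, hr, rfl, rfl⟩ := hab; exact h hr
    | refl _ => exact s.refl' _
    | symm _ _ _ ih => exact s.symm' ih
    | trans _ _ _ _ _ ih1 ih2 => exact s.trans' ih1 ih2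

theorem map_gc (f : α → β) :
    GaloisConnection (fun r : Setoid α => r.map f) (fun s => s.comap f) :=
  fun _ _ => map_le_iff

theorem map_sup (r s : Setoid α) (f : α → β) : (r ⊔ s).map f = r.map f ⊔ s.map f :=
  (map_gc f).l_sup

theorem map_bot (f : α → β) : (⊥ : Setoid α).map f = ⊥ :=
  (map_gc f).l_bot

theorem map_map (r : Setoid α) (f : α → β) (g : β → γ) :
    (r.map f).map g = r.map (g ∘ f) := by
  refine eq_of_forall_ge_iff fun s => ?_
  rw [map_le_iff, map_le_iff, map_le_iff]
  rfl

theorem map_congr (r : Setoid α) {f g : α → β} (h : ∀ x, f x = g x) : r.map f = r.map g := by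
  rw [funext h]

theorem map_id (r : Setoid α) : r.map id = r := by
  refine eq_of_forall_ge_iff fun s => ?_
  rw [map_le_iff]
  rfl

theorem map_rel_iff {r : Setoid α} {f : α → β} (hf : Function.Injective f) {x y : β} :
    r.map f x y ↔ (∃ u v, r u v ∧ f u = x ∧ f v = y) ∨ x = y := by
  rw [Setoid.coe_map_of_ker_le r f (Setoid.ker_eq_bot_iff.2 hf ▸ bot_le)]
  rfl

theorem map_le_map {r s : Setoid α} (h : r ≤ s) (f : α → β) : r.map f ≤ s.map f :=
  (map_gc f).monotone_l h

theorem sup_map_aux (G : Setoid β) (R : Setoid α) (f : α → β) {x y : β}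
    (h : (G ⊔ R.map f) x y) :
    (∃ a b, G x (f a) ∧ G y (f b) ∧ (G.comap f ⊔ R) a b) ∨
      ((∀ a, ¬ G x (f a)) ∧ (∀ a, ¬ G y (f a)) ∧ G x y) := by
  classical
  set H := G.comap f ⊔ R with hH
  let φ : β → Quotient H ⊕ Quotient G := fun z =>
    if hz : ∃ a, G z (f a) then Sum.inl (Quotient.mk H hz.choose) else Sum.inr (Quotient.mk G z)
  have hφ1 : ∀ z a, G z (f a) → φ z = Sum.inl (Quotient.mk H a) := by
    intro z a hza
    have hz : ∃ a, G z (f a) := ⟨a, hza⟩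
    simp only [φ, dif_pos hz]
    congr 1
    apply Quotient.sound
    have : G.comap f ≤ H := le_sup_left
    exact this (G.trans' (G.symm' hz.choose_spec) hza)
  have hφ2 : ∀ z, (∀ a, ¬ G z (f a)) → φ z = Sum.inr (Quotient.mk G z) := by
    intro z hz
    have hz : ¬ ∃ a, G z (f a) := not_exists.2 hz
    simp only [φ, dif_neg hz]
  have hker : G ⊔ R.map f ≤ Setoid.ker φ := by
    refine sup_le ?_ (map_le_iff.2 ?_)
    · intro u v huv
      change φ u = φ v
      by_cases hu : ∃ a, G u (f a)
      · obtain ⟨a, ha⟩ := hu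
        rw [hφ1 u a ha, hφ1 v a (G.trans' (G.symm' huv) ha)]
      · rw [hφ2 u (not_exists.1 hu),
          hφ2 v (fun a ha => hu ⟨a, G.trans' huv ha⟩)]
        exact congrArg _ (Quotient.sound huv)
    · intro u v huv
      change φ (f u) = φ (f v)
      rw [hφ1 (f u) u (G.refl' _), hφ1 (f v) v (G.refl' _)]
      have : R ≤ H := le_sup_right
      exact congrArg _ (Quotient.sound (this huv))
  have hxy : φ x = φ y := hker h
  by_cases hx : ∃ a, G x (f a)
  · obtain ⟨a, ha⟩ := hx
    by_cases hy : ∃ b, G y (f b)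
    · obtain ⟨b, hb⟩ := hy
      rw [hφ1 x a ha, hφ1 y b hb] at hxy
      exact Or.inl ⟨a, b, ha, hb, Quotient.exact (Sum.inl.inj hxy)⟩
    · rw [hφ1 x a ha, hφ2 y (not_exists.1 hy)] at hxy
      cases hxy
  · by_cases hy : ∃ b, G y (f b)
    · obtain ⟨b, hb⟩ := hy
      rw [hφ2 x (not_exists.1 hx), hφ1 y b hb] at hxy
      cases hxy
    · rw [hφ2 x (not_exists.1 hx), hφ2 y (not_exists.1 hy)] at hxy
      exact Or.inr ⟨not_exists.1 hx, not_exists.1 hy, Quotient.exact (Sum.inr.inj hxy)⟩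

theorem comap_sup_map (G : Setoid β) (R : Setoid α) (f : α → β) :
    (G ⊔ R.map f).comap f = G.comap f ⊔ R := by
  apply le_antisymm
  · intro a b hab
    have h1 : G.comap f ≤ G.comap f ⊔ R := le_sup_left
    rcases sup_map_aux G R f hab with ⟨a', b', ha, hb, h⟩ | ⟨h, -, -⟩
    · exact Setoid.trans' _ (h1 ha) (Setoid.trans' _ h (Setoid.symm' _ (h1 hb)))
    · exact absurd (G.refl' _) (h a)
  · refine sup_le (fun a b h => ?_) (fun a b h => ?_)
    · exact (le_sup_left : G ≤ _) h
    · exact (le_sup_right : R.map f ≤ G ⊔ R.map f) (Setoid.le_comap_map h)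

theorem floating_sup_map (G : Setoid β) (R : Setoid α) (f : α → β) :
    floating f (G ⊔ R.map f) = floating f G := by
  unfold floating
  congr 1
  have key : ∀ z, (∀ a, ¬ G z (f a)) → ∀ y, (G ⊔ R.map f) z y ↔ G z y := by
    intro z hz y
    constructor
    · intro h
      rcases sup_map_aux G R f h with ⟨a', b', ha, -, -⟩ | ⟨-, -, h⟩
      · exact absurd ha (hz _)
      · exact h
    · intro h
      exact (le_sup_left : G ≤ _) h
  ext c
  constructor
  · rintro ⟨⟨z, rfl⟩, hc⟩
    have hz : ∀ a, ¬ G z (f a) := fun a h =>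
      hc a ((le_sup_left : G ≤ G ⊔ R.map f) (G.symm' h))
    have : {x | (G ⊔ R.map f) x z} = {x | G x z} := by
      ext y
      exact ⟨fun h => G.symm' ((key z hz y).1 (Setoid.symm' _ h)),
        fun h => Setoid.symm' _ ((key z hz y).2 (G.symm' h))⟩
    rw [this] at hc ⊢
    exact ⟨⟨z, rfl⟩, hc⟩
  · rintro ⟨⟨z, rfl⟩, hc⟩
    have hz : ∀ a, ¬ G z (f a) := fun a h => hc a (G.symm' h)
    have : {x | G x z} = {x | (G ⊔ R.map f) x z} := by
      ext y
      exact ⟨fun h => Setoid.symm' _ ((key z hz y).2 (G.symm' h)),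
        fun h => G.symm' ((key z hz y).1 (Setoid.symm' _ h))⟩
    rw [this] at hc ⊢
    exact ⟨⟨z, rfl⟩, hc⟩

theorem comap_map_square (S : Setoid α) {j : α → β} {f : γ → β} {e : δ → α} {g : δ → γ}
    (hj : Function.Injective j) (hf : Function.Injective f) (hg : Function.Injective g)
    (hsq : ∀ d, f (g d) = j (e d)) (hpb : ∀ a c, j a = f c → ∃ d, e d = a ∧ g d = c) :
    (S.map j).comap f = (S.comap e).map g := by
  ext x y
  change S.map j (f x) (f y) ↔ _
  rw [map_rel_iff hj, map_rel_iff hg]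
  refine or_congr ⟨?_, ?_⟩ hf.eq_iff
  · rintro ⟨u, v, h, hu, hv⟩
    obtain ⟨d, rfl, rfl⟩ := hpb _ _ hu
    obtain ⟨d', rfl, rfl⟩ := hpb _ _ hv
    exact ⟨d, d', h, rfl, rfl⟩
  · rintro ⟨d, d', h, rfl, rfl⟩
    exact ⟨_, _, h, (hsq _).symm, (hsq _).symm⟩

theorem floating_map_square (S : Setoid α) {j : α → β} {f : γ → β} {e : δ → α} {g : δ → γ}
    (hj : Function.Injective j)
    (hsq : ∀ d, f (g d) = j (e d)) (hpb : ∀ a c, j a = f c → ∃ d, e d = a ∧ g d = c)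
    (hcov : ∀ x, (∃ a, j a = x) ∨ ∃ c, f c = x) :
    floating f (S.map j) = floating e S := by
  unfold floating
  rw [← Set.ncard_image_of_injective _ (Set.image_injective.2 hj)]
  congr 1
  have himg : ∀ a, {x | S.map j x (j a)} = j '' {x | S x a} := by
    intro a
    ext x
    constructor
    · intro h
      rcases (map_rel_iff hj).1 h with ⟨u, v, hr, rfl, hv⟩ | rfl
      · obtain rfl := hj hv
        exact ⟨u, hr, rfl⟩
      · exact ⟨a, S.refl' _, rfl⟩
    · rintro ⟨u, hu, rfl⟩
      exact (map_rel_iff hj).2 (Or.inl ⟨u, a, hu, rfl, rfl⟩)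
  ext c
  constructor
  · rintro ⟨⟨z, rfl⟩, hc⟩
    rcases hcov z with ⟨a, rfl⟩ | ⟨b, rfl⟩
    · refine ⟨{x | S x a}, ⟨⟨a, rfl⟩, fun d hd => hc (g d) ?_⟩, (himg a).symm⟩
      rw [himg a, hsq]
      exact ⟨_, hd, rfl⟩
    · exact absurd ((S.map j).refl' (f b)) (hc b)
  · rintro ⟨_, ⟨⟨a, rfl⟩, hc⟩, rfl⟩
    refine ⟨⟨j a, (himg a).symm⟩, ?_⟩
    rintro b ⟨u, hu, hub⟩
    obtain ⟨d, rfl, rfl⟩ := hpb _ _ hub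
    exact hc d hu

theorem floating_comp [Finite β] (f : α → β) (g : γ → α) (S : Setoid β) :
    floating (f ∘ g) S = floating f S + floating g (S.comap f) := by
  have h2 : floating g (S.comap f) =
      {c ∈ S.classes | (∃ e, f e ∈ c) ∧ ∀ e, f (g e) ∉ c}.ncard := by
    unfold floating
    refine (Set.ncard_congr (fun c _ => f ⁻¹' c) ?_ ?_ ?_).symm
    · rintro c ⟨⟨z, rfl⟩, ⟨a, ha⟩, hc⟩
      refine ⟨⟨a, ?_⟩, hc⟩
      ext x
      exact ⟨fun h => S.trans' h (S.symm' ha), fun h => S.trans' h ha⟩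
    · rintro c d ⟨hc, ⟨a, ha⟩, -⟩ ⟨hd, -, -⟩ hcd
      have : a ∈ f ⁻¹' c := ha
      change f ⁻¹' c = f ⁻¹' d at hcd
      rw [hcd] at this
      exact Setoid.eq_of_mem_classes hc ha hd this
    · rintro _ ⟨⟨a, rfl⟩, hc⟩
      exact ⟨{x | S x (f a)}, ⟨⟨_, rfl⟩, ⟨a, S.refl' _⟩, hc⟩, rfl⟩
  rw [h2]
  unfold floating
  rw [← Set.ncard_union_eq ?_ (Set.toFinite _) (Set.toFinite _)]
  · congr 1
    ext c
    constructor
    · rintro ⟨hc, h⟩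
      by_cases hf : ∃ e, f e ∈ c
      · exact Or.inr ⟨hc, hf, h⟩
      · exact Or.inl ⟨hc, not_exists.1 hf⟩
    · rintro (⟨hc, h⟩ | ⟨hc, -, h⟩)
      · exact ⟨hc, fun e => h (g e)⟩
      · exact ⟨hc, h⟩
  · rw [Set.disjoint_left]
    rintro c ⟨-, h⟩ ⟨-, ⟨e, he⟩, -⟩
    exact h e he

/-- Auxiliary: three partitions on top of each other. -/
def glue₃ (p : Setoid (α ⊕ β)) (q : Setoid (β ⊕ γ)) (r : Setoid (γ ⊕ δ)) :
    Setoid (α ⊕ β ⊕ γ ⊕ δ) :=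
  p.map (Sum.map id Sum.inl) ⊔ q.map (Sum.inr ∘ Sum.map id Sum.inl) ⊔ r.map (Sum.inr ∘ Sum.inr)

variable (p : Setoid (α ⊕ β)) (q : Setoid (β ⊕ γ)) (r : Setoid (γ ⊕ δ))

theorem glue₃_left : glue₃ p q r =
    (glue p q).map (Sum.map id (Sum.map id Sum.inl) : α ⊕ β ⊕ γ → α ⊕ β ⊕ γ ⊕ δ) ⊔
      (r.map Sum.inr : Setoid (α ⊕ γ ⊕ δ)).map (Sum.map id Sum.inr) := by
  unfold glue₃ glue
  rw [map_sup, map_map, map_map, map_map]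
  congr 2
  congr 1
  funext x; rcases x with x | x <;> rfl

theorem glue₃_right : glue₃ p q r =
    (glue q r).map (Sum.inr : β ⊕ γ ⊕ δ → α ⊕ β ⊕ γ ⊕ δ) ⊔
      (p.map (Sum.map id Sum.inl) : Setoid (α ⊕ β ⊕ δ)).map (Sum.map id (Sum.map id Sum.inr)) := by
  unfold glue₃ glue
  rw [map_sup, map_map, map_map, map_map, sup_comm _ (p.map _), ← sup_assoc]
  congr 2
  congr 1
  funext x; rcases x with x | x <;> rfl

theorem inj₁ : Function.Injective
    (Sum.map id (Sum.map id Sum.inl) : α ⊕ β ⊕ γ → α ⊕ β ⊕ γ ⊕ δ) :=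
  Function.injective_id.sumMap (Function.injective_id.sumMap Sum.inl_injective)

theorem inj₂ : Function.Injective
    (Sum.map id (Sum.map id Sum.inr) : α ⊕ β ⊕ δ → α ⊕ β ⊕ γ ⊕ δ) :=
  Function.injective_id.sumMap (Function.injective_id.sumMap Sum.inr_injective)

theorem inj₃ : Function.Injective (Sum.map id Sum.inr : α ⊕ γ → α ⊕ β ⊕ γ) :=
  Function.injective_id.sumMap Sum.inr_injective

theorem inj₄ : Function.Injective (Sum.map id Sum.inl : α ⊕ β → α ⊕ β ⊕ γ) :=
  Function.injective_id.sumMap Sum.inl_injective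

theorem comap_glue₃_left : (glue₃ p q r).comap (Sum.map id Sum.inr) = glue (vcomp p q) r := by
  rw [glue₃_left, comap_sup_map, glue.eq_1 (vcomp p q), vcomp,
    comap_map_square (glue p q) (e := ends) (g := Sum.map id Sum.inl) inj₁ inj₃ inj₄]
  · rintro (x | x) <;> rfl
  · rintro (x | x | x) (y | y | y) h <;> simp at h
    · exact ⟨Sum.inl x, rfl, by simp [h]⟩
    · exact ⟨Sum.inr x, rfl, by simp [h]⟩

theorem comap_glue₃_right :
    (glue₃ p q r).comap (Sum.map id (Sum.map id Sum.inr)) = glue p (vcomp q r) := by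
  rw [glue₃_right, comap_sup_map, glue.eq_1 p (vcomp q r), vcomp, sup_comm,
    comap_map_square (glue q r) (e := ends) (g := Sum.inr) Sum.inr_injective inj₂ Sum.inr_injective]
  · rintro (x | x) <;> rfl
  · rintro (x | x | x) (y | y | y) h <;> simp at h
    · exact ⟨Sum.inl x, rfl, by simp [h]⟩
    · exact ⟨Sum.inr x, rfl, by simp [h]⟩

theorem floating_glue₃_left :
    floating (Sum.map id Sum.inr : α ⊕ γ ⊕ δ → _) (glue₃ p q r) = loops p q := by
  rw [glue₃_left, floating_sup_map, loops,
    floating_map_square (glue p q) (e := ends) (g := Sum.map id Sum.inl) inj₁]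
  · rintro (x | x) <;> rfl
  · rintro (x | x | x) (y | y | y) h <;> simp at h
    · exact ⟨Sum.inl x, rfl, by simp [h]⟩
    · exact ⟨Sum.inr x, rfl, by simp [h]⟩
  · rintro (x | x | x | x)
    · exact Or.inr ⟨Sum.inl x, rfl⟩
    · exact Or.inl ⟨Sum.inr (Sum.inl x), rfl⟩
    · exact Or.inr ⟨Sum.inr (Sum.inl x), rfl⟩
    · exact Or.inr ⟨Sum.inr (Sum.inr x), rfl⟩

theorem floating_glue₃_right :
    floating (Sum.map id (Sum.map id Sum.inr) : α ⊕ β ⊕ δ → _) (glue₃ p q r) = loops q r := by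
  rw [glue₃_right, floating_sup_map, loops,
    floating_map_square (glue q r) (e := ends) (g := Sum.inr) Sum.inr_injective]
  · rintro (x | x) <;> rfl
  · rintro (x | x | x) (y | y | y) h <;> simp at h
    · exact ⟨Sum.inl x, rfl, by simp [h]⟩
    · exact ⟨Sum.inr x, rfl, by simp [h]⟩
  · rintro (x | x | x | x)
    · exact Or.inr ⟨Sum.inl x, rfl⟩
    · exact Or.inl ⟨Sum.inl x, rfl⟩
    · exact Or.inl ⟨Sum.inr (Sum.inl x), rfl⟩
    · exact Or.inr ⟨Sum.inr (Sum.inr x), rfl⟩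

theorem vcomp_assoc : vcomp (vcomp p q) r = vcomp p (vcomp q r) := by
  rw [vcomp.eq_1 (vcomp p q), vcomp.eq_1 p (vcomp q r), ← comap_glue₃_left, ← comap_glue₃_right,
    ← Setoid.comap_comp, ← Setoid.comap_comp]
  ext x y
  rcases x with x | x <;> rcases y with y | y <;> rfl

theorem loops_assoc [Finite α] [Finite β] [Finite γ] [Finite δ] :
    loops p q + loops (vcomp p q) r = loops q r + loops p (vcomp q r) := by
  have h1 := floating_comp (Sum.map id Sum.inr : α ⊕ γ ⊕ δ → α ⊕ β ⊕ γ ⊕ δ)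
    (ends : α ⊕ δ → α ⊕ γ ⊕ δ) (glue₃ p q r)
  have h2 := floating_comp (Sum.map id (Sum.map id Sum.inr) : α ⊕ β ⊕ δ → α ⊕ β ⊕ γ ⊕ δ)
    (ends : α ⊕ δ → α ⊕ β ⊕ δ) (glue₃ p q r)
  rw [floating_glue₃_left, comap_glue₃_left] at h1
  rw [floating_glue₃_right, comap_glue₃_right] at h2
  rw [loops, loops, ← loops, ← loops] at *
  rw [← h1, ← h2]
  congr 1
  funext x; rcases x with x | x <;> rfl

/-! ### Identities and reflections -/

theorem glue_top {x y : α ⊕ β} (h : p x y) :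
    glue p q (Sum.map id Sum.inl x) (Sum.map id Sum.inl y) :=
  (le_sup_left : p.map _ ≤ _) (Setoid.le_comap_map h)

theorem glue_bot {x y : β ⊕ γ} (h : q x y) : glue p q (Sum.inr x) (Sum.inr y) :=
  (le_sup_right : q.map _ ≤ _) (Setoid.le_comap_map h)

theorem id_vcomp : vcomp (idPart α) p = p := by
  apply le_antisymm
  · have h : glue (idPart α) p ≤ p.comap (Sum.elim Sum.inl id) := by
      refine sup_le (map_le_iff.2 ?_) (map_le_iff.2 fun _ _ h => h)
      rintro (x | x) (y | y) h <;> cases (h : x = y) <;> exact p.refl' _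
    rintro (x | x) (y | y) hxy <;> exact h hxy
  · have h : ∀ x, glue (idPart α) p (ends x) (Sum.inr x) := by
      rintro (x | x)
      · exact glue_top (idPart α) p (x := Sum.inl x) (y := Sum.inr x) rfl
      · exact Setoid.refl' _ _
    intro x y hxy
    exact (glue _ _).trans' (h x) ((glue _ _).trans' (glue_bot _ _ hxy) ((glue _ _).symm' (h y)))

theorem vcomp_id : vcomp p (idPart β) = p := by
  apply le_antisymm
  · have h : glue p (idPart β) ≤ p.comap (Sum.elim Sum.inl (Sum.elim Sum.inr Sum.inr)) := by
      refine sup_le (map_le_iff.2 ?_) (map_le_iff.2 ?_)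
      · rintro (x | x) (y | y) h <;> exact h
      · rintro (x | x) (y | y) h <;> cases (h : x = y) <;> exact p.refl' _
    rintro (x | x) (y | y) hxy <;> exact h hxy
  · have h : ∀ x, glue p (idPart β) (ends x) (Sum.map id Sum.inl x) := by
      rintro (x | x)
      · exact Setoid.refl' _ _
      · exact glue_bot p (idPart β) (x := Sum.inr x) (y := Sum.inl x) rfl
    intro x y hxy
    exact (glue _ _).trans' (h x) ((glue _ _).trans' (glue_top _ _ hxy) ((glue _ _).symm' (h y)))

theorem floating_eq_zero {f : α → β} {S : Setoid β} (h : ∀ x, ∃ e, S (f e) x) :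
    floating f S = 0 := by
  unfold floating
  convert Set.ncard_empty (Set β)
  ext c
  simp only [Set.mem_ofPred_eq, Set.mem_empty_iff_false, iff_false, not_and]
  rintro ⟨z, rfl⟩ hc
  obtain ⟨e, he⟩ := h z
  exact hc e he

theorem loops_id_left : loops (idPart α) p = 0 := by
  refine floating_eq_zero ?_
  rintro (x | x | x)
  · exact ⟨Sum.inl x, Setoid.refl' _ _⟩
  · exact ⟨Sum.inl x, glue_top (idPart α) p (x := Sum.inl x) (y := Sum.inr x) rfl⟩
  · exact ⟨Sum.inr x, Setoid.refl' _ _⟩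

theorem loops_id_right : loops p (idPart β) = 0 := by
  refine floating_eq_zero ?_
  rintro (x | x | x)
  · exact ⟨Sum.inl x, Setoid.refl' _ _⟩
  · exact ⟨Sum.inr x, glue_bot p (idPart β) (x := Sum.inr x) (y := Sum.inl x) rfl⟩
  · exact ⟨Sum.inr x, Setoid.refl' _ _⟩

theorem reflect_reflect : reflect (reflect p) = p := by
  ext x y
  change p (x.swap.swap) (y.swap.swap) ↔ _
  simp

theorem reflect_id : reflect (idPart α) = idPart α := by
  ext x y
  rcases x with x | x <;> rcases y with y | y <;> rfl

/-- Auxiliary: turning a glued diagram upside down. -/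
def flip₃ : α ⊕ β ⊕ γ ≃ γ ⊕ β ⊕ α where
  toFun := Sum.elim (Sum.inr ∘ Sum.inr) (Sum.elim (Sum.inr ∘ Sum.inl) Sum.inl)
  invFun := Sum.elim (Sum.inr ∘ Sum.inr) (Sum.elim (Sum.inr ∘ Sum.inl) Sum.inl)
  left_inv := by rintro (x | x | x) <;> rfl
  right_inv := by rintro (x | x | x) <;> rfl

theorem comap_equiv (e : α ≃ β) (S : Setoid β) : S.comap e = S.map e.symm := by
  apply le_antisymm
  · intro x y h
    have h' : S.map e.symm (e.symm (e x)) (e.symm (e y)) := Setoid.le_comap_map (f := e.symm) h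
    rwa [e.symm_apply_apply, e.symm_apply_apply] at h'
  · rw [map_le_iff]
    intro x y h
    change S (e (e.symm x)) (e (e.symm y))
    rwa [e.apply_symm_apply, e.apply_symm_apply]

theorem glue_reflect : glue (reflect q) (reflect p) = (glue p q).comap flip₃ := by
  rw [comap_equiv]
  unfold glue reflect
  rw [map_sup, map_map, map_map, sup_comm]
  have hp : p.comap Sum.swap = p.map (Equiv.sumComm β α).symm := comap_equiv (Equiv.sumComm β α) p
  have hq : q.comap Sum.swap = q.map (Equiv.sumComm γ β).symm := comap_equiv (Equiv.sumComm γ β) q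
  rw [hp, hq, map_map, map_map]
  congr 2
  · funext x; rcases x with x | x <;> rfl
  · funext x; rcases x with x | x <;> rfl

theorem reflect_vcomp : reflect (vcomp p q) = vcomp (reflect q) (reflect p) := by
  unfold vcomp
  rw [glue_reflect]
  ext x y
  rcases x with x | x <;> rcases y with y | y <;> rfl

theorem floating_comap_equiv (e : α ≃ β) (f : γ → α) (S : Setoid β) :
    floating f (S.comap e) = floating (e ∘ f) S := by
  rw [comap_equiv]
  refine floating_map_square S (e := e ∘ f) (g := id) e.symm.injective (by simp) ?_ ?_
  · intro a c h
    exact ⟨c, by simp [← h], rfl⟩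
  · intro x
    exact Or.inl ⟨e x, by simp⟩

theorem floating_comp_equiv (e : γ ≃ α) (f : α → β) (S : Setoid β) :
    floating (f ∘ e) S = floating f S := by
  unfold floating
  congr 1
  ext c
  simp [e.forall_congr_left]

theorem loops_reflect : loops (reflect q) (reflect p) = loops p q := by
  unfold loops
  rw [glue_reflect, floating_comap_equiv,
    ← floating_comp_equiv (Equiv.sumComm γ α) ends (glue p q)]
  congr 1
  funext x; rcases x with x | x <;> rfl

end Gluing

end PartitionCat

namespace PartitionCat

section Juxtaposition

variable {A B E A' B' X : Type*} {f : A → X} {f' : B → X}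

theorem juxt_left (hf : Function.Injective f) (hf' : Function.Injective f')
    (hd : ∀ a b, f a ≠ f' b) (S : Setoid A) (S' : Setoid B) {a a' : A} :
    (S.map f ⊔ S'.map f') (f a) (f a') ↔ S a a' := by
  have h : (S.map f ⊔ S'.map f').comap f = S := by
    rw [sup_comm, comap_sup_map]
    apply sup_eq_right.2
    intro a a' h
    rcases (map_rel_iff hf').1 h with ⟨u, v, -, hu, -⟩ | h
    · exact absurd hu.symm (hd _ _)
    · exact hf h ▸ S.refl' _
  exact Setoid.ext_iff.1 h a a'

theorem juxt_right (hf : Function.Injective f) (hf' : Function.Injective f')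
    (hd : ∀ a b, f a ≠ f' b) (S : Setoid A) (S' : Setoid B) {b b' : B} :
    (S.map f ⊔ S'.map f') (f' b) (f' b') ↔ S' b b' := by
  rw [sup_comm]
  exact juxt_left hf' hf (fun b a => (hd a b).symm) S' S

theorem juxt_cross (hd : ∀ a b, f a ≠ f' b) (S : Setoid A) (S' : Setoid B) {a : A} {b : B} :
    ¬ (S.map f ⊔ S'.map f') (f a) (f' b) := by
  intro h
  have hk : S.map f ⊔ S'.map f' ≤ Setoid.ker (fun x => ∃ a, f a = x) := by
    refine sup_le (map_le_iff.2 ?_) (map_le_iff.2 ?_)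
    · intro u v _
      change (∃ a, f a = f u) = (∃ a, f a = f v)
      exact propext ⟨fun _ => ⟨v, rfl⟩, fun _ => ⟨u, rfl⟩⟩
    · intro u v _
      change (∃ a, f a = f' u) = (∃ a, f a = f' v)
      exact propext ⟨fun ⟨a, ha⟩ => absurd ha (hd _ _), fun ⟨a, ha⟩ => absurd ha (hd _ _)⟩
  have : (∃ a', f a' = f a) = (∃ a', f a' = f' b) := hk h
  obtain ⟨a', ha'⟩ := this ▸ (⟨a, rfl⟩ : ∃ a', f a' = f a)
  exact hd _ _ ha'

theorem juxt_cross' (hd : ∀ a b, f a ≠ f' b) (S : Setoid A) (S' : Setoid B) {a : A} {b : B} :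
    ¬ (S.map f ⊔ S'.map f') (f' b) (f a) :=
  fun h => juxt_cross hd S S' (Setoid.symm' _ h)

theorem juxt_class_left (hf : Function.Injective f) (hf' : Function.Injective f')
    (hd : ∀ a b, f a ≠ f' b) (hc : ∀ x, (∃ a, f a = x) ∨ ∃ b, f' b = x)
    (S : Setoid A) (S' : Setoid B) (a : A) :
    {x | (S.map f ⊔ S'.map f') x (f a)} = f '' {x | S x a} := by
  ext x
  constructor
  · intro h
    rcases hc x with ⟨a', rfl⟩ | ⟨b, rfl⟩
    · exact ⟨a', (juxt_left hf hf' hd S S').1 h, rfl⟩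
    · exact absurd h (juxt_cross' hd S S')
  · rintro ⟨a', ha, rfl⟩
    exact (juxt_left hf hf' hd S S').2 ha

theorem juxt_class_right (hf : Function.Injective f) (hf' : Function.Injective f')
    (hd : ∀ a b, f a ≠ f' b) (hc : ∀ x, (∃ a, f a = x) ∨ ∃ b, f' b = x)
    (S : Setoid A) (S' : Setoid B) (b : B) :
    {x | (S.map f ⊔ S'.map f') x (f' b)} = f' '' {x | S' x b} := by
  rw [sup_comm]
  exact juxt_class_left hf' hf (fun b a => (hd a b).symm) (fun x => (hc x).symm) S' S b

theorem floating_juxt [Finite A] [Finite B]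
    (hf : Function.Injective f) (hf' : Function.Injective f')
    (hd : ∀ a b, f a ≠ f' b) (hc : ∀ x, (∃ a, f a = x) ∨ ∃ b, f' b = x)
    (S : Setoid A) (S' : Setoid B) {g : E → X} {eA : A' → A} {eB : B' → B}
    (hA : ∀ a, ∃ e, g e = f (eA a)) (hB : ∀ b, ∃ e, g e = f' (eB b))
    (hE : ∀ e, (∃ a, g e = f (eA a)) ∨ ∃ b, g e = f' (eB b)) :
    floating g (S.map f ⊔ S'.map f') = floating eA S + floating eB S' := by
  unfold floating
  rw [← Set.ncard_image_of_injective {c ∈ S.classes | _} (Set.image_injective.2 hf),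
    ← Set.ncard_image_of_injective {c ∈ S'.classes | _} (Set.image_injective.2 hf'),
    ← Set.ncard_union_eq ?_ (Set.toFinite _) (Set.toFinite _)]
  · congr 1
    ext c
    constructor
    · rintro ⟨⟨z, rfl⟩, h⟩
      rcases hc z with ⟨a, rfl⟩ | ⟨b, rfl⟩
      · rw [juxt_class_left hf hf' hd hc] at h ⊢
        refine Or.inl ⟨_, ⟨⟨a, rfl⟩, fun a' ha' => ?_⟩, rfl⟩
        obtain ⟨e, he⟩ := hA a'
        exact h e ⟨_, ha', he.symm⟩
      · rw [juxt_class_right hf hf' hd hc] at h ⊢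
        refine Or.inr ⟨_, ⟨⟨b, rfl⟩, fun b' hb' => ?_⟩, rfl⟩
        obtain ⟨e, he⟩ := hB b'
        exact h e ⟨_, hb', he.symm⟩
    · rintro (⟨_, ⟨⟨a, rfl⟩, h⟩, rfl⟩ | ⟨_, ⟨⟨b, rfl⟩, h⟩, rfl⟩)
      · refine ⟨⟨f a, (juxt_class_left hf hf' hd hc S S' a).symm⟩, ?_⟩
        rintro e ⟨u, hu, hue⟩
        rcases hE e with ⟨a', he⟩ | ⟨b', he⟩
        · exact h a' (hf (hue.trans he) ▸ hu)
        · exact hd _ _ (hue.trans he)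
      · refine ⟨⟨f' b, (juxt_class_right hf hf' hd hc S S' b).symm⟩, ?_⟩
        rintro e ⟨u, hu, hue⟩
        rcases hE e with ⟨a', he⟩ | ⟨b', he⟩
        · exact hd _ _ (hue.trans he).symm
        · exact h b' (hf' (hue.trans he) ▸ hu)
  · rw [Set.disjoint_left]
    rintro _ ⟨_, ⟨⟨a, rfl⟩, -⟩, rfl⟩ ⟨_, ⟨⟨b, rfl⟩, -⟩, h⟩
    have : f a ∈ f '' {x | S x a} := ⟨a, S.refl' _, rfl⟩
    rw [← h] at this
    obtain ⟨b', -, hb'⟩ := this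
    exact hd _ _ hb'.symm

end Juxtaposition

namespace Diagram

variable {k l m k' l' m' k'' l'' : ℕ}

theorem inLeft_injective : Function.Injective (inLeft k k' l l') :=
  (Fin.castAdd_injective _ _).sumMap (Fin.castAdd_injective _ _)

theorem inRight_injective : Function.Injective (inRight k k' l l') :=
  (Fin.natAdd_injective _ _).sumMap (Fin.natAdd_injective _ _)

theorem castAdd_ne_natAdd (i : Fin k) (j : Fin k') : Fin.castAdd k' i ≠ Fin.natAdd k j := by
  intro h
  have := congrArg Fin.val h
  simp at this
  omega

theorem inLeft_ne_inRight (a : Fin k ⊕ Fin l) (b : Fin k' ⊕ Fin l') :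
    inLeft k k' l l' a ≠ inRight k k' l l' b := by
  rcases a with a | a <;> rcases b with b | b <;> simp [inLeft, inRight, castAdd_ne_natAdd]

theorem fin_cover (i : Fin (k + k')) :
    (∃ a : Fin k, Fin.castAdd k' a = i) ∨ ∃ b : Fin k', Fin.natAdd k b = i := by
  induction i using Fin.addCases with
  | left i => exact Or.inl ⟨i, rfl⟩
  | right i => exact Or.inr ⟨i, rfl⟩

theorem inLeft_cover (x : Fin (k + k') ⊕ Fin (l + l')) :
    (∃ a, inLeft k k' l l' a = x) ∨ ∃ b, inRight k k' l l' b = x := by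
  rcases x with x | x
  · rcases fin_cover x with ⟨a, rfl⟩ | ⟨a, rfl⟩
    · exact Or.inl ⟨Sum.inl a, rfl⟩
    · exact Or.inr ⟨Sum.inl a, rfl⟩
  · rcases fin_cover x with ⟨a, rfl⟩ | ⟨a, rfl⟩
    · exact Or.inl ⟨Sum.inr a, rfl⟩
    · exact Or.inr ⟨Sum.inr a, rfl⟩

/-- Auxiliary: the analogue of `inLeft` for glued diagrams. -/
def inLeft₃ (k k' l l' m m' : ℕ) :
    Fin k ⊕ Fin l ⊕ Fin m → Fin (k + k') ⊕ Fin (l + l') ⊕ Fin (m + m') :=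
  Sum.map (Fin.castAdd k') (inLeft l l' m m')

/-- Auxiliary: the analogue of `inRight` for glued diagrams. -/
def inRight₃ (k k' l l' m m' : ℕ) :
    Fin k' ⊕ Fin l' ⊕ Fin m' → Fin (k + k') ⊕ Fin (l + l') ⊕ Fin (m + m') :=
  Sum.map (Fin.natAdd k) (inRight l l' m m')

theorem inLeft₃_injective : Function.Injective (inLeft₃ k k' l l' m m') :=
  (Fin.castAdd_injective _ _).sumMap inLeft_injective

theorem inRight₃_injective : Function.Injective (inRight₃ k k' l l' m m') :=
  (Fin.natAdd_injective _ _).sumMap inRight_injective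

theorem inLeft₃_ne_inRight₃ (a : Fin k ⊕ Fin l ⊕ Fin m) (b : Fin k' ⊕ Fin l' ⊕ Fin m') :
    inLeft₃ k k' l l' m m' a ≠ inRight₃ k k' l l' m m' b := by
  rcases a with a | a <;> rcases b with b | b <;>
    simp [inLeft₃, inRight₃, castAdd_ne_natAdd, inLeft_ne_inRight]

theorem inLeft₃_cover (x : Fin (k + k') ⊕ Fin (l + l') ⊕ Fin (m + m')) :
    (∃ a, inLeft₃ k k' l l' m m' a = x) ∨ ∃ b, inRight₃ k k' l l' m m' b = x := by
  rcases x with x | x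
  · rcases fin_cover x with ⟨a, rfl⟩ | ⟨a, rfl⟩
    · exact Or.inl ⟨Sum.inl a, rfl⟩
    · exact Or.inr ⟨Sum.inl a, rfl⟩
  · rcases inLeft_cover x with ⟨a, rfl⟩ | ⟨a, rfl⟩
    · exact Or.inl ⟨Sum.inr a, rfl⟩
    · exact Or.inr ⟨Sum.inr a, rfl⟩

theorem glue_tensor (p : Diagram k l) (q : Diagram l m) (p' : Diagram k' l') (q' : Diagram l' m') :
    glue (tensor p p') (tensor q q') =
      (glue p q).map (inLeft₃ k k' l l' m m') ⊔ (glue p' q').map (inRight₃ k k' l l' m m') := by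
  unfold glue tensor
  simp only [map_sup, map_map]
  rw [sup_sup_sup_comm]
  refine congrArg₂ _ (congrArg₂ _ ?_ ?_) (congrArg₂ _ ?_ ?_) <;> refine map_congr _ fun x => ?_ <;>
    rcases x with x | x <;> rfl

theorem ends_inLeft (a : Fin k ⊕ Fin m) :
    (ends (inLeft k k' m m' a) : Fin (k + k') ⊕ Fin (l + l') ⊕ Fin (m + m')) =
      inLeft₃ k k' l l' m m' (ends a) := by
  rcases a with a | a <;> rfl

theorem ends_inRight (a : Fin k' ⊕ Fin m') :
    (ends (inRight k k' m m' a) : Fin (k + k') ⊕ Fin (l + l') ⊕ Fin (m + m')) =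
      inRight₃ k k' l l' m m' (ends a) := by
  rcases a with a | a <;> rfl

theorem tensor_left {p : Diagram k l} {p' : Diagram k' l'} {a a' : Fin k ⊕ Fin l} :
    tensor p p' (inLeft k k' l l' a) (inLeft k k' l l' a') ↔ p a a' :=
  juxt_left inLeft_injective inRight_injective inLeft_ne_inRight p p'

theorem tensor_right {p : Diagram k l} {p' : Diagram k' l'} {a a' : Fin k' ⊕ Fin l'} :
    tensor p p' (inRight k k' l l' a) (inRight k k' l l' a') ↔ p' a a' :=
  juxt_right inLeft_injective inRight_injective inLeft_ne_inRight p p'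

theorem tensor_cross {p : Diagram k l} {p' : Diagram k' l'} {a : Fin k ⊕ Fin l}
    {b : Fin k' ⊕ Fin l'} : ¬ tensor p p' (inLeft k k' l l' a) (inRight k k' l l' b) :=
  juxt_cross inLeft_ne_inRight p p'

theorem tensor_cross' {p : Diagram k l} {p' : Diagram k' l'} {a : Fin k ⊕ Fin l}
    {b : Fin k' ⊕ Fin l'} : ¬ tensor p p' (inRight k k' l l' b) (inLeft k k' l l' a) :=
  juxt_cross' inLeft_ne_inRight p p'

theorem eq_tensor_of {p : Diagram k l} {p' : Diagram k' l'} {S : Diagram (k + k') (l + l')}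
    (h1 : ∀ a a', S (inLeft k k' l l' a) (inLeft k k' l l' a') ↔ p a a')
    (h2 : ∀ b b', S (inRight k k' l l' b) (inRight k k' l l' b') ↔ p' b b')
    (h3 : ∀ a b, ¬ S (inLeft k k' l l' a) (inRight k k' l l' b)) : S = tensor p p' := by
  ext x y
  rcases inLeft_cover x with ⟨a, rfl⟩ | ⟨a, rfl⟩ <;> rcases inLeft_cover y with ⟨b, rfl⟩ | ⟨b, rfl⟩
  · exact (h1 a b).trans tensor_left.symm
  · exact iff_of_false (h3 a b) tensor_cross
  · exact iff_of_false (fun h => h3 b a (S.symm' h)) tensor_cross'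
  · exact (h2 a b).trans tensor_right.symm

theorem vcomp_tensor (p : Diagram k l) (q : Diagram l m) (p' : Diagram k' l')
    (q' : Diagram l' m') :
    (vcomp (tensor p p') (tensor q q') : Diagram (k + k') (m + m')) =
      tensor (vcomp p q) (vcomp p' q') := by
  refine eq_tensor_of (fun a a' => ?_) (fun b b' => ?_) (fun a b => ?_)
  · change glue (tensor p p') (tensor q q') _ _ ↔ _
    rw [ends_inLeft, ends_inLeft, glue_tensor]
    exact juxt_left inLeft₃_injective inRight₃_injective inLeft₃_ne_inRight₃ _ _
  · change glue (tensor p p') (tensor q q') _ _ ↔ _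
    rw [ends_inRight, ends_inRight, glue_tensor]
    exact juxt_right inLeft₃_injective inRight₃_injective inLeft₃_ne_inRight₃ _ _
  · change ¬ glue (tensor p p') (tensor q q') _ _
    rw [ends_inLeft, ends_inRight, glue_tensor]
    exact juxt_cross inLeft₃_ne_inRight₃ _ _

theorem loops_tensor (p : Diagram k l) (q : Diagram l m) (p' : Diagram k' l')
    (q' : Diagram l' m') :
    loops (tensor p p') (tensor q q') = loops p q + loops p' q' := by
  unfold loops
  rw [glue_tensor]
  refine floating_juxt inLeft₃_injective inRight₃_injective inLeft₃_ne_inRight₃ inLeft₃_cover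
    _ _ (fun a => ⟨_, ends_inLeft a⟩) (fun b => ⟨_, ends_inRight b⟩) (fun e => ?_)
  rcases inLeft_cover e with ⟨a, rfl⟩ | ⟨a, rfl⟩
  · exact Or.inl ⟨a, ends_inLeft a⟩
  · exact Or.inr ⟨a, ends_inRight a⟩

theorem tensor_id : tensor (idPart (Fin k)) (idPart (Fin k')) = idPart (Fin (k + k')) := by
  refine (eq_tensor_of (fun a a' => ?_) (fun b b' => ?_) (fun a b => ?_)).symm
  · rcases a with a | a <;> rcases a' with a' | a' <;>
      exact (Fin.castAdd_injective _ _).eq_iff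
  · rcases b with a | a <;> rcases b' with a' | a' <;>
      exact (Fin.natAdd_injective _ _).eq_iff
  · rcases a with a | a <;> rcases b with b | b <;> exact castAdd_ne_natAdd a b

theorem reflect_tensor (p : Diagram k l) (p' : Diagram k' l') :
    reflect (tensor p p') = tensor (reflect p) (reflect p') := by
  refine eq_tensor_of (fun a a' => ?_) (fun b b' => ?_) (fun a b => ?_)
  · refine Iff.trans ?_ (tensor_left (p := p) (p' := p') (a := a.swap) (a' := a'.swap))
    rcases a with a | a <;> rcases a' with a' | a' <;> rfl
  · refine Iff.trans ?_ (tensor_right (p := p) (p' := p') (a := b.swap) (a' := b'.swap))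
    rcases b with a | a <;> rcases b' with a' | a' <;> rfl
  · have := tensor_cross (p := p) (p' := p') (a := a.swap) (b := b.swap)
    rcases a with a | a <;> rcases b with b | b <;> exact this

theorem tensor_assoc (p : Diagram k l) (p' : Diagram k' l') (p'' : Diagram k'' l'') :
    (tensor (tensor p p') p'').map (Sum.map id (Fin.cast (Nat.add_assoc l l' l''))) =
      (tensor p (tensor p' p'')).map (Sum.map (Fin.cast (Nat.add_assoc k k' k'').symm) id) := by
  unfold tensor
  simp only [map_sup, map_map]
  rw [sup_assoc]
  refine congrArg₂ _ ?_ (congrArg₂ _ ?_ ?_) <;> refine map_congr _ fun x => ?_ <;>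
    rcases x with x | x <;> simp [inLeft, inRight, Fin.ext_iff, Nat.add_assoc]

theorem empty_tensor (p : Diagram k l) :
    (tensor (idPart (Fin 0)) p).map (Sum.map id (Fin.cast (Nat.zero_add l))) =
      p.map (Sum.map (Fin.cast (Nat.zero_add k).symm) id) := by
  have : idPart (Fin 0) = ⊥ := by
    ext x y
    rcases x with x | x <;> exact x.elim0
  unfold tensor
  rw [this, map_bot, bot_sup_eq, map_map]
  refine map_congr _ fun x => ?_
  rcases x with x | x <;> simp [inRight]

theorem tensor_empty (p : Diagram k l) :
    (tensor p (idPart (Fin 0))).map (Sum.map id (Fin.cast (Nat.add_zero l))) =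
      p.map (Sum.map (Fin.cast (Nat.add_zero k).symm) id) := by
  have : idPart (Fin 0) = ⊥ := by
    ext x y
    rcases x with x | x <;> exact x.elim0
  unfold tensor
  rw [this, map_bot, sup_bot_eq, map_map]
  refine map_congr _ fun x => ?_
  rcases x with x | x <;> rfl

end Diagram
end PartitionCat

namespace PartitionCat
namespace Diagram

variable {k l m k' l' m' : ℕ}

theorem pos_injective : Function.Injective (pos : Fin k ⊕ Fin l → ℕ) := by
  rintro (x | x) (y | y) h <;> simp [pos] at h ⊢ <;> omega

/-! ### Non-crossing partitions -/

theorem pos_swap (x : Fin k ⊕ Fin l) : pos x.swap + pos x + 1 = k + l := by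
  rcases x with x | x <;> simp [pos] <;> omega

theorem IsNonCrossing.reflect {p : Diagram k l} (hp : p.IsNonCrossing) :
    IsNonCrossing (reflect p) := by
  intro a b c d hab hbc hcd hac hbd
  have ha := pos_swap a
  have hb := pos_swap b
  have hc := pos_swap c
  have hd := pos_swap d
  have := hp d.swap c.swap b.swap a.swap (by omega) (by omega) (by omega)
    (p.symm' hbd) (p.symm' hac)
  exact p.trans' hac (p.trans' (p.symm' this) (p.symm' hbd))

theorem idPart_rel {α : Type*} {x y : α ⊕ α} :
    idPart α x y ↔ Sum.elim id id x = Sum.elim id id y := Iff.rfl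

theorem isNonCrossing_id : IsNonCrossing (idPart (Fin k)) := by
  rintro (a | a) (b | b) (c | c) (d | d) hab hbc hcd hac hbd <;>
    simp [pos] at hab hbc hcd <;> simp [idPart_rel] at hac hbd ⊢ <;> omega

theorem pos_inLeft (a b : Fin k ⊕ Fin l) :
    pos (inLeft k k' l l' a) < pos (inLeft k k' l l' b) ↔ pos a < pos b := by
  rcases a with a | a <;> rcases b with b | b <;> simp [pos, inLeft] <;> omega

theorem pos_inRight (a b : Fin k' ⊕ Fin l') :
    pos (inRight k k' l l' a) < pos (inRight k k' l l' b) ↔ pos a < pos b := by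
  rcases a with a | a <;> rcases b with b | b <;> simp [pos, inRight] <;> omega

theorem pos_inLeft_or (a : Fin k ⊕ Fin l) :
    pos (inLeft k k' l l' a) < k ∨ k + k' + l' ≤ pos (inLeft k k' l l' a) := by
  rcases a with a | a <;> simp [pos, inLeft]
  omega

theorem pos_inRight_and (a : Fin k' ⊕ Fin l') :
    k ≤ pos (inRight k k' l l' a) ∧ pos (inRight k k' l l' a) < k + k' + l' := by
  rcases a with a | a <;> simp [pos, inRight] <;> omega

theorem IsNonCrossing.tensor {p : Diagram k l} {p' : Diagram k' l'} (hp : p.IsNonCrossing)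
    (hp' : p'.IsNonCrossing) : (tensor p p').IsNonCrossing := by
  intro a b c d hab hbc hcd hac hbd
  rcases inLeft_cover a with ⟨a, rfl⟩ | ⟨a, rfl⟩ <;>
  rcases inLeft_cover c with ⟨c, rfl⟩ | ⟨c, rfl⟩ <;>
  first
    | exact absurd hac tensor_cross
    | exact absurd hac tensor_cross'
    | skip
  all_goals
    rcases inLeft_cover b with ⟨b, rfl⟩ | ⟨b, rfl⟩ <;>
    rcases inLeft_cover d with ⟨d, rfl⟩ | ⟨d, rfl⟩ <;>
    first
      | exact absurd hbd tensor_cross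
      | exact absurd hbd tensor_cross'
      | skip
  · rw [pos_inLeft] at hab hbc hcd
    exact tensor_left.2 (hp a b c d hab hbc hcd (tensor_left.1 hac) (tensor_left.1 hbd))
  · have h1 := pos_inLeft_or (k' := k') (l' := l') c
    have h2 := pos_inRight_and (k := k) (l := l) b
    have h3 := pos_inRight_and (k := k) (l := l) d
    omega
  · have h1 := pos_inLeft_or (k' := k') (l' := l') b
    have h2 := pos_inRight_and (k := k) (l := l) a
    have h3 := pos_inRight_and (k := k) (l := l) c
    omega
  · rw [pos_inRight] at hab hbc hcd
    exact tensor_right.2 (hp' a b c d hab hbc hcd (tensor_right.1 hac) (tensor_right.1 hbd))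

open Classical in
/-- Auxiliary: `1` if `x` comes before `y` on the boundary circle, else `0`. -/
noncomputable def before (x y : Fin k ⊕ Fin l) : ZMod 2 := if pos x < pos y then 1 else 0

open Classical in
/-- Auxiliary: the mod 2 indicator function of a point. -/
noncomputable def dlt {α : Type*} (u : α) : α → ZMod 2 := fun x => if x = u then 1 else 0

open Classical in
/-- Auxiliary: a mod 2 function is even if its sum over every block vanishes. -/
def EvenOn {α : Type*} [Fintype α] (p : Setoid α) (f : α → ZMod 2) : Prop :=
  ∀ c : Quotient p, ∑ x with Quotient.mk p x = c, f x = 0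

theorem block_dichotomy {p : Diagram k l} (hp : p.IsNonCrossing) (B C : Quotient p)
    (hBC : B ≠ C) :
    (∀ x y y', Quotient.mk p x = B → Quotient.mk p y = C → Quotient.mk p y' = C →
      before x y = before x y') ∨
    (∀ x x' y, Quotient.mk p x = B → Quotient.mk p x' = B → Quotient.mk p y = C →
      before x y = before x' y) := by
  by_contra hcon
  push Not at hcon
  obtain ⟨⟨x, y, y', hx, hy, hy', hne⟩, ⟨x₁, x₂, y₃, hx₁, hx₂, hy₃, hne'⟩⟩ := hcon
  have hdis : ∀ u v, Quotient.mk p u = B → Quotient.mk p v = C → pos u ≠ pos v := by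
    intro u v hu hv h
    exact hBC (hu.symm.trans ((congrArg _ (pos_injective h)).trans hv))
  have hBr : ∀ u v, Quotient.mk p u = B → Quotient.mk p v = B → p u v :=
    fun u v hu hv => Quotient.exact (hu.trans hv.symm)
  have hCr : ∀ u v, Quotient.mk p u = C → Quotient.mk p v = C → p u v :=
    fun u v hu hv => Quotient.exact (hu.trans hv.symm)
  have hno : ∀ u v, Quotient.mk p u = B → Quotient.mk p v = C → ¬ p u v := by
    intro u v hu hv h
    exact hBC (hu.symm.trans ((Quotient.sound h).trans hv))
  -- no alternation of points of `B` and `C`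
  have alt1 : ∀ u v u' v', Quotient.mk p u = B → Quotient.mk p v = C → Quotient.mk p u' = B →
      Quotient.mk p v' = C → pos u < pos v → pos v < pos u' → pos u' < pos v' → False :=
    fun u v u' v' hu hv hu' hv' h1 h2 h3 =>
      hno _ _ hu hv (hp u v u' v' h1 h2 h3 (hBr _ _ hu hu') (hCr _ _ hv hv'))
  have alt2 : ∀ v u v' u', Quotient.mk p u = B → Quotient.mk p v = C → Quotient.mk p u' = B →
      Quotient.mk p v' = C → pos v < pos u → pos u < pos v' → pos v' < pos u' → False :=
    fun v u v' u' hu hv hu' hv' h1 h2 h3 =>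
      hno _ _ hu hv (p.symm' (hp v u v' u' h1 h2 h3 (hCr _ _ hv hv') (hBr _ _ hu hu')))
  have d1 := hdis x y hx hy
  have d2 := hdis x y' hx hy'
  have d3 := hdis x₁ y₃ hx₁ hy₃
  have d4 := hdis x₂ y₃ hx₂ hy₃
  have d5 := hdis x₁ y hx₁ hy
  have d6 := hdis x₁ y' hx₁ hy'
  have d7 := hdis x₂ y hx₂ hy
  have d8 := hdis x₂ y' hx₂ hy'
  unfold before at hne hne'
  have main : ∀ x y y' x₁ x₂ y₃, Quotient.mk p x = B → Quotient.mk p y = C →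
      Quotient.mk p y' = C → Quotient.mk p x₁ = B → Quotient.mk p x₂ = B → Quotient.mk p y₃ = C →
      pos y < pos x → pos x < pos y' → pos x₁ < pos y₃ → pos y₃ < pos x₂ → False := by
    intro x y y' x₁ x₂ y₃ hx hy hy' hx₁ hx₂ hy₃ h1 h2 h3 h4
    have d5 := hdis x₁ y hx₁ hy
    have d8 := hdis x₂ y' hx₂ hy'
    rcases lt_or_gt_of_ne d5 with h | h
    · exact alt1 x₁ y x y' hx₁ hy hx hy' h h1 h2
    · rcases lt_or_gt_of_ne d8 with h' | h'
      · exact alt2 y x₁ y₃ x₂ hx₁ hy hx₂ hy₃ h h3 h4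
      · exact alt2 y x y' x₂ hx hy hx₂ hy' h1 h2 h'
  split_ifs at hne hne' with h1 h2 h3 h4 h3 h4 h3 h4 h3 h4 h3 h4
  all_goals try exact absurd rfl hne
  all_goals try exact absurd rfl hne'
  · exact main x y' y x₁ x₂ y₃ hx hy' hy hx₁ hx₂ hy₃ (by omega) (by omega) (by omega) (by omega)
  · exact main x y' y x₂ x₁ y₃ hx hy' hy hx₂ hx₁ hy₃ (by omega) (by omega) (by omega) (by omega)
  · exact main x y y' x₁ x₂ y₃ hx hy hy' hx₁ hx₂ hy₃ (by omega) (by omega) (by omega) (by omega)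
  · exact main x y y' x₂ x₁ y₃ hx hy hy' hx₂ hx₁ hy₃ (by omega) (by omega) (by omega) (by omega)

open Classical in
theorem sum_before_eq_zero {p : Diagram k l} (hp : p.IsNonCrossing)
    {f g : Fin k ⊕ Fin l → ZMod 2} (hf : EvenOn p f) (hg : EvenOn p g)
    (hfg : ∀ x y, p x y → f x * g y = 0) : ∑ x, ∑ y, f x * g y * before x y = 0 := by
  rw [← Finset.sum_fiberwise _ (Quotient.mk p)]
  refine Finset.sum_eq_zero fun B _ => ?_
  have : ∀ x, ∑ y, f x * g y * before x y =
      ∑ C : Quotient p, ∑ y with Quotient.mk p y = C, f x * g y * before x y :=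
    fun x => (Finset.sum_fiberwise _ (Quotient.mk p) _).symm
  simp_rw [this]
  rw [Finset.sum_comm]
  refine Finset.sum_eq_zero fun C _ => ?_
  by_cases hBC : B = C
  · refine Finset.sum_eq_zero fun x hx => Finset.sum_eq_zero fun y hy => ?_
    rw [Finset.mem_filter] at hx hy
    rw [hfg x y (Quotient.exact (hx.2.trans (hBC.trans hy.2.symm))), zero_mul]
  · rcases block_dichotomy hp B C hBC with h | h
    · refine Finset.sum_eq_zero fun x hx => ?_
      rw [Finset.mem_filter] at hx
      by_cases he : ∃ y₀, Quotient.mk p y₀ = C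
      · obtain ⟨y₀, hy₀⟩ := he
        have : ∀ y ∈ Finset.univ.filter (fun y => Quotient.mk p y = C),
            f x * g y * before x y = (f x * before x y₀) * g y := by
          intro y hy
          rw [Finset.mem_filter] at hy
          rw [h x y y₀ hx.2 hy.2 hy₀]
          ring
        rw [Finset.sum_congr rfl this, ← Finset.mul_sum, hg C, mul_zero]
      · refine Finset.sum_eq_zero fun y hy => ?_
        exact absurd ⟨y, (Finset.mem_filter.1 hy).2⟩ he
    · rw [Finset.sum_comm]
      refine Finset.sum_eq_zero fun y hy => ?_
      rw [Finset.mem_filter] at hy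
      by_cases he : ∃ x₀, Quotient.mk p x₀ = B
      · obtain ⟨x₀, hx₀⟩ := he
        have : ∀ x ∈ Finset.univ.filter (fun x => Quotient.mk p x = B),
            f x * g y * before x y = (g y * before x₀ y) * f x := by
          intro x hx
          rw [Finset.mem_filter] at hx
          rw [h x x₀ y hx.2 hx₀ hy.2]
          ring
        rw [Finset.sum_congr rfl this, ← Finset.mul_sum, hf B, mul_zero]
      · refine Finset.sum_eq_zero fun x hx => ?_
        exact absurd ⟨x, (Finset.mem_filter.1 hx).2⟩ he

theorem evenOn_zero {α : Type*} [Fintype α] {p : Setoid α} : EvenOn p (0 : α → ZMod 2) :=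
  fun c => by simp

theorem EvenOn.add {α : Type*} [Fintype α] {p : Setoid α} {f g : α → ZMod 2} (hf : EvenOn p f)
    (hg : EvenOn p g) : EvenOn p (f + g) := by
  intro c
  simp only [Pi.add_apply, Finset.sum_add_distrib, hf c, hg c, add_zero]

theorem EvenOn.sum {α : Type*} [Fintype α] {p : Setoid α} {f : α → ZMod 2} (hf : EvenOn p f) :
    ∑ x, f x = 0 := by
  classical
  rw [← Finset.sum_fiberwise _ (Quotient.mk p)]
  refine Finset.sum_eq_zero fun c _ => ?_
  convert hf c

theorem evenOn_pair {α : Type*} [Fintype α] {p : Setoid α} {u v : α} (h : p u v) :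
    EvenOn p (dlt u + dlt v) := by
  classical
  intro c
  have hc : Quotient.mk p u = Quotient.mk p v := Quotient.sound h
  simp only [Pi.add_apply, Finset.sum_add_distrib, dlt, Finset.sum_ite_eq', Finset.mem_filter,
    Finset.mem_univ, true_and, hc]
  exact CharTwo.add_self_eq_zero _

theorem pair_support {α : Type*} {u v z : α} (h : (dlt u + dlt v) z ≠ 0) : z = u ∨ z = v := by
  by_contra hcon
  push Not at hcon
  simp [dlt, hcon] at h

/-- Auxiliary: the function on the points of a glued diagram given by functions on its parts. -/
def total (f : Fin k ⊕ Fin l → ZMod 2) (g : Fin l ⊕ Fin m → ZMod 2) :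
    Fin k ⊕ Fin l ⊕ Fin m → ZMod 2 :=
  Sum.elim (fun i => f (Sum.inl i)) (Sum.elim (fun j => f (Sum.inr j) + g (Sum.inl j))
    (fun i => g (Sum.inr i)))

theorem total_zero : total (0 : Fin k ⊕ Fin l → ZMod 2) (0 : Fin l ⊕ Fin m → ZMod 2) = 0 := by
  funext z
  rcases z with z | z | z <;> simp [total]

theorem dlt_self {α : Type*} (x : α) : dlt x + dlt x = 0 := by
  funext z
  exact CharTwo.add_self_eq_zero _

/-- Auxiliary: connected points of a glued diagram are connected by a mod 2 chain. -/
theorem exists_chain (p : Diagram k l) (q : Diagram l m) {x y : Fin k ⊕ Fin l ⊕ Fin m}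
    (h : glue p q x y) : ∃ (f : Fin k ⊕ Fin l → ZMod 2) (g : Fin l ⊕ Fin m → ZMod 2),
      EvenOn p f ∧ EvenOn q g ∧
      (∀ z, f z ≠ 0 → glue p q x (Sum.map id Sum.inl z)) ∧
      (∀ z, g z ≠ 0 → glue p q x (Sum.inr z)) ∧ total f g = dlt x + dlt y := by
  have h0 := h
  have hrefl : ∀ x, ∃ (f : Fin k ⊕ Fin l → ZMod 2) (g : Fin l ⊕ Fin m → ZMod 2),
      EvenOn p f ∧ EvenOn q g ∧
      (∀ z, f z ≠ 0 → glue p q x (Sum.map id Sum.inl z)) ∧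
      (∀ z, g z ≠ 0 → glue p q x (Sum.inr z)) ∧ total f g = dlt x + dlt x := fun x =>
    ⟨0, 0, evenOn_zero, evenOn_zero, by simp, by simp, total_zero.trans (dlt_self x).symm⟩
  rw [glue, Setoid.sup_eq_eqvGen] at h
  induction h with
  | rel x y hxy =>
    rcases hxy with hxy | hxy
    · rcases (map_rel_iff inj₄).1 hxy with ⟨u, v, huv, rfl, rfl⟩ | rfl
      · refine ⟨dlt u + dlt v, 0, evenOn_pair huv, evenOn_zero, ?_, by simp, ?_⟩
        · intro z hz
          rcases pair_support hz with rfl | rfl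
          · exact Setoid.refl' _ _
          · exact h0
        · funext z
          rcases u with u | u <;> rcases v with v | v <;> rcases z with z | z | z <;>
            simp [total, dlt]
      · exact hrefl x
    · rcases (map_rel_iff Sum.inr_injective).1 hxy with ⟨u, v, huv, rfl, rfl⟩ | rfl
      · refine ⟨0, dlt u + dlt v, evenOn_zero, evenOn_pair huv, by simp, ?_, ?_⟩
        · intro z hz
          rcases pair_support hz with rfl | rfl
          · exact Setoid.refl' _ _
          · exact h0
        · funext z
          rcases u with u | u <;> rcases v with v | v <;> rcases z with z | z | z <;>
            simp [total, dlt]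
      · exact hrefl x
  | refl x => exact hrefl x
  | symm x y h ih =>
    obtain ⟨f, g, hf, hg, hf', hg', hb⟩ := ih (Setoid.symm' _ h0)
    exact ⟨f, g, hf, hg, fun z hz => Setoid.trans' _ h0 (hf' z hz),
      fun z hz => Setoid.trans' _ h0 (hg' z hz), hb.trans (add_comm _ _)⟩
  | trans x y z h1 h2 ih1 ih2 =>
    have h1' : glue p q x y := by rw [glue, Setoid.sup_eq_eqvGen]; exact h1
    have h2' : glue p q y z := by rw [glue, Setoid.sup_eq_eqvGen]; exact h2
    obtain ⟨f₁, g₁, hf₁, hg₁, hf₁', hg₁', hb₁⟩ := ih1 h1'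
    obtain ⟨f₂, g₂, hf₂, hg₂, hf₂', hg₂', hb₂⟩ := ih2 h2'
    refine ⟨f₁ + f₂, g₁ + g₂, hf₁.add hf₂, hg₁.add hg₂, ?_, ?_, ?_⟩
    · intro z hz
      by_cases h : f₁ z = 0
      · exact Setoid.trans' _ h1' (hf₂' z fun h' => hz (by simp [h, h']))
      · exact hf₁' z h
    · intro z hz
      by_cases h : g₁ z = 0
      · exact Setoid.trans' _ h1' (hg₂' z fun h' => hz (by simp [h, h']))
      · exact hg₁' z h
    · have h3 : dlt x + dlt z = (dlt x + dlt y) + (dlt y + dlt z) := by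
        have := dlt_self y
        rw [add_assoc, ← add_assoc (dlt y), this, zero_add]
      rw [h3, ← hb₁, ← hb₂]
      funext w
      rcases w with w | w | w <;> simp [total]
      ring

theorem sum_dlt_pair {α : Type*} [Fintype α] (a c b d : α) (F : α → α → ZMod 2) :
    ∑ x, ∑ y, (dlt a + dlt c) x * (dlt b + dlt d) y * F x y =
      F a b + F a d + F c b + F c d := by
  classical
  have h1 : ∀ x, ∑ y, (dlt a + dlt c) x * (dlt b + dlt d) y * F x y =
      (dlt a + dlt c) x * (F x b + F x d) := by
    intro x
    simp only [mul_assoc, ← Finset.mul_sum]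
    congr 1
    simp [dlt, add_mul, Finset.sum_add_distrib]
  simp only [h1]
  simp [dlt, add_mul, Finset.sum_add_distrib]
  ring

theorem before_ll (i i' : Fin k) :
    before (Sum.inl i : Fin k ⊕ Fin l) (Sum.inl i') = if i < i' then 1 else 0 := by
  simp [before, pos]

theorem before_lr (i : Fin k) (j : Fin l) :
    before (Sum.inl i : Fin k ⊕ Fin l) (Sum.inr j) = 1 := by
  refine if_pos ?_
  change (i : ℕ) < k + (l - 1 - (j : ℕ))
  omega

theorem before_rl (i : Fin k) (j : Fin l) :
    before (Sum.inr j : Fin k ⊕ Fin l) (Sum.inl i) = 0 := by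
  refine if_neg ?_
  change ¬ (k + (l - 1 - (j : ℕ)) < (i : ℕ))
  omega

theorem before_rr (j j' : Fin l) :
    before (Sum.inr j : Fin k ⊕ Fin l) (Sum.inr j') = if j' < j then 1 else 0 := by
  have : l - 1 - (j : ℕ) < l - 1 - (j' : ℕ) ↔ j' < j := by
    rw [Fin.lt_def]
    omega
  simp [before, pos, this]

theorem IsNonCrossing.vcomp {p : Diagram k l} {q : Diagram l m} (hp : p.IsNonCrossing)
    (hq : q.IsNonCrossing) : IsNonCrossing (vcomp p q : Diagram k m) := by
  intro a b c d hab hbc hcd hac hbd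
  by_contra hno
  change glue p q (ends a) (ends c) at hac
  change glue p q (ends b) (ends d) at hbd
  change ¬ glue p q (ends a) (ends b) at hno
  obtain ⟨f, g, hf, hg, hf', hg', h₁⟩ := exists_chain p q hac
  obtain ⟨f', g', hF, hG, hF', hG', h₂⟩ := exists_chain p q hbd
  have e1 := sum_before_eq_zero hp hf hF (fun x y hxy => by
    by_contra h
    exact hno ((glue p q).trans' (hf' x (left_ne_zero_of_mul h)) ((glue p q).trans'
      (glue_top p q hxy) ((glue p q).symm' (hF' y (right_ne_zero_of_mul h))))))
  have e2 := sum_before_eq_zero hq hg hG (fun x y hxy => by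
    by_contra h
    exact hno ((glue p q).trans' (hg' x (left_ne_zero_of_mul h)) ((glue p q).trans'
      (glue_bot p q hxy) ((glue p q).symm' (hG' y (right_ne_zero_of_mul h))))))
  have e3 : ∀ j, f (Sum.inr j) * f' (Sum.inr j) = 0 := by
    intro j
    by_contra h
    exact hno ((glue p q).trans' (hf' _ (left_ne_zero_of_mul h))
      ((glue p q).symm' (hF' _ (right_ne_zero_of_mul h))))
  have s1 := hf.sum
  have s2 := hF.sum
  have s3 := hg.sum
  have s4 := hG.sum
  have t1 : ∀ j, f (Sum.inr j) = g (Sum.inl j) := by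
    intro j
    have := congrFun h₁ (Sum.inr (Sum.inl j))
    rcases a with a | a <;> rcases c with c | c <;> simp [total, dlt, ends] at this <;>
      exact CharTwo.add_eq_zero.1 this
  have t2 : ∀ j, f' (Sum.inr j) = g' (Sum.inl j) := by
    intro j
    have := congrFun h₂ (Sum.inr (Sum.inl j))
    rcases b with b | b <;> rcases d with d | d <;> simp [total, dlt, ends] at this <;>
      exact CharTwo.add_eq_zero.1 this
  have u1 : ∀ z, (dlt a + dlt c) z = Sum.elim (fun i => f (Sum.inl i)) (fun i => g (Sum.inr i)) z := by
    intro z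
    have := congrFun h₁ (ends z)
    rcases z with z | z <;> rcases a with a | a <;> rcases c with c | c <;>
      simp [total, dlt, ends] at this ⊢ <;> exact this.symm
  have u2 : ∀ z, (dlt b + dlt d) z =
      Sum.elim (fun i => f' (Sum.inl i)) (fun i => g' (Sum.inr i)) z := by
    intro z
    have := congrFun h₂ (ends z)
    rcases z with z | z <;> rcases b with b | b <;> rcases d with d | d <;>
      simp [total, dlt, ends] at this ⊢ <;> exact this.symm
  have e4 := sum_dlt_pair a c b d before
  have v1 : before a b = 1 := by simp [before, hab]
  have v2 : before a d = 1 := by simp [before, hab.trans (hbc.trans hcd)]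
  have v3 : before c b = 0 := by simp [before, hbc.le]
  have v4 : before c d = 1 := by simp [before, hcd]
  rw [v1, v2, v3, v4] at e4
  simp only [u1, u2] at e4
  simp only [Fintype.sum_sum_type] at e1 e2 e4 s1 s2 s3 s4
  simp only [← t1, ← t2] at e2 s3 s4
  simp only [before_ll, before_lr, before_rl, before_rr, Sum.elim_inl, Sum.elim_inr, mul_one,
    mul_zero, Finset.sum_const_zero, zero_add, Finset.sum_add_distrib, ← Finset.sum_mul_sum]
    at e1 e2 e4
  have e5 : (∑ j, ∑ j', f (Sum.inr j) * f' (Sum.inr j') * (if j' < j then 1 else 0)) +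
      (∑ j, ∑ j', f (Sum.inr j) * f' (Sum.inr j') * (if j < j' then 1 else 0)) =
      (∑ j, f (Sum.inr j)) * ∑ j, f' (Sum.inr j) := by
    rw [Finset.sum_mul_sum, ← Finset.sum_add_distrib]
    refine Finset.sum_congr rfl fun j _ => ?_
    rw [← Finset.sum_add_distrib]
    refine Finset.sum_congr rfl fun j' _ => ?_
    rcases lt_trichotomy j j' with h | rfl | h
    · simp [h, h.le]
    · simp [e3]
    · simp [h, h.le]
  revert e1 e2 e4 e5 s1 s2 s3 s4
  generalize (∑ i, f (Sum.inl i)) = U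
  generalize (∑ i, f (Sum.inr i)) = M
  generalize (∑ i, g (Sum.inr i)) = V
  generalize (∑ i, f' (Sum.inl i)) = U'
  generalize (∑ i, f' (Sum.inr i)) = M'
  generalize (∑ i, g' (Sum.inr i)) = V'
  generalize (∑ i, ∑ i', f (Sum.inl i) * f' (Sum.inl i') * (if i < i' then 1 else 0)) = P
  generalize (∑ i, ∑ i', g (Sum.inr i) * g' (Sum.inr i') * (if i' < i then 1 else 0)) = Q
  generalize (∑ j, ∑ j', f (Sum.inr j) * f' (Sum.inr j') * (if j' < j then 1 else 0)) = R
  generalize (∑ j, ∑ j', f (Sum.inr j) * f' (Sum.inr j') * (if j < j' then 1 else 0)) = T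
  intro s1 s2 s3 s4 e1 e2 e4 e5
  rw [CharTwo.add_eq_zero] at s1 s2 s3 s4
  subst s1 s2 s3 s4
  revert U U' P Q R T
  decide

/-! ### Pairings -/

theorem IsPairing.reflect {p : Diagram k l} (hp : p.IsPairing) : IsPairing (reflect p) := by
  intro x
  rw [← hp x.swap, ← Set.ncard_image_of_injective _ (Equiv.sumComm _ _).injective]
  refine congrArg Set.ncard (Set.ext fun y => ?_)
  constructor
  · rintro ⟨z, hz, rfl⟩
    exact hz
  · intro h
    refine ⟨y.swap, ?_, by simp⟩
    change p x.swap y.swap.swap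
    simpa using h

theorem isPairing_id : IsPairing (idPart (Fin k)) := by
  intro x
  rw [Set.ncard_eq_two]
  refine ⟨Sum.inl (Sum.elim id id x), Sum.inr (Sum.elim id id x), by simp, ?_⟩
  ext y
  change Sum.elim id id x = Sum.elim id id y ↔ _
  rcases y with y | y <;> simp [eq_comm]

theorem IsPairing.tensor {p : Diagram k l} {p' : Diagram k' l'} (hp : p.IsPairing)
    (hp' : p'.IsPairing) : (tensor p p').IsPairing := by
  intro x
  rcases inLeft_cover x with ⟨a, rfl⟩ | ⟨a, rfl⟩
  · rw [← hp a, ← Set.ncard_image_of_injective {y | p a y} (inLeft_injective (k' := k') (l' := l'))]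
    refine congrArg Set.ncard (Set.ext fun y => ?_)
    rcases inLeft_cover y with ⟨b, rfl⟩ | ⟨b, rfl⟩
    · rw [inLeft_injective.mem_set_image]
      exact tensor_left
    · refine iff_of_false tensor_cross ?_
      rintro ⟨z, -, hz⟩
      exact inLeft_ne_inRight _ _ hz
  · rw [← hp' a, ← Set.ncard_image_of_injective {y | p' a y} (inRight_injective (k := k) (l := l))]
    refine congrArg Set.ncard (Set.ext fun y => ?_)
    rcases inLeft_cover y with ⟨b, rfl⟩ | ⟨b, rfl⟩
    · refine iff_of_false tensor_cross' ?_
      rintro ⟨z, -, hz⟩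
      exact inLeft_ne_inRight _ _ hz.symm
    · rw [inRight_injective.mem_set_image]
      exact tensor_right

/-- Auxiliary: the other point in the block of a point. -/
theorem IsPairing.exists_partner {p : Diagram k l} (hp : p.IsPairing) :
    ∃ s : Fin k ⊕ Fin l → Fin k ⊕ Fin l, ∀ x, s x ≠ x ∧ ∀ y, p x y ↔ y = x ∨ y = s x := by
  have : ∀ x, ∃ y, y ≠ x ∧ ∀ z, p x z ↔ z = x ∨ z = y := by
    intro x
    obtain ⟨u, v, huv, h⟩ := Set.ncard_eq_two.1 (hp x)
    have hx : x ∈ {y | p x y} := p.refl' x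
    have hz : ∀ z, p x z ↔ z = u ∨ z = v := fun z => by
      change z ∈ {y | p x y} ↔ _
      rw [h]
      rfl
    rw [h] at hx
    rcases hx with rfl | rfl
    · exact ⟨v, huv.symm, hz⟩
    · exact ⟨u, huv, fun z => (hz z).trans or_comm⟩
  choose s hs using this
  exact ⟨s, hs⟩

open Classical in
theorem IsPairing.even_closed {p : Diagram k l} (hp : p.IsPairing) {P : Fin k ⊕ Fin l → Prop}
    (hP : ∀ x y, p x y → P x → P y) :
    ∑ x, (if P x then 1 else 0 : ZMod 2) = 0 := by
  obtain ⟨s, hs⟩ := hp.exists_partner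
  have hps : ∀ x, p x (s x) := fun x => ((hs x).2 _).2 (Or.inr rfl)
  refine Finset.sum_involution (fun x _ => s x) ?_ (fun x _ _ => (hs x).1) (by simp) ?_
  · intro x _
    have : P (s x) ↔ P x := ⟨hP _ _ (p.symm' (hps x)), hP _ _ (hps x)⟩
    simp only [this]
    exact CharTwo.add_self_eq_zero _
  · intro x _
    rcases ((hs (s x)).2 x).1 (p.symm' (hps x)) with h | h
    · exact absurd h.symm (hs x).1
    · exact h.symm

theorem IsPairing.vcomp_le {p : Diagram k l} {q : Diagram l m} (hp : p.IsPairing)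
    (hq : q.IsPairing) (e : Fin k ⊕ Fin m) : {e' | (vcomp p q : Diagram k m) e e'}.ncard ≤ 2 := by
  classical
  obtain ⟨s, hs⟩ := hp.exists_partner
  obtain ⟨t, ht⟩ := hq.exists_partner
  let G : SimpleGraph (Fin k ⊕ Fin l ⊕ Fin m) := SimpleGraph.fromRel fun x y =>
    (∃ u, Sum.map id Sum.inl u = x ∧ Sum.map id Sum.inl (s u) = y) ∨
      (∃ u, Sum.inr u = x ∧ Sum.inr (t u) = y)
  have hss : ∀ u, s (s u) = u := by
    intro u
    have : p (s u) u := p.symm' (((hs u).2 _).2 (Or.inr rfl))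
    rcases ((hs (s u)).2 u).1 this with h | h
    · exact absurd h.symm (hs u).1
    · exact h.symm
  have htt : ∀ u, t (t u) = u := by
    intro u
    have : q (t u) u := q.symm' (((ht u).2 _).2 (Or.inr rfl))
    rcases ((ht (t u)).2 u).1 this with h | h
    · exact absurd h.symm (ht u).1
    · exact h.symm
  have hadj : ∀ x y, G.Adj x y → (∃ u, Sum.map id Sum.inl u = x ∧ Sum.map id Sum.inl (s u) = y) ∨
      (∃ u, Sum.inr u = x ∧ Sum.inr (t u) = y) := by
    intro x y h
    rcases h with ⟨-, (h | ⟨u, rfl, rfl⟩ | ⟨u, rfl, rfl⟩)⟩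
    · exact h
    · exact Or.inl ⟨s u, rfl, by rw [hss]⟩
    · exact Or.inr ⟨t u, rfl, by rw [htt]⟩
  have hreach : ∀ x y, glue p q x y ↔ G.Reachable x y := by
    intro x y
    constructor
    · intro h
      have hle : glue p q ≤ G.reachableSetoid := by
        refine sup_le (map_le_iff.2 ?_) (map_le_iff.2 ?_)
        · intro u v huv
          change G.Reachable _ _
          rcases ((hs u).2 v).1 huv with rfl | rfl
          · exact SimpleGraph.Reachable.refl _
          · refine SimpleGraph.Adj.reachable ⟨fun h => (hs u).1 (inj₄ h).symm, ?_⟩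
            exact Or.inl (Or.inl ⟨u, rfl, rfl⟩)
        · intro u v huv
          change G.Reachable _ _
          rcases ((ht u).2 v).1 huv with rfl | rfl
          · exact SimpleGraph.Reachable.refl _
          · refine SimpleGraph.Adj.reachable ⟨fun h => (ht u).1 (Sum.inr_injective h).symm, ?_⟩
            exact Or.inl (Or.inr ⟨u, rfl, rfl⟩)
      exact hle h
    · rintro ⟨w⟩
      induction w with
      | nil => exact Setoid.refl' _ _
      | cons h _ ih =>
        refine Setoid.trans' _ ?_ ih
        rcases hadj _ _ h with ⟨u, rfl, rfl⟩ | ⟨u, rfl, rfl⟩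
        · exact glue_top p q (((hs u).2 _).2 (Or.inr rfl))
        · exact glue_bot p q (((ht u).2 _).2 (Or.inr rfl))
  let C := G.connectedComponentMk (ends e)
  have hmem : ∀ x, x ∈ C ↔ glue p q (ends e) x := by
    intro x
    rw [hreach, SimpleGraph.reachable_comm]
    exact SimpleGraph.ConnectedComponent.eq
  let H := C.toSimpleGraph
  have hcard : Nat.card C ≤ Nat.card H.edgeSet + 1 := C.connected_toSimpleGraph.card_vert_le_card_edgeSet_add_one
  have hdeg : ∀ v : C, H.degree v + (if ∃ e', ends e' = v.1 then 1 else 0) ≤ 2 := by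
    have hT : ∀ (v : C) (T : Finset (Fin k ⊕ Fin l ⊕ Fin m)), (∀ y, G.Adj v.1 y → y ∈ T) →
        H.degree v ≤ T.card := by
      intro v T h
      rw [← SimpleGraph.card_neighborFinset_eq_degree,
        ← Finset.card_map (Function.Embedding.subtype _)]
      refine Finset.card_le_card fun y hy => ?_
      obtain ⟨w, hw, rfl⟩ := Finset.mem_map.1 hy
      exact h _ ((H.mem_neighborFinset v w).1 hw)
    rintro ⟨v | v | v, hv⟩
    · have h1 := hT ⟨Sum.inl v, hv⟩ {Sum.map id Sum.inl (s (Sum.inl v))} (by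
        intro y hy
        rcases hadj _ _ hy with ⟨u | u, hu, rfl⟩ | ⟨u, hu, rfl⟩ <;> simp at hu
        subst hu; simp)
      rw [Finset.card_singleton] at h1
      split_ifs <;> omega
    · have h1 := hT ⟨Sum.inr (Sum.inl v), hv⟩
        {Sum.map id Sum.inl (s (Sum.inr v)), Sum.inr (t (Sum.inl v))} (by
        intro y hy
        rcases hadj _ _ hy with ⟨u | u, hu, rfl⟩ | ⟨u | u, hu, rfl⟩ <;> simp at hu
        · subst hu; simp
        · subst hu; simp)
      have h2 := h1.trans Finset.card_le_two
      rw [if_neg]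
      · exact h2
      · rintro ⟨u | u, hu⟩ <;> simp [ends] at hu
    · have h1 := hT ⟨Sum.inr (Sum.inr v), hv⟩ {Sum.inr (t (Sum.inr v))} (by
        intro y hy
        rcases hadj _ _ hy with ⟨u | u, hu, rfl⟩ | ⟨u | u, hu, rfl⟩ <;> simp at hu
        subst hu; simp)
      rw [Finset.card_singleton] at h1
      split_ifs <;> omega
  have hsum := H.sum_degrees_eq_twice_card_edges
  have hext : ∑ v : C, (if ∃ e', ends e' = v.1 then 1 else 0) =
      {e' | (vcomp p q : Diagram k m) e e'}.ncard := by
    rw [Finset.sum_boole, Set.ncard_eq_toFinset_card', Nat.cast_id]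
    symm
    refine Finset.card_bij (fun e' he' => ⟨ends e', (hmem _).2 (Set.mem_toFinset.1 he')⟩) ?_ ?_ ?_
    · intro e' _
      exact Finset.mem_filter.2 ⟨Finset.mem_univ _, e', rfl⟩
    · intro e₁ _ e₂ _ h
      exact inj₃ (congrArg Subtype.val h)
    · rintro ⟨v, hv⟩ h
      obtain ⟨e', rfl⟩ := (Finset.mem_filter.1 h).2
      exact ⟨e', Set.mem_toFinset.2 ((hmem _).1 hv), rfl⟩
  have := Finset.sum_le_sum fun v (_ : v ∈ Finset.univ) => hdeg v
  rw [Finset.sum_add_distrib, hsum, hext] at this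
  simp only [Finset.sum_const, Finset.card_univ, smul_eq_mul] at this
  rw [Nat.card_eq_fintype_card, Nat.card_eq_fintype_card, ← SimpleGraph.edgeFinset_card] at hcard
  omega

theorem IsPairing.vcomp {p : Diagram k l} {q : Diagram l m} (hp : p.IsPairing)
    (hq : q.IsPairing) : IsPairing (vcomp p q : Diagram k m) := by
  classical
  intro e
  have h2 := hp.vcomp_le hq e
  have h1 : 0 < {e' | (PartitionCat.vcomp p q : Diagram k m) e e'}.ncard :=
    (Set.ncard_pos (Set.toFinite _)).2 ⟨e, (PartitionCat.vcomp p q).refl' e⟩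
  have hev : (({e' | (PartitionCat.vcomp p q : Diagram k m) e e'}.ncard : ℕ) : ZMod 2) = 0 := by
    have e1 := hp.even_closed (P := fun x => glue p q (ends e) (Sum.map id Sum.inl x))
      (fun x y hxy h => (glue p q).trans' h (glue_top p q hxy))
    have e2 := hq.even_closed (P := fun x => glue p q (ends e) (Sum.inr x))
      (fun x y hxy h => (glue p q).trans' h (glue_bot p q hxy))
    have e3 := congrArg₂ (· + ·) e1 e2
    simp only [Fintype.sum_sum_type, add_zero] at e3
    rw [Set.ncard_eq_toFinset_card', Set.toFinset_ofPred, ← Finset.sum_boole,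
      Fintype.sum_sum_type]
    have h0 := CharTwo.add_self_eq_zero
      (∑ j : Fin l, if glue p q (ends e) (Sum.inr (Sum.inl j)) then 1 else 0 : ZMod 2)
    have h3 : ∀ x y z : ZMod 2, y + y = 0 → x + z = (x + y) + (y + z) := by decide
    exact (h3 _ _ _ h0).trans e3
  rw [ZMod.natCast_eq_zero_iff] at hev
  omega

end Diagram
end PartitionCat

/-! ## The categories of partitions -/

namespace PartitionCat

open CategoryTheory MonoidalCategory

/-- A class of partitions that contains the identity partitions and is stable under composition,
tensor product and reflection. -/
structure DiagramClass where
  mem : ∀ {k l : ℕ}, Diagram k l → Prop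
  id_mem : ∀ k, mem (idPart (Fin k) : Diagram k k)
  vcomp_mem : ∀ {k l m : ℕ} {p : Diagram k l} {q : Diagram l m}, mem p → mem q →
    mem (vcomp p q : Diagram k m)
  tensor_mem : ∀ {k l k' l' : ℕ} {p : Diagram k l} {p' : Diagram k' l'}, mem p → mem p' →
    mem (p.tensor p')
  reflect_mem : ∀ {k l : ℕ} {p : Diagram k l}, mem p → mem (reflect p : Diagram l k)

/-- The class of all non-crossing partitions. -/
def nonCrossing : DiagramClass where
  mem p := p.IsNonCrossing
  id_mem _ := Diagram.isNonCrossing_id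
  vcomp_mem hp hq := hp.vcomp hq
  tensor_mem hp hq := hp.tensor hq
  reflect_mem hp := hp.reflect

/-- The class of all non-crossing pairings. -/
def nonCrossingPairing : DiagramClass where
  mem p := p.IsNonCrossing ∧ p.IsPairing
  id_mem _ := ⟨Diagram.isNonCrossing_id, Diagram.isPairing_id⟩
  vcomp_mem hp hq := ⟨hp.1.vcomp hq.1, hp.2.vcomp hq.2⟩
  tensor_mem hp hq := ⟨hp.1.tensor hq.1, hp.2.tensor hq.2⟩
  reflect_mem hp := ⟨hp.1.reflect, hp.2.reflect⟩

namespace DiagramClass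

variable (K : DiagramClass) {k l m k' l' m' : ℕ}

/-- The partitions of the class `K` with `k` upper and `l` lower points. -/
abbrev Part (k l : ℕ) : Type := {p : Diagram k l // K.mem p}

/-- Formal complex linear combinations of partitions of the class `K`. -/
abbrev Mor (k l : ℕ) : Type := K.Part k l →₀ ℂ

variable {K}

/-- The identity partition. -/
def Part.one (k : ℕ) : K.Part k k := ⟨idPart (Fin k), K.id_mem k⟩

/-- Composition of partitions. -/
def Part.comp (p : K.Part k l) (q : K.Part l m) : K.Part k m :=
  ⟨vcomp p.1 q.1, K.vcomp_mem p.2 q.2⟩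

/-- Tensor product of partitions. -/
def Part.tensor (p : K.Part k l) (q : K.Part k' l') : K.Part (k + k') (l + l') :=
  ⟨p.1.tensor q.1, K.tensor_mem p.2 q.2⟩

/-- Involution of partitions. -/
def Part.star (p : K.Part k l) : K.Part l k :=
  ⟨reflect p.1, K.reflect_mem p.2⟩

variable (K)

/-- The bilinear composition: on partitions, `p` and `q` are composed and every block without
upper and lower points is replaced by the factor `N`. -/
noncomputable def comp (N : ℝ) : K.Mor k l →ₗ[ℂ] K.Mor l m →ₗ[ℂ] K.Mor k m :=
  Finsupp.linearCombination ℂ fun p : K.Part k l =>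
    Finsupp.linearCombination ℂ fun q : K.Part l m =>
      Finsupp.single (p.comp q) ((N : ℂ) ^ loops p.1 q.1)

/-- The bilinear tensor product. -/
noncomputable def tens : K.Mor k l →ₗ[ℂ] K.Mor k' l' →ₗ[ℂ] K.Mor (k + k') (l + l') :=
  Finsupp.linearCombination ℂ fun p : K.Part k l =>
    Finsupp.linearCombination ℂ fun q : K.Part k' l' => Finsupp.single (p.tensor q) (1 : ℂ)

/-- The conjugate-linear involution. -/
noncomputable def adj (f : K.Mor k l) : K.Mor l k :=
  Finsupp.mapDomain Part.star (f.mapRange (starRingEnd ℂ) (map_zero _))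

variable {K}

theorem comp_single (N : ℝ) (p : K.Part k l) (q : K.Part l m) (a b : ℂ) :
    K.comp N (Finsupp.single p a) (Finsupp.single q b) =
      Finsupp.single (p.comp q) (a * b * (N : ℂ) ^ loops p.1 q.1) := by
  rw [comp, Finsupp.linearCombination_single, LinearMap.smul_apply,
    Finsupp.linearCombination_single, Finsupp.smul_single, Finsupp.smul_single, smul_eq_mul,
    smul_eq_mul, mul_assoc]

theorem tens_single (p : K.Part k l) (q : K.Part k' l') (a b : ℂ) :
    K.tens (Finsupp.single p a) (Finsupp.single q b) = Finsupp.single (p.tensor q) (a * b) := by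
  simp [tens, Finsupp.linearCombination_single]

theorem adj_single (p : K.Part k l) (a : ℂ) :
    K.adj (Finsupp.single p a) = Finsupp.single p.star (starRingEnd ℂ a) := by
  simp [adj]

theorem adj_add (f g : K.Mor k l) : K.adj (f + g) = K.adj f + K.adj g := by
  unfold adj
  rw [Finsupp.mapRange_add (fun _ _ => map_add _ _ _), Finsupp.mapDomain_add]

theorem adj_zero : K.adj (0 : K.Mor k l) = 0 := by
  simp [adj]

end DiagramClass

open DiagramClass

/-- The category whose objects are the natural numbers and whose morphisms `k ⟶ l` are the formal
linear combinations of partitions of the class `K` with `k` upper and `l` lower points; a block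
lost in a composition contributes the factor `N`. -/
@[ext]
structure PartCat (K : DiagramClass) (N : ℝ) where
  /-- The number of points. -/
  pts : ℕ

namespace PartCat

variable {K : DiagramClass} {N : ℝ}

noncomputable instance : Category (PartCat K N) where
  Hom X Y := K.Mor X.pts Y.pts
  id X := Finsupp.single (Part.one X.pts) 1
  comp f g := K.comp N f g
  id_comp {X Y} f := by
    induction f using Finsupp.induction_linear with
    | zero => exact map_zero _
    | add f g hf hg => rw [map_add, hf, hg]
    | single p a =>
      rw [comp_single]
      have h1 : Part.comp (Part.one _) p = p := Subtype.ext (id_vcomp p.1)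
      have h2 : loops (Part.one X.pts : K.Part _ _).1 p.1 = 0 := loops_id_left p.1
      rw [h1, h2, pow_zero, one_mul, mul_one]
  comp_id {X Y} f := by
    induction f using Finsupp.induction_linear with
    | zero => simp
    | add f g hf hg => rw [map_add, LinearMap.add_apply, hf, hg]
    | single p a =>
      rw [comp_single]
      have h1 : Part.comp p (Part.one _) = p := Subtype.ext (vcomp_id p.1)
      have h2 : loops p.1 (Part.one Y.pts : K.Part _ _).1 = 0 := loops_id_right p.1
      rw [h1, h2, pow_zero, mul_one, mul_one]
  assoc f g h := by
    induction f using Finsupp.induction_linear with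
    | zero => simp
    | add f f' hf hf' => simp only [map_add, LinearMap.add_apply, hf, hf']
    | single p a =>
      induction g using Finsupp.induction_linear with
      | zero => simp
      | add g g' hg hg' => simp only [map_add, LinearMap.add_apply, hg, hg']
      | single q b =>
        induction h using Finsupp.induction_linear with
        | zero => simp
        | add h h' hh hh' => simp only [map_add, hh, hh']
        | single r c =>
          simp only [comp_single]
          have h1 : (p.comp q).comp r = p.comp (q.comp r) := Subtype.ext (vcomp_assoc p.1 q.1 r.1)
          have h2 : loops p.1 q.1 + loops (p.comp q).1 r.1 =
            loops q.1 r.1 + loops p.1 (q.comp r).1 := loops_assoc p.1 q.1 r.1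
          rw [h1]
          congr 1
          calc a * b * (N : ℂ) ^ loops p.1 q.1 * c * (N : ℂ) ^ loops (p.comp q).1 r.1
              = a * b * c * (N : ℂ) ^ (loops p.1 q.1 + loops (p.comp q).1 r.1) := by
                rw [pow_add]; ring
            _ = _ := by rw [h2, pow_add]; ring

/-- The morphism of the category given by a linear combination of partitions. -/
def ofMor {X Y : PartCat K N} (f : K.Mor X.pts Y.pts) : X ⟶ Y := f

/-- A partition, as a morphism. -/
noncomputable def ofPart {X Y : PartCat K N} (p : K.Part X.pts Y.pts) : X ⟶ Y :=
  ofMor (Finsupp.single p 1)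

noncomputable instance : Preadditive (PartCat K N) where
  homGroup X Y := inferInstanceAs (AddCommGroup (K.Mor X.pts Y.pts))
  add_comp _ _ _ f f' g := LinearMap.congr_fun ((K.comp N).map_add f f') g
  comp_add _ _ _ f g g' := (K.comp N f).map_add g g'

noncomputable instance : Linear ℂ (PartCat K N) where
  homModule X Y := inferInstanceAs (Module ℂ (K.Mor X.pts Y.pts))
  smul_comp _ _ _ r f g := LinearMap.congr_fun ((K.comp N).map_smul r f) g
  comp_smul _ _ _ f r g := (K.comp N f).map_smul r g

/-- Induction principle: an additive property of morphisms holds if it holds for multiples of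
partitions. -/
theorem hom_induction {X Y : PartCat K N} {P : (X ⟶ Y) → Prop} (f : X ⟶ Y) (h0 : P 0)
    (hadd : ∀ f g, P f → P g → P (f + g))
    (hs : ∀ (p : K.Part X.pts Y.pts) (a : ℂ), P (ofMor (Finsupp.single p a))) : P f :=
  Finsupp.induction_linear (motive := P) f h0 hadd hs

noncomputable instance : MonoidalCategoryStruct (PartCat K N) where
  tensorObj X Y := ⟨X.pts + Y.pts⟩
  tensorHom f g := K.tens f g
  whiskerLeft X _ _ f := K.tens (Finsupp.single (Part.one X.pts) 1) f
  whiskerRight f Y := K.tens f (Finsupp.single (Part.one Y.pts) 1)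
  tensorUnit := ⟨0⟩
  associator X Y Z := eqToIso (congrArg mk (Nat.add_assoc X.pts Y.pts Z.pts))
  leftUnitor X := eqToIso (congrArg mk (Nat.zero_add X.pts))
  rightUnitor X := eqToIso (congrArg mk (Nat.add_zero X.pts))

theorem tensor_add {X Y X' Y' : PartCat K N} (f : X ⟶ Y) (g g' : X' ⟶ Y') :
    f ⊗ₘ (g + g') = (f ⊗ₘ g) + (f ⊗ₘ g') := (K.tens f).map_add g g'

theorem add_tensor {X Y X' Y' : PartCat K N} (f f' : X ⟶ Y) (g : X' ⟶ Y') :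
    (f + f') ⊗ₘ g = (f ⊗ₘ g) + (f' ⊗ₘ g) := by
  change K.tens (f + f') g = K.tens f g + K.tens f' g
  rw [map_add, LinearMap.add_apply]

theorem tensor_smul {X Y X' Y' : PartCat K N} (f : X ⟶ Y) (r : ℂ) (g : X' ⟶ Y') :
    f ⊗ₘ (r • g) = r • (f ⊗ₘ g) := (K.tens f).map_smul r g

theorem smul_tensor {X Y X' Y' : PartCat K N} (r : ℂ) (f : X ⟶ Y) (g : X' ⟶ Y') :
    (r • f) ⊗ₘ g = r • (f ⊗ₘ g) := by
  change K.tens (r • f) g = r • K.tens f g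
  rw [map_smul, LinearMap.smul_apply]

theorem tensor_zero {X Y X' Y' : PartCat K N} (f : X ⟶ Y) :
    f ⊗ₘ (0 : X' ⟶ Y') = 0 := (K.tens f).map_zero

theorem zero_tensor {X Y X' Y' : PartCat K N} (g : X' ⟶ Y') :
    (0 : X ⟶ Y) ⊗ₘ g = 0 := by
  change K.tens 0 g = 0
  rw [map_zero, LinearMap.zero_apply]

theorem single_comp_single {X Y Z : PartCat K N} (p : K.Part X.pts Y.pts) (q : K.Part Y.pts Z.pts)
    (a b : ℂ) : (ofMor (Finsupp.single p a) : X ⟶ Y) ≫ (ofMor (Finsupp.single q b) : Y ⟶ Z) =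
      ofMor (Finsupp.single (p.comp q) (a * b * (N : ℂ) ^ loops p.1 q.1)) :=
  comp_single N p q a b

theorem single_tensor_single {X Y X' Y' : PartCat K N} (p : K.Part X.pts Y.pts)
    (q : K.Part X'.pts Y'.pts) (a b : ℂ) :
    (ofMor (Finsupp.single p a) : X ⟶ Y) ⊗ₘ (ofMor (Finsupp.single q b) : X' ⟶ Y') =
      ofMor (X := X ⊗ X') (Y := Y ⊗ Y') (Finsupp.single (p.tensor q) (a * b)) :=
  tens_single p q a b

theorem id_tensor_id (X Y : PartCat K N) : 𝟙 X ⊗ₘ 𝟙 Y = 𝟙 (X ⊗ Y) := by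
  refine (single_tensor_single (Part.one X.pts) (Part.one Y.pts) 1 1).trans ?_
  rw [mul_one]
  exact congrArg (fun p => (Finsupp.single p 1 : K.Mor (X.pts + Y.pts) (X.pts + Y.pts)))
    (Subtype.ext Diagram.tensor_id)

theorem eqToHom_tensor_eqToHom {X X' Y Y' : PartCat K N} (h : X = X') (h' : Y = Y') :
    eqToHom h ⊗ₘ eqToHom h' = eqToHom (h ▸ h' ▸ rfl : X ⊗ Y = X' ⊗ Y') := by
  subst h h'
  exact id_tensor_id X Y

theorem tensor_comp {X₁ Y₁ Z₁ X₂ Y₂ Z₂ : PartCat K N} (f₁ : X₁ ⟶ Y₁) (f₂ : X₂ ⟶ Y₂) (g₁ : Y₁ ⟶ Z₁)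
    (g₂ : Y₂ ⟶ Z₂) : (f₁ ⊗ₘ f₂) ≫ (g₁ ⊗ₘ g₂) = (f₁ ≫ g₁) ⊗ₘ (f₂ ≫ g₂) := by
  induction f₁ using hom_induction with
  | h0 => simp only [zero_tensor, Limits.zero_comp]
  | hadd f g hf hg => simp only [add_tensor, Preadditive.add_comp, hf, hg]
  | hs p a =>
  induction f₂ using hom_induction with
  | h0 => simp only [tensor_zero, Limits.zero_comp]
  | hadd f g hf hg => simp only [tensor_add, Preadditive.add_comp, hf, hg]
  | hs p' a' =>
  induction g₁ using hom_induction with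
  | h0 => simp only [zero_tensor, Limits.comp_zero]
  | hadd f g hf hg => simp only [add_tensor, Preadditive.comp_add, hf, hg]
  | hs q b =>
  induction g₂ using hom_induction with
  | h0 => simp only [tensor_zero, Limits.comp_zero]
  | hadd f g hf hg => simp only [tensor_add, Preadditive.comp_add, hf, hg]
  | hs q' b' =>
    rw [single_tensor_single, single_tensor_single, single_comp_single, single_comp_single,
      single_comp_single]
    refine Eq.trans ?_ (single_tensor_single _ _ _ _).symm
    have h1 : (p.tensor p').comp (q.tensor q') = (p.comp q).tensor (p'.comp q') :=
      Subtype.ext (Diagram.vcomp_tensor p.1 q.1 p'.1 q'.1)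
    have h2 : loops (p.tensor p').1 (q.tensor q').1 = loops p.1 q.1 + loops p'.1 q'.1 :=
      Diagram.loops_tensor p.1 q.1 p'.1 q'.1
    rw [h1, h2, pow_add]
    congr 2
    ring

/-- Equality of the numbers of points as a relabelling of partitions. -/
theorem single_comp_eqToHom {X Y Z : PartCat K N} (h : Y = Z) (p : K.Part X.pts Y.pts) (a : ℂ)
    (q : K.Part X.pts Z.pts) (hq : q.1 = p.1.map (Sum.map id (Fin.cast (congrArg pts h)))) :
    (ofMor (Finsupp.single p a) : X ⟶ Y) ≫ eqToHom h = ofMor (Finsupp.single q a) := by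
  subst h
  rw [eqToHom_refl, Category.comp_id]
  congr 2
  refine Subtype.ext (Eq.trans ?_ hq.symm)
  refine ((map_congr _ ?_).trans (map_id _)).symm
  rintro (x | x) <;> rfl

theorem eqToHom_comp_single {X Y Z : PartCat K N} (h : X = Y) (p : K.Part Y.pts Z.pts) (a : ℂ)
    (q : K.Part X.pts Z.pts) (hq : q.1 = p.1.map (Sum.map (Fin.cast (congrArg pts h.symm)) id)) :
    eqToHom h ≫ (ofMor (Finsupp.single p a) : Y ⟶ Z) = ofMor (Finsupp.single q a) := by
  subst h
  rw [eqToHom_refl, Category.id_comp]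
  congr 2
  refine Subtype.ext (Eq.trans ?_ hq.symm)
  refine ((map_congr _ ?_).trans (map_id _)).symm
  rintro (x | x) <;> rfl

/-- Auxiliary: relabelling the lower points. -/
theorem exists_cast {X Y Z : PartCat K N} (h : Y = Z) (p : K.Part X.pts Y.pts) :
    ∃ q : K.Part X.pts Z.pts, q.1 = p.1.map (Sum.map id (Fin.cast (congrArg pts h))) := by
  subst h
  refine ⟨p, ((map_congr _ ?_).trans (map_id _)).symm⟩
  rintro (x | x) <;> rfl

theorem cast_natural {X X' Y Y' : PartCat K N} (hX : X = X') (hY : Y = Y')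
    (p : K.Part X.pts Y.pts) (p' : K.Part X'.pts Y'.pts) (a : ℂ)
    (h : p.1.map (Sum.map id (Fin.cast (congrArg pts hY))) =
      p'.1.map (Sum.map (Fin.cast (congrArg pts hX.symm)) id)) :
    (ofMor (Finsupp.single p a) : X ⟶ Y) ≫ eqToHom hY =
      eqToHom hX ≫ (ofMor (Finsupp.single p' a) : X' ⟶ Y') := by
  obtain ⟨q, hq⟩ := exists_cast hY p
  rw [single_comp_eqToHom hY p a q hq, eqToHom_comp_single hX p' a q (hq.trans h)]

theorem associator_hom (X Y Z : PartCat K N) :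
    (α_ X Y Z).hom = eqToHom (congrArg mk (Nat.add_assoc X.pts Y.pts Z.pts) :
      (X ⊗ Y) ⊗ Z = X ⊗ Y ⊗ Z) := rfl

theorem leftUnitor_hom (X : PartCat K N) :
    (λ_ X).hom = eqToHom (congrArg mk (Nat.zero_add X.pts) : 𝟙_ (PartCat K N) ⊗ X = X) := rfl

theorem rightUnitor_hom (X : PartCat K N) :
    (ρ_ X).hom = eqToHom (congrArg mk (Nat.add_zero X.pts) : X ⊗ 𝟙_ (PartCat K N) = X) := rfl

noncomputable instance : MonoidalCategory (PartCat K N) :=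
  MonoidalCategory.ofTensorHom
    (id_tensorHom_id := id_tensor_id)
    (id_tensorHom := fun _ _ _ _ => rfl)
    (tensorHom_id := fun _ _ => rfl)
    (tensorHom_comp_tensorHom := tensor_comp)
    (associator_naturality := fun {X₁ X₂ X₃ Y₁ Y₂ Y₃} f₁ f₂ f₃ => by
      induction f₁ using hom_induction with
      | h0 => simp only [zero_tensor, Limits.zero_comp, Limits.comp_zero]
      | hadd f g hf hg => simp only [add_tensor, Preadditive.add_comp, Preadditive.comp_add, hf, hg]
      | hs p a =>
      induction f₂ using hom_induction with
      | h0 => simp only [tensor_zero, zero_tensor, Limits.zero_comp, Limits.comp_zero]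
      | hadd f g hf hg =>
        simp only [tensor_add, add_tensor, Preadditive.add_comp, Preadditive.comp_add, hf, hg]
      | hs q b =>
      induction f₃ using hom_induction with
      | h0 => simp only [tensor_zero, Limits.zero_comp, Limits.comp_zero]
      | hadd f g hf hg =>
        simp only [tensor_add, Preadditive.add_comp, Preadditive.comp_add, hf, hg]
      | hs r c =>
        rw [single_tensor_single, single_tensor_single, single_tensor_single, single_tensor_single,
          mul_assoc]
        exact cast_natural (X := (X₁ ⊗ X₂) ⊗ X₃) (X' := X₁ ⊗ X₂ ⊗ X₃) (Y := (Y₁ ⊗ Y₂) ⊗ Y₃)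
          (Y' := Y₁ ⊗ Y₂ ⊗ Y₃) (congrArg mk (Nat.add_assoc _ _ _))
          (congrArg mk (Nat.add_assoc _ _ _)) _ _ _ (Diagram.tensor_assoc p.1 q.1 r.1))
    (leftUnitor_naturality := fun {X Y} f => by
      induction f using hom_induction with
      | h0 => simp only [tensor_zero, Limits.zero_comp, Limits.comp_zero]
      | hadd f g hf hg =>
        simp only [tensor_add, Preadditive.add_comp, Preadditive.comp_add, hf, hg]
      | hs p a =>
        have e1 := single_tensor_single (X := 𝟙_ (PartCat K N)) (Y := 𝟙_ (PartCat K N))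
          (Part.one 0) p 1 a
        rw [one_mul] at e1
        refine (congrArg (· ≫ _) e1).trans ?_
        exact cast_natural (X := 𝟙_ _ ⊗ X) (X' := X) (Y := 𝟙_ _ ⊗ Y)
          (Y' := Y) (congrArg mk (Nat.zero_add _)) (congrArg mk (Nat.zero_add _)) _ _ _
          (Diagram.empty_tensor p.1))
    (rightUnitor_naturality := fun {X Y} f => by
      induction f using hom_induction with
      | h0 => simp only [zero_tensor, Limits.zero_comp, Limits.comp_zero]
      | hadd f g hf hg =>
        simp only [add_tensor, Preadditive.add_comp, Preadditive.comp_add, hf, hg]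
      | hs p a =>
        have e1 := single_tensor_single (X' := 𝟙_ (PartCat K N)) (Y' := 𝟙_ (PartCat K N))
          p (Part.one 0) a 1
        rw [mul_one] at e1
        refine (congrArg (· ≫ _) e1).trans ?_
        exact cast_natural (X := X ⊗ 𝟙_ _) (X' := X) (Y := Y ⊗ 𝟙_ _)
          (Y' := Y) (congrArg mk (Nat.add_zero _)) (congrArg mk (Nat.add_zero _)) _ _ _
          (Diagram.tensor_empty p.1))
    (pentagon := fun W X Y Z => by
      simp only [associator_hom, ← eqToHom_refl _ rfl, eqToHom_tensor_eqToHom, eqToHom_trans])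
    (triangle := fun X Y => by
      simp only [associator_hom, leftUnitor_hom, rightUnitor_hom, ← eqToHom_refl _ rfl,
        eqToHom_tensor_eqToHom, eqToHom_trans])

instance : MonoidalPreadditive (PartCat K N) where
  whiskerLeft_zero {X _ _} := tensor_zero (𝟙 X)
  zero_whiskerRight {X _ _} := zero_tensor (𝟙 X)
  whiskerLeft_add {X _ _} f g := tensor_add (𝟙 X) f g
  add_whiskerRight {X _ _} f g := add_tensor f g (𝟙 X)

instance : MonoidalLinear ℂ (PartCat K N) where
  whiskerLeft_smul X _ _ r f := tensor_smul (𝟙 X) r f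
  smul_whiskerRight r _ _ f X := smul_tensor r f (𝟙 X)

end PartCat

/-- The involution of a monoidal `*`-category over `ℂ`. -/
class MonoidalStarCategory (C : Type*) [Category C] [Preadditive C] [Linear ℂ C]
    [MonoidalCategory C] where
  /-- The involution on morphisms. -/
  dagger {X Y : C} (f : X ⟶ Y) : Y ⟶ X
  dagger_dagger {X Y : C} (f : X ⟶ Y) : dagger (dagger f) = f
  dagger_id (X : C) : dagger (𝟙 X) = 𝟙 X
  dagger_comp {X Y Z : C} (f : X ⟶ Y) (g : Y ⟶ Z) : dagger (f ≫ g) = dagger g ≫ dagger f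
  dagger_add {X Y : C} (f g : X ⟶ Y) : dagger (f + g) = dagger f + dagger g
  dagger_smul {X Y : C} (r : ℂ) (f : X ⟶ Y) : dagger (r • f) = (starRingEnd ℂ r) • dagger f
  dagger_tensorHom {X Y X' Y' : C} (f : X ⟶ Y) (g : X' ⟶ Y') :
    dagger (f ⊗ₘ g) = dagger f ⊗ₘ dagger g
  dagger_associator (X Y Z : C) : dagger (α_ X Y Z).hom = (α_ X Y Z).inv
  dagger_leftUnitor (X : C) : dagger (λ_ X).hom = (λ_ X).inv
  dagger_rightUnitor (X : C) : dagger (ρ_ X).hom = (ρ_ X).inv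

namespace PartCat

variable {K : DiagramClass} {N : ℝ}

theorem adj_id (X : PartCat K N) : (K.adj (𝟙 X) : X ⟶ X) = 𝟙 X := by
  refine (adj_single (Part.one X.pts) 1).trans ?_
  rw [map_one]
  exact congrArg (fun p => (Finsupp.single p 1 : K.Mor X.pts X.pts)) (Subtype.ext reflect_id)

theorem adj_eqToHom {X Y : PartCat K N} (h : X = Y) :
    (K.adj (eqToHom h) : Y ⟶ X) = eqToHom h.symm := by
  subst h
  exact adj_id X

noncomputable instance : MonoidalStarCategory (PartCat K N) where
  dagger f := K.adj f
  dagger_dagger f := by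
    induction f using hom_induction with
    | h0 => exact (congrArg K.adj adj_zero).trans adj_zero
    | hadd f g hf hg => exact (congrArg K.adj (adj_add f g)).trans ((adj_add _ _).trans
        (congrArg₂ (· + ·) hf hg))
    | hs p a =>
      refine (congrArg K.adj (adj_single p a)).trans ((adj_single _ _).trans ?_)
      rw [Complex.conj_conj]
      exact congrArg (fun q => Finsupp.single q a) (Subtype.ext (reflect_reflect p.1))
  dagger_id X := adj_id X
  dagger_comp {X Y Z} f g := by
    change K.adj (K.comp N f g) = K.comp N (K.adj g) (K.adj f)
    induction f using hom_induction with
    | h0 =>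
      have : K.comp N (0 : K.Mor X.pts Y.pts) g = 0 := by simp
      refine (congrArg K.adj this).trans ?_
      rw [adj_zero]
      exact ((congrArg _ adj_zero).trans (map_zero _)).symm
    | hadd f f' hf hf' =>
      have : K.comp N (f + f' : K.Mor X.pts Y.pts) g = K.comp N f g + K.comp N f' g := by
        rw [map_add, LinearMap.add_apply]
      refine (congrArg K.adj this).trans ((adj_add _ _).trans ?_)
      rw [hf, hf']
      exact ((congrArg _ (adj_add f f')).trans (map_add _ _ _)).symm
    | hs p a =>
    induction g using hom_induction with
    | h0 =>
      refine (congrArg K.adj (map_zero _)).trans ?_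
      rw [adj_zero]
      refine ((congrArg (fun h => K.comp N h _) adj_zero).trans ?_).symm
      simp
    | hadd g g' hg hg' =>
      refine (congrArg K.adj (map_add _ _ _)).trans ((adj_add _ _).trans ?_)
      rw [hg, hg']
      refine ((congrArg (fun h => K.comp N h _) (adj_add g g')).trans ?_).symm
      rw [map_add, LinearMap.add_apply]
    | hs q b =>
      refine (congrArg K.adj (comp_single N p q a b)).trans ((adj_single _ _).trans ?_)
      refine Eq.trans ?_ ((congrArg₂ (fun h h' => K.comp N h h') (adj_single q b)
        (adj_single p a)).trans (comp_single N _ _ _ _)).symm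
      have h1 : (p.comp q).star = q.star.comp p.star := Subtype.ext (reflect_vcomp p.1 q.1)
      have h2 : loops q.star.1 p.star.1 = loops p.1 q.1 := loops_reflect p.1 q.1
      rw [h1, h2]
      congr 1
      simp [mul_comm]
  dagger_add f g := adj_add f g
  dagger_smul r f := by
    induction f using hom_induction with
    | h0 =>
      rw [smul_zero]
      refine adj_zero.trans ?_
      exact ((congrArg (_ • ·) adj_zero).trans (smul_zero _)).symm
    | hadd f g hf hg =>
      rw [smul_add]
      refine (adj_add _ _).trans ((congrArg₂ (· + ·) hf hg).trans ?_)
      exact ((congrArg (_ • ·) (adj_add f g)).trans (smul_add _ _ _)).symm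
    | hs p a =>
      refine (congrArg K.adj (Finsupp.smul_single r p a)).trans ((adj_single _ _).trans ?_)
      refine Eq.trans ?_ (congrArg ((starRingEnd ℂ r) • ·) (adj_single p a)).symm
      refine Eq.trans ?_ (Finsupp.smul_single _ _ _).symm
      simp
  dagger_tensorHom {X Y X' Y'} f g := by
    change K.adj (K.tens f g) = K.tens (K.adj f) (K.adj g)
    induction f using hom_induction with
    | h0 =>
      have : K.tens (0 : K.Mor X.pts Y.pts) g = 0 := by simp
      refine (congrArg K.adj this).trans ?_
      rw [adj_zero]
      refine ((congrArg (fun h => K.tens h _) adj_zero).trans ?_).symm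
      simp
    | hadd f f' hf hf' =>
      have : K.tens (f + f' : K.Mor X.pts Y.pts) g = K.tens f g + K.tens f' g := by
        rw [map_add, LinearMap.add_apply]
      refine (congrArg K.adj this).trans ((adj_add _ _).trans ?_)
      rw [hf, hf']
      refine ((congrArg (fun h => K.tens h _) (adj_add f f')).trans ?_).symm
      rw [map_add, LinearMap.add_apply]
    | hs p a =>
    induction g using hom_induction with
    | h0 =>
      refine (congrArg K.adj (map_zero _)).trans ?_
      rw [adj_zero]
      exact ((congrArg _ adj_zero).trans (map_zero _)).symm
    | hadd g g' hg hg' =>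
      refine (congrArg K.adj (map_add _ _ _)).trans ((adj_add _ _).trans ?_)
      rw [hg, hg']
      exact ((congrArg _ (adj_add g g')).trans (map_add _ _ _)).symm
    | hs q b =>
      refine (congrArg K.adj (tens_single p q a b)).trans ((adj_single _ _).trans ?_)
      refine Eq.trans ?_ ((congrArg₂ (fun h h' => K.tens h h') (adj_single p a)
        (adj_single q b)).trans (tens_single _ _ _ _)).symm
      have h1 : (p.tensor q).star = p.star.tensor q.star :=
        Subtype.ext (Diagram.reflect_tensor p.1 q.1)
      rw [h1, map_mul]
  dagger_associator X Y Z := adj_eqToHom (congrArg mk (Nat.add_assoc X.pts Y.pts Z.pts))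
  dagger_leftUnitor X := adj_eqToHom (congrArg mk (Nat.zero_add X.pts))
  dagger_rightUnitor X := adj_eqToHom (congrArg mk (Nat.add_zero X.pts))

end PartCat

end PartitionCat

namespace PartitionCat

open CategoryTheory MonoidalCategory

/-- A full subcategory of a monoidal `*`-category that contains the unit and is stable under tensor
products is a monoidal `*`-category. -/
instance {C : Type*} [Category C] [Preadditive C] [Linear ℂ C] [MonoidalCategory C]
    [MonoidalStarCategory C] (P : ObjectProperty C) [P.IsMonoidal] :
    MonoidalStarCategory P.FullSubcategory where
  dagger f := ObjectProperty.homMk (MonoidalStarCategory.dagger f.hom)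
  dagger_dagger f := ObjectProperty.hom_ext P (MonoidalStarCategory.dagger_dagger f.hom)
  dagger_id X := ObjectProperty.hom_ext P (MonoidalStarCategory.dagger_id X.obj)
  dagger_comp f g := ObjectProperty.hom_ext P (MonoidalStarCategory.dagger_comp f.hom g.hom)
  dagger_add f g := ObjectProperty.hom_ext P (MonoidalStarCategory.dagger_add f.hom g.hom)
  dagger_smul r f := ObjectProperty.hom_ext P (MonoidalStarCategory.dagger_smul r f.hom)
  dagger_tensorHom f g :=
    ObjectProperty.hom_ext P (MonoidalStarCategory.dagger_tensorHom f.hom g.hom)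
  dagger_associator X Y Z :=
    ObjectProperty.hom_ext P (MonoidalStarCategory.dagger_associator X.obj Y.obj Z.obj)
  dagger_leftUnitor X := ObjectProperty.hom_ext P (MonoidalStarCategory.dagger_leftUnitor X.obj)
  dagger_rightUnitor X := ObjectProperty.hom_ext P (MonoidalStarCategory.dagger_rightUnitor X.obj)

/-- A monoidal functor between monoidal `*`-categories over `ℂ` is unitary if it is linear,
preserves the involution and has unitary coherence isomorphisms. -/
structure IsUnitaryMonoidal {C D : Type*} [Category C] [Preadditive C] [Linear ℂ C]
    [MonoidalCategory C] [MonoidalStarCategory C] [Category D] [Preadditive D] [Linear ℂ D]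
    [MonoidalCategory D] [MonoidalStarCategory D] (F : C ⥤ D) [F.Monoidal] : Prop where
  map_add {X Y : C} (f g : X ⟶ Y) : F.map (f + g) = F.map f + F.map g
  map_smul {X Y : C} (r : ℂ) (f : X ⟶ Y) : F.map (r • f) = r • F.map f
  map_dagger {X Y : C} (f : X ⟶ Y) :
    F.map (MonoidalStarCategory.dagger f) = MonoidalStarCategory.dagger (F.map f)
  dagger_ε : MonoidalStarCategory.dagger (Functor.LaxMonoidal.ε F) = Functor.OplaxMonoidal.η F
  dagger_μ (X Y : C) : MonoidalStarCategory.dagger (Functor.LaxMonoidal.μ F X Y) =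
    Functor.OplaxMonoidal.δ F X Y

/-- A monoidal functor is strict if it sends the unit to the unit and tensor products to tensor
products on the nose, its coherence isomorphisms being the resulting identities. -/
structure IsStrictMonoidal {C D : Type*} [Category C] [MonoidalCategory C] [Category D]
    [MonoidalCategory D] (F : C ⥤ D) [F.Monoidal] : Prop where
  ε_eq : ∃ h : 𝟙_ D = F.obj (𝟙_ C), Functor.LaxMonoidal.ε F = eqToHom h
  μ_eq (X Y : C) : ∃ h : F.obj X ⊗ F.obj Y = F.obj (X ⊗ Y),
    Functor.LaxMonoidal.μ F X Y = eqToHom h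

/-- The category of non-crossing partitions with loop parameter `N`. -/
abbrev NCPart (N : ℝ) : Type := PartCat nonCrossing N

/-- The category of non-crossing pairings with loop parameter `N`. -/
abbrev NCPair (N : ℝ) : Type := PartCat nonCrossingPairing N

/-- The objects of the category of non-crossing pairings given by even numbers. -/
def evenPoints (N : ℝ) : ObjectProperty (NCPair N) := fun X => Even X.pts

instance (N : ℝ) : (evenPoints N).IsMonoidal where
  prop_unit := (Even.zero : Even 0)
  prop_tensor X Y hX hY := (Even.add hX hY : Even (X.pts + Y.pts))

/-- The full subcategory of the category of non-crossing pairings on the even numbers. -/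
abbrev NCPairEven (N : ℝ) : Type := (evenPoints N).FullSubcategory

/-- The number `2 * k` as an object of the category of non-crossing pairings on even numbers. -/
def doubled (N : ℝ) (k : ℕ) : NCPairEven N := ⟨⟨2 * k⟩, even_two_mul k⟩

end PartitionCat

open CategoryTheory PartitionCat

/-! # The outline functor from non-crossing partitions to non-crossing pairings

Write `p̃` for the outline of a partition `p`. It is the kernel of the map that labels the two end
points of the line from `x⁺` to `y⁻` by `y`, where `y` is the point next to `x` in its block
(`outline_eq_ker`), so it is a pairing. Compatibility with identities, tensor products and
reflections follows since these operations preserve or reverse the cyclic order, and since two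
comparable pairings are equal (`IsPairing.eq_of_le`).

**Composition.** Replace every point by three points and draw `p` on the middle ones and `p̃` on the
outer ones. If `p` is non-crossing, so is this tripled diagram (`IsNonCrossing.triple_outline`), and
tripled diagrams are composed by composing the two parts (`vcomp_triple`). As the composition of
non-crossing partitions is non-crossing, the composition of `p̃` and `q̃` is a pairing that can be
drawn together with the composition of `p` and `q` without crossings. Its lines only join copies
of points of the same block and separate no two points of a block; this leaves only the outline of
the composition (`eq_outline_of_triple`, `outline_vcomp`).

**Loops.** As the blocks of `p` contain `k + l` points altogether, the weight of `p` is
`n ^ (|p| - (k + l) / 2)`, with `|p|` the number of blocks. The loop factors `n ^ 2` and `n` then match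
by Euler's formula `loops_outline`. To prove it, glue `p̃` and `q̃` and join the two copies of every
outer point. Given a function on the doubled points that is constant on the resulting closed curves,
consider its difference across the thick lines, a function on the points of the glued diagram.

* The difference vanishes if and only if the function comes from a function that is constant on the
  blocks of the glued partitions.
* The difference has sum zero over each block of `p` and of `q`, as the sum telescopes along the
  outline of the block. Every function with these zero sums arises, as the difference of its partial
  sums along the boundary circle: the points passed over by a line of an outline form a union of
  blocks because the partition is non-crossing (`IsNonCrossing.partialSum_const`).

Counting dimensions in this exact sequence gives the formula.
-/

namespace PartitionCat
namespace Diagram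

variable {k l m k' l' : ℕ}

/-! ### Positions and the next point of a block -/

theorem pos_lt (x : Fin k ⊕ Fin l) : pos x < k + l := by
  rcases x with x | x <;> simp [pos] <;> omega

theorem gap_eq (x y : Fin k ⊕ Fin l) :
    gap x y = if pos x < pos y then pos y - pos x - 1 else pos y + (k + l) - 1 - pos x := by
  have hx := pos_lt x
  have hy := pos_lt y
  unfold gap
  split_ifs with h
  · rw [show pos y + (k + l - 1 - pos x) = (pos y - pos x - 1) + (k + l) by omega,
      Nat.add_mod_right, Nat.mod_eq_of_lt (by omega)]
  · rw [Nat.mod_eq_of_lt (by omega)]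
    omega

theorem exists_isNext (p : Diagram k l) (x : Fin k ⊕ Fin l) : ∃ y, IsNext p x y := by
  obtain ⟨y, hy, h⟩ := Set.exists_min_image {y | p x y} (gap x) (Set.toFinite _) ⟨x, p.refl' x⟩
  exact ⟨y, hy, h⟩

theorem IsNext.unique {p : Diagram k l} {x y y' : Fin k ⊕ Fin l} (h : IsNext p x y)
    (h' : IsNext p x y') : y = y' := by
  have h1 := h.2 _ h'.1
  have h2 := h'.2 _ h.1
  have hx := pos_lt x
  have hy := pos_lt y
  have hy' := pos_lt y'
  apply pos_injective
  rw [gap_eq, gap_eq] at h1 h2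
  split_ifs at h1 h2 <;> omega

/-- The next map of a partition is injective, since a point `x'` of the block other than `x` with
the same successor `y` would lie between `x` and `y`, or `x` between `x'` and `y`. -/
theorem IsNext.left_unique {p : Diagram k l} {x x' y : Fin k ⊕ Fin l} (h : IsNext p x y)
    (h' : IsNext p x' y) : x = x' := by
  have h1 := h.2 x' (p.trans' h.1 (p.symm' h'.1))
  have h2 := h'.2 x (p.trans' h'.1 (p.symm' h.1))
  have hx := pos_lt x
  have hy := pos_lt y
  have hx' := pos_lt x'
  apply pos_injective
  rw [gap_eq, gap_eq] at h1 h2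
  split_ifs at h1 h2 <;> omega

/-- The point that comes next after `x` on the boundary circle within the block of `x`. -/
noncomputable def next (p : Diagram k l) (x : Fin k ⊕ Fin l) : Fin k ⊕ Fin l :=
  (exists_isNext p x).choose

theorem isNext_next (p : Diagram k l) (x : Fin k ⊕ Fin l) : IsNext p x (next p x) :=
  (exists_isNext p x).choose_spec

theorem IsNext.next_eq {p : Diagram k l} {x y : Fin k ⊕ Fin l} (h : IsNext p x y) :
    next p x = y :=
  (isNext_next p x).unique h

theorem next_injective (p : Diagram k l) : Function.Injective (next p) := fun x x' h =>
  (isNext_next p x).left_unique (h ▸ isNext_next p x')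

theorem next_surjective (p : Diagram k l) : Function.Surjective (next p) :=
  Finite.surjective_of_injective (next_injective p)

/-- A function that is invariant under the next map is constant on the blocks: walking around a
block visits all its points. -/
theorem eq_of_next_invariant {p : Diagram k l} {M : Type*} {f : Fin k ⊕ Fin l → M}
    (hf : ∀ x, f (next p x) = f x) {x y : Fin k ⊕ Fin l} (h : p x y) : f x = f y := by
  induction hg : gap x y using Nat.strong_induction_on generalizing x with
  | _ g ih =>
    have hn := isNext_next p x
    by_cases hy : next p x = y
    · rw [← hy, hf]
    · rw [← hf x]
      refine ih _ ?_ (p.trans' (p.symm' hn.1) h) rfl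
      have h1 := hn.2 y h
      have hne : pos (next p x) ≠ pos y := fun h => hy (pos_injective h)
      have h2 := pos_lt x
      have h3 := pos_lt y
      have h4 := pos_lt (next p x)
      rw [← hg]
      rw [gap_eq, gap_eq] at *
      split_ifs at * <;> omega

/-- In a non-crossing partition no block enters and leaves the open arc between a point `x` and
its successor `y`. -/
theorem IsNonCrossing.mem_arc {p : Diagram k l} (hp : p.IsNonCrossing) {x y z w : Fin k ⊕ Fin l}
    (hxy : IsNext p x y) (hzw : p z w) (hz : gap x z < gap x y) : gap x w < gap x y := by
  by_contra hw
  have hxz : ¬ p x z := fun h => absurd (hxy.2 z h) (by omega)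
  have hwx : pos w ≠ pos x := fun h => hxz (p.symm' (pos_injective h ▸ hzw))
  have hwy : pos w ≠ pos y := fun h => hxz (p.trans' hxy.1 (p.symm' (pos_injective h ▸ hzw)))
  have c1 : ¬ (pos x < pos z ∧ pos z < pos y ∧ pos y < pos w) := fun ⟨h1, h2, h3⟩ =>
    hxz (hp x z y w h1 h2 h3 hxy.1 hzw)
  have c2 : ¬ (pos z < pos y ∧ pos y < pos w ∧ pos w < pos x) := fun ⟨h1, h2, h3⟩ =>
    hxz (p.trans' hxy.1 (p.symm' (hp z y w x h1 h2 h3 hzw (p.symm' hxy.1))))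
  have c3 : ¬ (pos y < pos w ∧ pos w < pos x ∧ pos x < pos z) := fun ⟨h1, h2, h3⟩ =>
    hxz (p.trans' hxy.1 (p.trans' (hp y w x z h1 h2 h3 (p.symm' hxy.1) (p.symm' hzw))
      (p.symm' hzw)))
  have c4 : ¬ (pos w < pos x ∧ pos x < pos z ∧ pos z < pos y) := fun ⟨h1, h2, h3⟩ =>
    hxz (p.trans' (p.symm' (hp w x z y h1 h2 h3 (p.symm' hzw) hxy.1)) (p.symm' hzw))
  have h1 := pos_lt x
  have h2 := pos_lt y
  have h3 := pos_lt z
  have h4 := pos_lt w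
  rw [gap_eq, gap_eq] at *
  split_ifs at * <;> omega

/-! ### Doubled points and the outline -/

/-- The first copy `x⁻` of a point in the order of the boundary circle; on the lower row this is
the right one of the two copies. -/
def firstCopy : Fin k ⊕ Fin l → Fin (2 * k) ⊕ Fin (2 * l) :=
  Sum.map (fun i => ⟨2 * i, by omega⟩) (fun j => ⟨2 * j + 1, by omega⟩)

/-- The second copy `x⁺` of a point in the order of the boundary circle; on the lower row this is
the left one of the two copies. -/
def secondCopy : Fin k ⊕ Fin l → Fin (2 * k) ⊕ Fin (2 * l) :=
  Sum.map (fun i => ⟨2 * i + 1, by omega⟩) (fun j => ⟨2 * j, by omega⟩)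

theorem pos_firstCopy (x : Fin k ⊕ Fin l) : pos (firstCopy x) = 2 * pos x := by
  rcases x with x | x <;> simp [pos, firstCopy] <;> omega

theorem pos_secondCopy (x : Fin k ⊕ Fin l) : pos (secondCopy x) = 2 * pos x + 1 := by
  rcases x with x | x <;> simp [pos, secondCopy] <;> omega

theorem pos_base (u : Fin (2 * k) ⊕ Fin (2 * l)) : pos (base u) = pos u / 2 := by
  rcases u with u | u <;> simp [pos, base] <;> omega

theorem base_firstCopy (x : Fin k ⊕ Fin l) : base (firstCopy x) = x :=
  pos_injective (by rw [pos_base, pos_firstCopy]; omega)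

theorem base_secondCopy (x : Fin k ⊕ Fin l) : base (secondCopy x) = x :=
  pos_injective (by rw [pos_base, pos_secondCopy]; omega)

theorem firstCopy_injective :
    Function.Injective (firstCopy : Fin k ⊕ Fin l → Fin (2 * k) ⊕ Fin (2 * l)) :=
  Function.LeftInverse.injective base_firstCopy

theorem secondCopy_injective :
    Function.Injective (secondCopy : Fin k ⊕ Fin l → Fin (2 * k) ⊕ Fin (2 * l)) :=
  Function.LeftInverse.injective base_secondCopy

theorem firstCopy_ne_secondCopy (x y : Fin k ⊕ Fin l) : firstCopy x ≠ secondCopy y := by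
  intro h
  have := congrArg pos h
  rw [pos_firstCopy, pos_secondCopy] at this
  omega

theorem eq_firstCopy {u : Fin (2 * k) ⊕ Fin (2 * l)} (h : Even (pos u)) :
    u = firstCopy (base u) :=
  pos_injective (by rw [pos_firstCopy, pos_base]; obtain ⟨r, hr⟩ := h; omega)

theorem eq_secondCopy {u : Fin (2 * k) ⊕ Fin (2 * l)} (h : Odd (pos u)) :
    u = secondCopy (base u) :=
  pos_injective (by rw [pos_secondCopy, pos_base]; obtain ⟨r, hr⟩ := h; omega)

theorem eq_copy (u : Fin (2 * k) ⊕ Fin (2 * l)) :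
    (∃ x, u = firstCopy x) ∨ ∃ x, u = secondCopy x :=
  (Nat.even_or_odd (pos u)).imp (fun h => ⟨_, eq_firstCopy h⟩) (fun h => ⟨_, eq_secondCopy h⟩)

theorem outlineStep_copies {p : Diagram k l} {x y : Fin k ⊕ Fin l} (h : IsNext p x y) :
    OutlineStep p (secondCopy x) (firstCopy y) := by
  refine ⟨?_, ?_, ?_⟩
  · rw [pos_secondCopy]
    exact odd_two_mul_add_one _
  · rw [pos_firstCopy]
    exact even_two_mul _
  · rwa [base_secondCopy, base_firstCopy]

theorem outline_le {p : Diagram k l} {S : Diagram (2 * k) (2 * l)} :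
    outline p ≤ S ↔ ∀ x y, IsNext p x y → S (secondCopy x) (firstCopy y) := by
  constructor
  · intro h x y hxy
    exact h (Relation.EqvGen.rel _ _ (outlineStep_copies hxy))
  · intro h
    refine Setoid.eqvGen_le ?_
    rintro u v ⟨hu, hv, huv⟩
    rw [eq_secondCopy hu, eq_firstCopy hv]
    exact h _ _ huv

theorem outline_rel {p : Diagram k l} {x y : Fin k ⊕ Fin l} (h : IsNext p x y) :
    outline p (secondCopy x) (firstCopy y) :=
  outline_le.1 le_rfl x y h

open Classical in
/-- The common label of the two end points `x⁺` and `y⁻` of a line of the outline: the point `y`. -/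
noncomputable def outlineLabel (p : Diagram k l) (u : Fin (2 * k) ⊕ Fin (2 * l)) :
    Fin k ⊕ Fin l :=
  if Even (pos u) then base u else next p (base u)

theorem outlineLabel_firstCopy (p : Diagram k l) (x : Fin k ⊕ Fin l) :
    outlineLabel p (firstCopy x) = x := by
  rw [outlineLabel, if_pos (by rw [pos_firstCopy]; exact even_two_mul _), base_firstCopy]

theorem outlineLabel_secondCopy (p : Diagram k l) (x : Fin k ⊕ Fin l) :
    outlineLabel p (secondCopy x) = next p x := by
  rw [outlineLabel, if_neg (by rw [pos_secondCopy]; exact Nat.not_even_two_mul_add_one _),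
    base_secondCopy]

theorem outline_eq_ker (p : Diagram k l) : outline p = Setoid.ker (outlineLabel p) := by
  apply le_antisymm
  · refine outline_le.2 fun x y h => ?_
    change outlineLabel p _ = outlineLabel p _
    rw [outlineLabel_firstCopy, outlineLabel_secondCopy, h.next_eq]
  · have h : ∀ u, outline p u (firstCopy (outlineLabel p u)) := by
      intro u
      rcases eq_copy u with ⟨x, rfl⟩ | ⟨x, rfl⟩
      · rw [outlineLabel_firstCopy]
      · rw [outlineLabel_secondCopy]
        exact outline_rel (isNext_next p x)
    intro u v (huv : outlineLabel p u = outlineLabel p v)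
    exact (outline p).trans' (h u) (huv ▸ (outline p).symm' (h v))

theorem outline_iff {p : Diagram k l} {u v : Fin (2 * k) ⊕ Fin (2 * l)} :
    outline p u v ↔ outlineLabel p u = outlineLabel p v := by
  rw [outline_eq_ker]
  rfl

theorem outline_second_first {p : Diagram k l} {x y : Fin k ⊕ Fin l} :
    outline p (secondCopy x) (firstCopy y) ↔ IsNext p x y := by
  rw [outline_iff, outlineLabel_firstCopy, outlineLabel_secondCopy]
  exact ⟨fun h => h ▸ isNext_next p x, IsNext.next_eq⟩

theorem isPairing_outline (p : Diagram k l) : IsPairing (outline p) := by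
  intro u
  obtain ⟨x, hx⟩ := next_surjective p (outlineLabel p u)
  rw [Set.ncard_eq_two]
  refine ⟨firstCopy (next p x), secondCopy x, firstCopy_ne_secondCopy _ _, ?_⟩
  ext v
  change outline p u v ↔ v = _ ∨ v = _
  rw [outline_iff, ← hx]
  rcases eq_copy v with ⟨y, rfl⟩ | ⟨y, rfl⟩
  · rw [outlineLabel_firstCopy, firstCopy_injective.eq_iff]
    simp [firstCopy_ne_secondCopy, eq_comm]
  · rw [outlineLabel_secondCopy, secondCopy_injective.eq_iff, (next_injective p).eq_iff]
    simp [(firstCopy_ne_secondCopy _ _).symm, eq_comm]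

theorem outline_le_comap_base (p : Diagram k l) : outline p ≤ p.comap base := by
  refine outline_le.2 fun x y h => ?_
  change p (base _) (base _)
  rw [base_firstCopy, base_secondCopy]
  exact h.1

/-- A pairing has no proper coarsening that is a pairing. -/
theorem IsPairing.eq_of_le {p q : Diagram k l} (hp : p.IsPairing) (hq : q.IsPairing)
    (h : p ≤ q) : p = q := by
  refine le_antisymm h fun x y hxy => ?_
  have : {y | p x y} = {y | q x y} :=
    Set.eq_of_subset_of_ncard_le (fun y hy => h hy) (by rw [hp x, hq x]) (Set.toFinite _)
  exact this.ge hxy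

/-- The outline together with the closing lines between the two copies of each point gives back
the partition. -/
theorem outline_sup_ker_base (p : Diagram k l) :
    outline p ⊔ Setoid.ker base = p.comap base := by
  apply le_antisymm
  · refine sup_le (outline_le_comap_base p) ?_
    intro u v (huv : base u = base v)
    change p (base u) (base v)
    rw [huv]
  · intro u v (huv : p (base u) (base v))
    set S := outline p ⊔ Setoid.ker base
    have hb : ∀ u, S u (firstCopy (base u)) := fun u =>
      (le_sup_right : Setoid.ker base ≤ S) (base_firstCopy (base u)).symm
    have hs : ∀ x, S (firstCopy (next p x)) (firstCopy x) := by
      intro x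
      have h1 : S (secondCopy x) (firstCopy (next p x)) :=
        (le_sup_left : outline p ≤ S) (outline_rel (isNext_next p x))
      have h2 := hb (secondCopy x)
      rw [base_secondCopy] at h2
      exact S.trans' (S.symm' h1) h2
    have := eq_of_next_invariant (f := fun x => Quotient.mk S (firstCopy x))
      (fun x => Quotient.sound (hs x)) huv
    exact S.trans' (hb u) (S.trans' (Quotient.exact this) (S.symm' (hb v)))

end Diagram
end PartitionCat

namespace PartitionCat
namespace Diagram

variable {k l m k' l' : ℕ}

/-! ### A partition drawn together with its outline -/

/-- The middle one of the three points that replace a point. -/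
def midFin {k : ℕ} (i : Fin k) : Fin (3 * k) := ⟨3 * i + 1, by omega⟩

/-- The outer two of the three points that replace a point, in terms of its two copies. -/
def sideFin {k : ℕ} (i : Fin (2 * k)) : Fin (3 * k) := ⟨3 * (i / 2) + 2 * (i % 2), by omega⟩

theorem midFin_injective : Function.Injective (midFin : Fin k → Fin (3 * k)) := by
  intro i j h
  simp only [midFin, Fin.mk.injEq] at h
  omega

theorem sideFin_injective : Function.Injective (sideFin : Fin (2 * k) → Fin (3 * k)) := by
  intro i j h
  simp only [sideFin, Fin.mk.injEq] at h
  omega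

theorem midFin_ne_sideFin (i : Fin k) (j : Fin (2 * k)) : midFin i ≠ sideFin j := by
  intro h
  simp only [midFin, sideFin, Fin.mk.injEq] at h
  omega

theorem midFin_cover (i : Fin (3 * k)) :
    (∃ a : Fin k, midFin a = i) ∨ ∃ b : Fin (2 * k), sideFin b = i := by
  by_cases h : (i : ℕ) % 3 = 1
  · exact Or.inl ⟨⟨i / 3, by omega⟩, Fin.ext (by simp only [midFin]; omega)⟩
  · exact Or.inr ⟨⟨2 * (i / 3) + (i % 3) / 2, by omega⟩, Fin.ext (by simp only [sideFin]; omega)⟩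

/-- The middle points of a tripled diagram. -/
def mid : Fin k ⊕ Fin l → Fin (3 * k) ⊕ Fin (3 * l) := Sum.map midFin midFin

/-- The outer points of a tripled diagram. -/
def side : Fin (2 * k) ⊕ Fin (2 * l) → Fin (3 * k) ⊕ Fin (3 * l) := Sum.map sideFin sideFin

theorem mid_injective : Function.Injective (mid : Fin k ⊕ Fin l → _) :=
  midFin_injective.sumMap midFin_injective

theorem side_injective : Function.Injective (side : Fin (2 * k) ⊕ Fin (2 * l) → _) :=
  sideFin_injective.sumMap sideFin_injective

theorem mid_ne_side (a : Fin k ⊕ Fin l) (b : Fin (2 * k) ⊕ Fin (2 * l)) : mid a ≠ side b := by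
  rcases a with a | a <;> rcases b with b | b <;> simp [mid, side, midFin_ne_sideFin]

theorem mid_cover (x : Fin (3 * k) ⊕ Fin (3 * l)) :
    (∃ a : Fin k ⊕ Fin l, mid a = x) ∨ ∃ b : Fin (2 * k) ⊕ Fin (2 * l), side b = x := by
  rcases x with x | x
  · rcases midFin_cover x with ⟨a, rfl⟩ | ⟨a, rfl⟩
    · exact Or.inl ⟨Sum.inl a, rfl⟩
    · exact Or.inr ⟨Sum.inl a, rfl⟩
  · rcases midFin_cover x with ⟨a, rfl⟩ | ⟨a, rfl⟩
    · exact Or.inl ⟨Sum.inr a, rfl⟩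
    · exact Or.inr ⟨Sum.inr a, rfl⟩

theorem pos_mid (x : Fin k ⊕ Fin l) : pos (mid x) = 3 * pos x + 1 := by
  rcases x with x | x
  · simp [pos, mid, midFin]
  · simp [pos, mid, midFin]
    omega

theorem pos_side_firstCopy (x : Fin k ⊕ Fin l) : pos (side (firstCopy x)) = 3 * pos x := by
  rcases x with x | x
  · simp [pos, side, sideFin, firstCopy]
  · simp [pos, side, sideFin, firstCopy]
    omega

theorem pos_side_secondCopy (x : Fin k ⊕ Fin l) : pos (side (secondCopy x)) = 3 * pos x + 2 := by
  rcases x with x | x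
  · simp [pos, side, sideFin, secondCopy]
    omega
  · simp [pos, side, sideFin, secondCopy]
    omega

/-- Every point is tripled; the partition `s` is drawn on the middle points and the partition `t`
of the doubled points on the outer points. -/
def triple (s : Diagram k l) (t : Diagram (2 * k) (2 * l)) : Diagram (3 * k) (3 * l) :=
  s.map mid ⊔ t.map side

theorem triple_mid {s : Diagram k l} {t : Diagram (2 * k) (2 * l)} {a b : Fin k ⊕ Fin l} :
    triple s t (mid a) (mid b) ↔ s a b :=
  juxt_left mid_injective side_injective mid_ne_side s t

theorem triple_side {s : Diagram k l} {t : Diagram (2 * k) (2 * l)}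
    {u v : Fin (2 * k) ⊕ Fin (2 * l)} : triple s t (side u) (side v) ↔ t u v :=
  juxt_right mid_injective side_injective mid_ne_side s t

theorem not_triple_mid_side {s : Diagram k l} {t : Diagram (2 * k) (2 * l)} {a : Fin k ⊕ Fin l}
    {u : Fin (2 * k) ⊕ Fin (2 * l)} : ¬ triple s t (mid a) (side u) :=
  juxt_cross mid_ne_side s t

theorem not_triple_side_mid {s : Diagram k l} {t : Diagram (2 * k) (2 * l)} {a : Fin k ⊕ Fin l}
    {u : Fin (2 * k) ⊕ Fin (2 * l)} : ¬ triple s t (side u) (mid a) :=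
  juxt_cross' mid_ne_side s t

theorem eq_triple_of {s : Diagram k l} {t : Diagram (2 * k) (2 * l)}
    {S : Diagram (3 * k) (3 * l)} (h1 : ∀ a a', S (mid a) (mid a') ↔ s a a')
    (h2 : ∀ b b', S (side b) (side b') ↔ t b b') (h3 : ∀ a b, ¬ S (mid a) (side b)) :
    S = triple s t := by
  ext x y
  rcases mid_cover x with ⟨a, rfl⟩ | ⟨a, rfl⟩ <;> rcases mid_cover y with ⟨b, rfl⟩ | ⟨b, rfl⟩
  · exact (h1 a b).trans triple_mid.symm
  · exact iff_of_false (h3 a b) not_triple_mid_side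
  · exact iff_of_false (fun h => h3 b a (S.symm' h)) not_triple_side_mid
  · exact (h2 a b).trans triple_side.symm

theorem vcomp_triple (s : Diagram k l) (t : Diagram (2 * k) (2 * l)) (s' : Diagram l m)
    (t' : Diagram (2 * l) (2 * m)) :
    (vcomp (triple s t) (triple s' t') : Diagram (3 * k) (3 * m)) =
      triple (vcomp s s') (vcomp t t') := by
  set j : Fin k ⊕ Fin l ⊕ Fin m → Fin (3 * k) ⊕ Fin (3 * l) ⊕ Fin (3 * m) :=
    Sum.map midFin mid with hj
  set j' : Fin (2 * k) ⊕ Fin (2 * l) ⊕ Fin (2 * m) → Fin (3 * k) ⊕ Fin (3 * l) ⊕ Fin (3 * m) :=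
    Sum.map sideFin side with hj'
  have hji : Function.Injective j := midFin_injective.sumMap mid_injective
  have hji' : Function.Injective j' := sideFin_injective.sumMap side_injective
  have hd : ∀ a b, j a ≠ j' b := by
    rintro (a | a) (b | b) <;> simp [hj, hj', midFin_ne_sideFin, mid_ne_side]
  have hg : glue (triple s t) (triple s' t') = (glue s s').map j ⊔ (glue t t').map j' := by
    unfold glue triple
    simp only [map_sup, map_map]
    rw [sup_sup_sup_comm]
    refine congrArg₂ _ (congrArg₂ _ ?_ ?_) (congrArg₂ _ ?_ ?_) <;> refine map_congr _ fun x => ?_ <;>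
      rcases x with x | x <;> rfl
  have he : ∀ a : Fin k ⊕ Fin m, ends (mid a) = j (ends a) := by rintro (a | a) <;> rfl
  have he' : ∀ a : Fin (2 * k) ⊕ Fin (2 * m), ends (side a) = j' (ends a) := by
    rintro (a | a) <;> rfl
  refine eq_triple_of (fun a a' => ?_) (fun b b' => ?_) (fun a b => ?_)
  · change glue (triple s t) (triple s' t') _ _ ↔ _
    rw [he, he, hg]
    exact juxt_left hji hji' hd _ _
  · change glue (triple s t) (triple s' t') _ _ ↔ _
    rw [he', he', hg]
    exact juxt_right hji hji' hd _ _
  · change ¬ glue (triple s t) (triple s' t') _ _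
    rw [he, he', hg]
    exact juxt_cross hd _ _

/-- A line of the outline, from `x⁺` to `y⁻`, does not separate two points of a tripled diagram
that replace points of the same block. -/
theorem IsNonCrossing.not_separated {p : Diagram k l} (hp : p.IsNonCrossing)
    {x y z w : Fin k ⊕ Fin l} (hxy : IsNext p x y) (hzw : p z w) {b d : ℕ}
    (hb : b / 3 = pos z) (hd : d / 3 = pos w)
    (h1 : min (3 * pos x + 2) (3 * pos y) < b) (h2 : b < max (3 * pos x + 2) (3 * pos y))
    (h3 : d < min (3 * pos x + 2) (3 * pos y) ∨ max (3 * pos x + 2) (3 * pos y) < d) : False := by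
  have key : gap x z < gap x y ↔ gap x w < gap x y :=
    ⟨hp.mem_arc hxy hzw, hp.mem_arc hxy (p.symm' hzw)⟩
  have b1 := pos_lt x
  have b2 := pos_lt y
  have b3 := pos_lt z
  have b4 := pos_lt w
  rw [gap_eq, gap_eq, gap_eq] at key
  split_ifs at key <;> omega

theorem isNext_of_outline {p : Diagram k l} {u v : Fin (2 * k) ⊕ Fin (2 * l)}
    (h : outline p u v) (huv : u ≠ v) :
    ∃ x y, IsNext p x y ∧ (u = secondCopy x ∧ v = firstCopy y ∨ u = firstCopy y ∧
      v = secondCopy x) := by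
  rcases eq_copy u with ⟨x, rfl⟩ | ⟨x, rfl⟩ <;> rcases eq_copy v with ⟨y, rfl⟩ | ⟨y, rfl⟩
  · rw [outline_iff, outlineLabel_firstCopy, outlineLabel_firstCopy] at h
    exact absurd (congrArg _ h) huv
  · exact ⟨y, x, outline_second_first.1 ((outline p).symm' h), Or.inr ⟨rfl, rfl⟩⟩
  · exact ⟨x, y, outline_second_first.1 h, Or.inl ⟨rfl, rfl⟩⟩
  · rw [outline_iff, outlineLabel_secondCopy, outlineLabel_secondCopy] at h
    exact absurd (congrArg _ (next_injective p h)) huv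

/-- A non-crossing partition can be drawn together with its outline without crossings. -/
theorem IsNonCrossing.triple_outline {p : Diagram k l} (hp : p.IsNonCrossing) :
    (triple p (outline p)).IsNonCrossing := by
  -- A line of the outline crosses neither a block nor another line.
  have key : ∀ (u v : Fin (2 * k) ⊕ Fin (2 * l)) (z w : Fin k ⊕ Fin l) (b d : ℕ), outline p u v →
      p z w → b / 3 = pos z → d / 3 = pos w → pos (side u) < b → b < pos (side v) →
      (d < pos (side u) ∨ pos (side v) < d) → False := by
    intro u v z w b d huv hzw hb hd h1 h2 h3
    obtain ⟨x, y, hxy, ⟨rfl, rfl⟩ | ⟨rfl, rfl⟩⟩ :=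
      isNext_of_outline huv (by rintro rfl; omega)
    all_goals
      rw [pos_side_firstCopy, pos_side_secondCopy] at *
      exact hp.not_separated hxy hzw hb hd (by omega) (by omega) (by omega)
  have hside : ∀ u : Fin (2 * k) ⊕ Fin (2 * l), pos (side u) / 3 = pos (base u) := by
    intro u
    rcases eq_copy u with ⟨x, rfl⟩ | ⟨x, rfl⟩
    · rw [pos_side_firstCopy, base_firstCopy]
      omega
    · rw [pos_side_secondCopy, base_secondCopy]
      omega
  have hmid : ∀ x : Fin k ⊕ Fin l, pos (mid x) / 3 = pos x := by
    intro x
    rw [pos_mid]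
    omega
  intro a b c d hab hbc hcd hac hbd
  rcases mid_cover a with ⟨a, rfl⟩ | ⟨a, rfl⟩ <;> rcases mid_cover c with ⟨c, rfl⟩ | ⟨c, rfl⟩
  · rw [triple_mid] at hac
    rcases mid_cover b with ⟨b, rfl⟩ | ⟨b, rfl⟩ <;> rcases mid_cover d with ⟨d, rfl⟩ | ⟨d, rfl⟩
    · rw [triple_mid] at hbd ⊢
      simp only [pos_mid] at hab hbc hcd
      exact hp a b c d (by omega) (by omega) (by omega) hac hbd
    · exact absurd hbd not_triple_mid_side
    · exact absurd hbd not_triple_side_mid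
    · exact (key b d c a _ _ (triple_side.1 hbd) (p.symm' hac) (hmid c) (hmid a) hbc hcd
        (Or.inl hab)).elim
  · exact absurd hac not_triple_mid_side
  · exact absurd hac not_triple_side_mid
  · rw [triple_side] at hac
    rcases mid_cover b with ⟨b, rfl⟩ | ⟨b, rfl⟩ <;> rcases mid_cover d with ⟨d, rfl⟩ | ⟨d, rfl⟩
    · exact (key a c b d _ _ hac (triple_mid.1 hbd) (hmid b) (hmid d) hab hbc
        (Or.inr hcd)).elim
    · exact absurd hbd not_triple_mid_side
    · exact absurd hbd not_triple_side_mid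
    · exact (key a c (base b) (base d) _ _ hac (outline_le_comap_base p (triple_side.1 hbd))
        (hside b) (hside d) hab hbc (Or.inr hcd)).elim

theorem pos_side_lt_iff {u v : Fin (2 * k) ⊕ Fin (2 * l)} :
    pos (side u) < pos (side v) ↔ pos u < pos v := by
  rcases eq_copy u with ⟨x, rfl⟩ | ⟨x, rfl⟩ <;> rcases eq_copy v with ⟨y, rfl⟩ | ⟨y, rfl⟩ <;>
    simp only [pos_side_firstCopy, pos_side_secondCopy, pos_firstCopy, pos_secondCopy] <;> omega

/-- The outline of a non-crossing partition is non-crossing. -/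
theorem isNonCrossing_outline {p : Diagram k l} (hp : p.IsNonCrossing) :
    (outline p).IsNonCrossing := by
  intro a b c d hab hbc hcd hac hbd
  exact triple_side.1 (hp.triple_outline _ _ _ _ (pos_side_lt_iff.2 hab) (pos_side_lt_iff.2 hbc)
    (pos_side_lt_iff.2 hcd) (triple_side.2 hac) (triple_side.2 hbd))

/-- The outline of `s` is characterized among the pairings of the doubled points by joining only
copies of points of the same block, and by being drawn together with `s` without crossings. -/
theorem eq_outline_of_triple {s : Diagram k l} {t : Diagram (2 * k) (2 * l)}
    (h : (triple s t).IsNonCrossing) (ht : t.IsPairing) (hle : t ≤ s.comap base) :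
    t = outline s := by
  -- A pair of `t` does not separate two middle points of the same block.
  have key : ∀ u v a b, t u v → s a b → ¬ (pos (side u) < pos (mid a) ∧
      pos (mid a) < pos (side v) ∧
      (pos (mid b) < pos (side u) ∨ pos (side v) < pos (mid b))) := by
    rintro u v a b huv hab ⟨h1, h2, h3⟩
    rcases h3 with h3 | h3
    · exact not_triple_mid_side (h _ _ _ _ h3 h1 h2 (triple_mid.2 (s.symm' hab))
        (triple_side.2 huv))
    · exact not_triple_side_mid (h _ _ _ _ h1 h2 h3 (triple_side.2 huv) (triple_mid.2 hab))
  obtain ⟨σ, hσ⟩ := ht.exists_partner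
  refine ((isPairing_outline s).eq_of_le ht (outline_le.2 fun x y hxy => ?_)).symm
  have h1 : t (secondCopy x) (σ (secondCopy x)) := ((hσ _).2 _).2 (Or.inr rfl)
  have h2 : s x (base (σ (secondCopy x))) := by
    have := hle h1
    change s (base _) _ at this
    rwa [base_secondCopy] at this
  rcases eq_copy (σ (secondCopy x)) with ⟨z, hz⟩ | ⟨z, hz⟩
  · rw [hz] at h1 h2
    rw [base_firstCopy] at h2
    suffices hn : IsNext s x z by
      rw [hxy.unique hn]
      exact h1
    refine ⟨h2, fun w hw => ?_⟩
    by_contra hlt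
    have k1 := key _ _ w x h1 (s.symm' hw)
    have k2 := key _ _ x w (t.symm' h1) hw
    have b1 := pos_lt x
    have b2 := pos_lt z
    have b3 := pos_lt w
    rw [gap_eq, gap_eq] at hlt
    rw [pos_side_firstCopy, pos_side_secondCopy, pos_mid, pos_mid] at k1 k2
    split_ifs at hlt <;> omega
  · rw [hz] at h1 h2
    rw [base_secondCopy] at h2
    have hne : pos z ≠ pos x := by
      intro h
      apply (hσ (secondCopy x)).1
      rw [hz, pos_injective h]
    have k1 := key _ _ z x h1 (s.symm' h2)
    have k2 := key _ _ x z (t.symm' h1) h2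
    rw [pos_side_secondCopy, pos_side_secondCopy, pos_mid, pos_mid] at k1 k2
    omega

theorem glue_outline_le (p : Diagram k l) (q : Diagram l m) :
    glue (outline p) (outline q) ≤
      (glue p q).comap (Sum.map (fun i : Fin (2 * k) => (⟨i / 2, by omega⟩ : Fin k)) base) := by
  refine sup_le (map_le_iff.2 ?_) (map_le_iff.2 ?_)
  · intro u v huv
    have := glue_top p q (outline_le_comap_base p huv)
    rcases u with u | u <;> rcases v with v | v <;> exact this
  · intro u v huv
    have := glue_bot p q (outline_le_comap_base q huv)
    rcases u with u | u <;> rcases v with v | v <;> exact this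

/-- Outlines are compatible with composition. -/
theorem outline_vcomp {p : Diagram k l} {q : Diagram l m} (hp : p.IsNonCrossing)
    (hq : q.IsNonCrossing) :
    (vcomp (outline p) (outline q) : Diagram (2 * k) (2 * m)) = outline (vcomp p q) := by
  refine eq_outline_of_triple ?_ ((isPairing_outline p).vcomp (isPairing_outline q)) ?_
  · rw [← vcomp_triple]
    exact hp.triple_outline.vcomp hq.triple_outline
  · intro u v huv
    have := glue_outline_le p q huv
    rcases u with u | u <;> rcases v with v | v <;> exact this

/-! ### Outlines of identities and reflections -/

theorem outline_id : outline (idPart (Fin k)) = idPart (Fin (2 * k)) := by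
  refine (isPairing_outline _).eq_of_le isPairing_id (outline_le.2 fun x y h => ?_)
  -- The successor of a point in the identity partition is the opposite point.
  have hs : y = x.swap := by
    apply h.unique
    constructor
    · rcases x with x | x <;> rfl
    · intro z hz
      have : z = x ∨ z = x.swap := by
        rcases x with x | x <;> rcases z with z | z <;> simpa [idPart_rel, eq_comm] using hz
      rcases this with rfl | rfl
      · have h1 := pos_lt z
        have h2 := pos_lt z.swap
        rw [gap_eq, gap_eq]
        split_ifs <;> omega
      · exact le_rfl
  subst hs
  rcases x with x | x <;> rfl

theorem outline_reflect (p : Diagram k l) : outline (reflect p) = reflect (outline p) := by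
  refine (isPairing_outline _).eq_of_le (isPairing_outline p).reflect (outline_le.2 fun x y h => ?_)
  have hn : IsNext p y.swap x.swap := by
    refine ⟨p.symm' h.1, fun z hz => ?_⟩
    have hxz : p x.swap z := p.trans' h.1 hz
    have h1 := h.2 z.swap (by
      change p x.swap z.swap.swap
      rwa [Sum.swap_swap])
    have e1 := pos_swap x
    have e2 := pos_swap y
    have e3 := pos_swap z
    rw [gap_eq, gap_eq] at *
    by_cases hzx : pos z = pos x.swap
    · rw [hzx]
    split_ifs at * <;> omega
  have := (outline p).symm' (outline_rel hn)
  rcases x with x | x <;> rcases y with y | y <;> exact this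

end Diagram
end PartitionCat

namespace PartitionCat

open Module

/-! ### Counting blocks by functions that are constant on them -/

section Blocks

variable {X Y A B : Type*}

theorem floating_empty (S : Setoid X) (f : Empty → X) : floating f S = S.classes.ncard := by
  simp [floating]

theorem ncard_classes_eq_card_quotient (S : Setoid X) :
    S.classes.ncard = Nat.card (Quotient S) := by
  rw [← Nat.card_coe_set_eq]
  exact Nat.card_congr (Setoid.quotientEquivClasses S).symm

theorem ncard_classes_comap {f : Y → X} (hf : Function.Surjective f) (S : Setoid X) :
    (S.comap f).classes.ncard = S.classes.ncard := by
  rw [ncard_classes_eq_card_quotient, ncard_classes_eq_card_quotient]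
  refine Nat.card_congr (Equiv.ofBijective
    (Quotient.map' f fun _ _ h => h) ⟨?_, ?_⟩)
  · intro a b
    induction a using Quotient.inductionOn'
    induction b using Quotient.inductionOn'
    intro h
    exact Quotient.sound' (Quotient.exact' (s₁ := S) h)
  · intro b
    induction b using Quotient.inductionOn' with
    | h b =>
      obtain ⟨a, rfl⟩ := hf b
      exact ⟨Quotient.mk'' a, rfl⟩

theorem ncard_classes_bot : (⊥ : Setoid X).classes.ncard = Nat.card X := by
  rw [ncard_classes_eq_card_quotient]
  exact Nat.card_congr Setoid.quotientBotEquiv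

theorem ncard_classes_juxt [Finite A] [Finite B] {f : A → X} {f' : B → X}
    (hf : Function.Injective f) (hf' : Function.Injective f') (hd : ∀ a b, f a ≠ f' b)
    (hc : ∀ x, (∃ a, f a = x) ∨ ∃ b, f' b = x) (S : Setoid A) (S' : Setoid B) :
    (S.map f ⊔ S'.map f').classes.ncard = S.classes.ncard + S'.classes.ncard := by
  have := floating_juxt hf hf' hd hc S S' (g := Empty.elim) (eA := Empty.elim) (eB := Empty.elim)
    (fun a => a.elim) (fun a => a.elim) (fun a => a.elim)
  rwa [floating_empty, floating_empty, floating_empty] at this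

/-- The number of all blocks is the number of those without a point `f a`, plus the number of
blocks of the induced partition. -/
theorem ncard_classes_eq_floating_add [Finite X] (f : Y → X) (S : Setoid X) :
    S.classes.ncard = floating f S + (S.comap f).classes.ncard := by
  have := floating_comp f (Empty.elim : Empty → Y) S
  rwa [floating_empty, floating_empty] at this

/-- The rational functions that are constant on the blocks of a partition. -/
def blockFunctions (S : Setoid X) : Submodule ℚ (X → ℚ) where
  carrier := {f | S ≤ Setoid.ker f}
  zero_mem' := fun _ _ _ => rfl
  add_mem' := fun hf hg _ _ h => congrArg₂ (· + ·) (hf h) (hg h)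
  smul_mem' := fun r _ hf _ _ h => congrArg (r • ·) (hf h)

theorem mem_blockFunctions {S : Setoid X} {f : X → ℚ} :
    f ∈ blockFunctions S ↔ S ≤ Setoid.ker f := Iff.rfl

theorem blockFunctions_sup (S T : Setoid X) :
    blockFunctions (S ⊔ T) = blockFunctions S ⊓ blockFunctions T := by
  ext f
  exact sup_le_iff (c := Setoid.ker f)

theorem finrank_blockFunctions [Finite X] (S : Setoid X) :
    finrank ℚ (blockFunctions S) = S.classes.ncard := by
  have := Fintype.ofFinite (Quotient S)
  have h : blockFunctions S = LinearMap.range (LinearMap.funLeft ℚ ℚ (Quotient.mk S)) := by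
    ext f
    constructor
    · intro hf
      exact ⟨Quotient.lift f fun _ _ h => hf h, rfl⟩
    · rintro ⟨g, rfl⟩ x y hxy
      exact congrArg g (Quotient.sound hxy)
  rw [h, LinearMap.finrank_range_of_inj
    (LinearMap.funLeft_injective_of_surjective ℚ ℚ _ Quotient.mk_surjective),
    finrank_fintype_fun_eq_card, ncard_classes_eq_card_quotient, Nat.card_eq_fintype_card]

/-- The functions that are orthogonal to a space of functions. -/
def orthogonalFunctions [Fintype X] (U : Submodule ℚ (X → ℚ)) : Submodule ℚ (X → ℚ) :=
  LinearMap.BilinForm.orthogonal (dotProductBilin ℚ ℚ) U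

theorem mem_orthogonalFunctions [Fintype X] {U : Submodule ℚ (X → ℚ)} {g : X → ℚ} :
    g ∈ orthogonalFunctions U ↔ ∀ f ∈ U, ∑ x, f x * g x = 0 := Iff.rfl

theorem finrank_orthogonalFunctions [Fintype X] (U : Submodule ℚ (X → ℚ)) :
    finrank ℚ (orthogonalFunctions U) + finrank ℚ U = Fintype.card X := by
  classical
  have hB : (dotProductBilin ℚ ℚ : LinearMap.BilinForm ℚ (X → ℚ)).Nondegenerate := by
    refine ⟨fun f hf => ?_, fun f hf => ?_⟩
    · funext x
      simpa using hf (Pi.single x 1)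
    · funext x
      simpa using hf (Pi.single x 1)
  have h := LinearMap.BilinForm.finrank_orthogonal hB U
  have h' := Submodule.finrank_le U
  rw [finrank_fintype_fun_eq_card] at h h'
  rw [orthogonalFunctions, h]
  omega

/-- A function orthogonal to the functions that are constant on the blocks has sum zero over every
union of blocks. -/
theorem sum_eq_zero_of_orthogonal [Fintype X] {S : Setoid X} {g : X → ℚ}
    (hg : g ∈ orthogonalFunctions (blockFunctions S)) (P : X → Prop) [DecidablePred P]
    (hP : ∀ x y, S x y → P x → P y) : ∑ x with P x, g x = 0 := by
  have := mem_orthogonalFunctions.1 hg (fun x => if P x then 1 else 0) (fun x y hxy => by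
    change (if P x then (1 : ℚ) else 0) = if P y then 1 else 0
    have : P x ↔ P y := ⟨hP x y hxy, hP y x (S.symm' hxy)⟩
    simp only [this])
  simpa only [Finset.sum_filter, ite_mul, one_mul, zero_mul] using this

end Blocks

namespace Diagram

variable {k l m k' l' : ℕ}

/-! ### Functions that are constant on the lines of an outline -/

/-- The differences across the thick lines of a function that is constant on the lines of the
outline have sum zero on every block: the sum telescopes around the block. -/
theorem sum_mul_difference {p : Diagram k l} {f : Fin k ⊕ Fin l → ℚ}
    {h : Fin (2 * k) ⊕ Fin (2 * l) → ℚ} (hf : p ≤ Setoid.ker f)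
    (hh : outline p ≤ Setoid.ker h) :
    ∑ x, f x * (h (secondCopy x) - h (firstCopy x)) = 0 := by
  have h1 : ∀ x, f x * h (secondCopy x) = f (next p x) * h (firstCopy (next p x)) := by
    intro x
    have e1 : f x = f (next p x) := hf (isNext_next p x).1
    have e2 : h (secondCopy x) = h (firstCopy (next p x)) := hh (outline_rel (isNext_next p x))
    rw [← e1, e2]
  simp only [mul_sub, Finset.sum_sub_distrib, h1]
  rw [sub_eq_zero]
  exact (Equiv.ofBijective (next p) ⟨next_injective p, next_surjective p⟩).sum_comp
    (fun x => f x * h (firstCopy x))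

/-- The sum of `g` over all points whose first copy comes before the place `u` on the boundary
circle of the doubled diagram. -/
def partialSum (g : Fin k ⊕ Fin l → ℚ) (u : Fin (2 * k) ⊕ Fin (2 * l)) : ℚ :=
  ∑ z with 2 * pos z < pos u, g z

/-- If `g` has sum zero on the blocks of a non-crossing partition, then its partial sums are constant
on the lines of the outline: the points passed over by a line form a union of blocks. -/
theorem IsNonCrossing.partialSum_const {p : Diagram k l} (hp : p.IsNonCrossing)
    {g : Fin k ⊕ Fin l → ℚ} (hg : g ∈ orthogonalFunctions (blockFunctions p)) :
    outline p ≤ Setoid.ker (partialSum g) := by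
  classical
  refine outline_le.2 fun x y hxy => ?_
  change partialSum g _ = partialSum g _
  unfold partialSum
  rw [pos_firstCopy, pos_secondCopy]
  have b1 := pos_lt x
  have b2 := pos_lt y
  by_cases h : pos x < pos y
  · -- The points strictly between `x` and `y` are those of an open arc from `x` to `y`.
    have h0 := sum_eq_zero_of_orthogonal hg (fun z => gap x z < gap x y)
      fun z w hzw hz => hp.mem_arc hxy hzw hz
    have h1 : (Finset.univ.filter fun z : Fin k ⊕ Fin l => 2 * pos z < 2 * pos y) =
        (Finset.univ.filter fun z => 2 * pos z < 2 * pos x + 1) ∪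
          Finset.univ.filter fun z => gap x z < gap x y := by
      ext z
      have b3 := pos_lt z
      simp only [Finset.mem_filter, Finset.mem_union, Finset.mem_univ, true_and]
      rw [gap_eq, gap_eq]
      split_ifs <;> omega
    rw [h1, Finset.sum_union, h0, add_zero]
    rw [Finset.disjoint_filter]
    intro z _ hz
    rw [gap_eq, gap_eq]
    split_ifs <;> omega
  · -- The points from `y` to `x` form the complement of the open arc from `x` to `y`.
    have h0 := sum_eq_zero_of_orthogonal hg (fun z => ¬ gap x z < gap x y)
      fun z w hzw hz hw => hz (hp.mem_arc hxy (p.symm' hzw) hw)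
    have h1 : (Finset.univ.filter fun z : Fin k ⊕ Fin l => 2 * pos z < 2 * pos x + 1) =
        (Finset.univ.filter fun z => 2 * pos z < 2 * pos y) ∪
          Finset.univ.filter fun z => ¬ gap x z < gap x y := by
      ext z
      have b3 := pos_lt z
      simp only [Finset.mem_filter, Finset.mem_union, Finset.mem_univ, true_and]
      rw [gap_eq, gap_eq]
      split_ifs <;> omega
    rw [h1, Finset.sum_union, h0, add_zero]
    rw [Finset.disjoint_filter]
    intro z _ hz
    have b3 := pos_lt z
    rw [gap_eq, gap_eq]
    split_ifs <;> omega

end Diagram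
end PartitionCat

namespace PartitionCat
namespace Diagram

open Module

variable {k l m : ℕ}

/-! ### The Euler characteristic of a composition -/

/-- The point of which a point of the doubled glued diagram is a copy. -/
def base₃ : Fin (2 * k) ⊕ Fin (2 * l) ⊕ Fin (2 * m) → Fin k ⊕ Fin l ⊕ Fin m :=
  Sum.map (fun i => ⟨i / 2, by omega⟩) base

/-- One of the two copies of each point of a glued diagram: the right one on the middle row, as it
comes first around the upper diagram and second around the lower diagram. -/
def rightCopy : Fin k ⊕ Fin l ⊕ Fin m → Fin (2 * k) ⊕ Fin (2 * l) ⊕ Fin (2 * m) :=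
  Sum.map (fun i => ⟨2 * i, by omega⟩) secondCopy

/-- The other copy of each point of a glued diagram, the left one on the middle row. -/
def leftCopy : Fin k ⊕ Fin l ⊕ Fin m → Fin (2 * k) ⊕ Fin (2 * l) ⊕ Fin (2 * m) :=
  Sum.map (fun i => ⟨2 * i + 1, by omega⟩) firstCopy

theorem base₃_rightCopy (x : Fin k ⊕ Fin l ⊕ Fin m) : base₃ (rightCopy x) = x := by
  rcases x with x | x
  · simp [base₃, rightCopy]
  · simp [base₃, rightCopy, base_secondCopy]

theorem base₃_leftCopy (x : Fin k ⊕ Fin l ⊕ Fin m) : base₃ (leftCopy x) = x := by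
  rcases x with x | x
  · exact congrArg Sum.inl (Fin.ext (by dsimp; omega))
  · simp [base₃, leftCopy, base_firstCopy]

theorem eq_rightCopy_or (u : Fin (2 * k) ⊕ Fin (2 * l) ⊕ Fin (2 * m)) :
    u = rightCopy (base₃ u) ∨ u = leftCopy (base₃ u) := by
  rcases u with u | u
  · rcases Nat.mod_two_eq_zero_or_one u with h | h
    · exact Or.inl (congrArg Sum.inl (Fin.ext (by dsimp; omega)))
    · exact Or.inr (congrArg Sum.inl (Fin.ext (by dsimp; omega)))
  · exact (Nat.even_or_odd (pos u)).symm.imp (fun h => congrArg Sum.inr (eq_secondCopy h))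
      (fun h => congrArg Sum.inr (eq_firstCopy h))

theorem rightCopy_top (z : Fin k ⊕ Fin l) :
    (rightCopy (Sum.map id Sum.inl z) : _ ⊕ _ ⊕ Fin (2 * m)) =
      Sum.map id Sum.inl (firstCopy z) := by
  rcases z with z | z <;> rfl

/-- The partition of the doubled points of a composition whose blocks are the closed curves
that arise from the glued outlines by joining the two copies of each outer point. -/
def closedCurves (p : Diagram k l) (q : Diagram l m) :
    Setoid (Fin (2 * k) ⊕ Fin (2 * l) ⊕ Fin (2 * m)) :=
  glue (outline p) (outline q) ⊔
    (Setoid.ker base : Diagram (2 * k) (2 * m)).map ends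

/-- The closed curves are the loops, and one curve for each block of the composition. -/
theorem ncard_closedCurves {p : Diagram k l} {q : Diagram l m} (hp : p.IsNonCrossing)
    (hq : q.IsNonCrossing) : (closedCurves p q).classes.ncard =
      loops (outline p) (outline q) + (vcomp p q).classes.ncard := by
  rw [ncard_classes_eq_floating_add (ends : Fin (2 * k) ⊕ Fin (2 * m) → _), closedCurves,
    floating_sup_map, comap_sup_map]
  have h : (glue (outline p) (outline q)).comap ends ⊔ Setoid.ker base =
      (vcomp p q : Diagram k m).comap base := by
    rw [← outline_sup_ker_base, ← outline_vcomp hp hq]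
    rfl
  rw [h, ncard_classes_comap fun x => ⟨firstCopy x, base_firstCopy x⟩]
  rfl

theorem ncard_glue (p : Diagram k l) (q : Diagram l m) :
    (glue p q).classes.ncard = loops p q + (vcomp p q).classes.ncard :=
  ncard_classes_eq_floating_add ends _

/-- Joining the two copies of all points makes the glued outlines into the glued partitions. -/
theorem closedCurves_sup_ker (p : Diagram k l) (q : Diagram l m) :
    closedCurves p q ⊔ Setoid.ker base₃ = (glue p q).comap base₃ := by
  apply le_antisymm
  · refine sup_le (sup_le (glue_outline_le p q) (map_le_iff.2 ?_)) ?_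
    · intro u v (huv : base u = base v)
      have hb : ∀ w : Fin (2 * k) ⊕ Fin (2 * m),
          (base₃ (ends w) : Fin k ⊕ Fin l ⊕ Fin m) = ends (base w) := by
        rintro (w | w) <;> rfl
      change glue p q (base₃ (ends u)) (base₃ (ends v))
      rw [hb, hb, huv]
    · intro u v (huv : base₃ u = base₃ v)
      change glue p q (base₃ u) (base₃ v)
      rw [huv]
  · set U := closedCurves p q ⊔ Setoid.ker base₃ with hU
    have hker : Setoid.ker base₃ ≤ U := le_sup_right
    have hglue : glue (outline p) (outline q) ≤ U := le_sup_left.trans le_sup_left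
    have h1 : p.comap base ≤ U.comap (Sum.map id Sum.inl) := by
      rw [← outline_sup_ker_base]
      refine sup_le (fun u v huv => hglue (glue_top _ _ huv)) ?_
      intro u v (huv : base u = base v)
      apply hker
      have hb : ∀ w : Fin (2 * k) ⊕ Fin (2 * l), (base₃ (Sum.map id Sum.inl w) :
          Fin k ⊕ Fin l ⊕ Fin m) = Sum.map id Sum.inl (base w) := by
        rintro (w | w) <;> rfl
      change base₃ _ = base₃ _
      rw [hb, hb, huv]
    have h2 : q.comap base ≤ U.comap Sum.inr := by
      rw [← outline_sup_ker_base]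
      refine sup_le (fun u v huv => hglue (glue_bot _ _ huv)) ?_
      intro u v (huv : base u = base v)
      exact hker (congrArg Sum.inr huv)
    have h3 : glue p q ≤ U.comap rightCopy := by
      refine sup_le (map_le_iff.2 ?_) (map_le_iff.2 ?_)
      · intro x y hxy
        change U (rightCopy _) (rightCopy _)
        rw [rightCopy_top, rightCopy_top]
        exact h1 (show p (base _) (base _) by rwa [base_firstCopy, base_firstCopy])
      · intro x y hxy
        exact h2 (show q (base _) (base _) by rwa [base_secondCopy, base_secondCopy])
    have h4 : ∀ u, U u (rightCopy (base₃ u)) := fun u => hker (base₃_rightCopy (base₃ u)).symm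
    intro u v huv
    exact U.trans' (h4 u) (U.trans' (h3 huv) (U.symm' (h4 v)))

/-- The partition of the points of a glued diagram given by the upper diagram. -/
def topBlocks (p : Diagram k l) (m : ℕ) : Setoid (Fin k ⊕ Fin l ⊕ Fin m) :=
  p.map (Sum.map id Sum.inl)

/-- The partition of the points of a glued diagram given by the lower diagram. -/
def bottomBlocks (k : ℕ) (q : Diagram l m) : Setoid (Fin k ⊕ Fin l ⊕ Fin m) :=
  q.map Sum.inr

theorem ncard_topBlocks (p : Diagram k l) :
    (topBlocks p m).classes.ncard = p.classes.ncard + m := by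
  have := ncard_classes_juxt (f := (Sum.map id Sum.inl : Fin k ⊕ Fin l → Fin k ⊕ Fin l ⊕ Fin m))
    (f' := fun i : Fin m => Sum.inr (Sum.inr i)) inj₄
    (Sum.inr_injective.comp Sum.inr_injective) (by rintro (a | a) b <;> simp)
    (by
      rintro (x | x | x)
      · exact Or.inl ⟨Sum.inl x, rfl⟩
      · exact Or.inl ⟨Sum.inr x, rfl⟩
      · exact Or.inr ⟨x, rfl⟩) p ⊥
  rwa [map_bot, sup_bot_eq, ncard_classes_bot, Nat.card_eq_fintype_card, Fintype.card_fin] at this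

theorem ncard_bottomBlocks (q : Diagram l m) :
    (bottomBlocks k q).classes.ncard = q.classes.ncard + k := by
  have := ncard_classes_juxt (f := (Sum.inr : Fin l ⊕ Fin m → Fin k ⊕ Fin l ⊕ Fin m))
    (f' := fun i : Fin k => Sum.inl i) Sum.inr_injective Sum.inl_injective (by simp)
    (by
      rintro (x | x)
      · exact Or.inr ⟨x, rfl⟩
      · exact Or.inl ⟨x, rfl⟩) q ⊥
  rwa [map_bot, sup_bot_eq, ncard_classes_bot, Nat.card_eq_fintype_card, Fintype.card_fin] at this

/-- The difference of a function across the thick lines of a glued diagram. -/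
def difference : (Fin (2 * k) ⊕ Fin (2 * l) ⊕ Fin (2 * m) → ℚ) →ₗ[ℚ]
    (Fin k ⊕ Fin l ⊕ Fin m → ℚ) :=
  LinearMap.funLeft ℚ ℚ leftCopy - LinearMap.funLeft ℚ ℚ rightCopy

theorem difference_apply (F : Fin (2 * k) ⊕ Fin (2 * l) ⊕ Fin (2 * m) → ℚ)
    (x : Fin k ⊕ Fin l ⊕ Fin m) : difference F x = F (leftCopy x) - F (rightCopy x) := rfl

theorem ker_difference :
    LinearMap.ker (difference : (Fin (2 * k) ⊕ Fin (2 * l) ⊕ Fin (2 * m) → ℚ) →ₗ[ℚ] _) =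
      blockFunctions (Setoid.ker base₃) := by
  ext F
  rw [LinearMap.mem_ker, mem_blockFunctions]
  constructor
  · intro h
    have h1 : ∀ u, F u = F (rightCopy (base₃ u)) := by
      intro u
      rcases eq_rightCopy_or u with hu | hu
      · rw [← hu]
      · have := congrFun h (base₃ u)
        rw [difference_apply, ← hu] at this
        exact sub_eq_zero.1 this
    intro u v (huv : base₃ u = base₃ v)
    change F u = F v
    rw [h1 u, h1 v, huv]
  · intro h
    funext x
    rw [difference_apply, Pi.zero_apply, sub_eq_zero]
    exact h ((base₃_leftCopy x).trans (base₃_rightCopy x).symm)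

/-- The sum of a function on the middle row over the points from a given place of the doubled row
to its right end. -/
def rightSum (g : Fin l → ℚ) (u : Fin (2 * l)) : ℚ := 
  ∑ j : Fin l, if (u : ℕ) ≤ 2 * (j : ℕ) then g j else 0

theorem rightSum_sub (g : Fin l → ℚ) (j : Fin l) :
    rightSum g ⟨2 * j, by omega⟩ - rightSum g ⟨2 * j + 1, by omega⟩ = g j := by
  unfold rightSum
  dsimp only
  rw [← Finset.sum_sub_distrib]
  refine (Finset.sum_eq_single j (fun i _ hij => ?_) (by simp)).trans (by simp)
  have : (i : ℕ) ≠ j := fun h => hij (Fin.ext h)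
  split_ifs <;> first | omega | simp

theorem partialSum_inl_of_zero {g : Fin k ⊕ Fin l → ℚ} (h0 : ∀ i, g (Sum.inl i) = 0)
    (i : Fin (2 * k)) : partialSum g (Sum.inl i) = 0 := by
  refine Finset.sum_eq_zero fun z hz => ?_
  rcases z with z | z
  · exact h0 z
  · have h : 2 * (k + (l - 1 - (z : ℕ))) < (i : ℕ) := (Finset.mem_filter.1 hz).2
    omega

theorem partialSum_inr_of_zero {g : Fin k ⊕ Fin l → ℚ} (h0 : ∀ i, g (Sum.inl i) = 0)
    (u : Fin (2 * l)) : partialSum g (Sum.inr u) = rightSum (fun j => g (Sum.inr j)) u := by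
  unfold partialSum rightSum
  rw [Finset.sum_filter, Fintype.sum_sum_type]
  simp only [h0, ite_self, Finset.sum_const_zero, zero_add]
  refine Finset.sum_congr rfl fun j _ => ?_
  refine if_congr ?_ rfl rfl
  simp only [pos, Sum.elim_inr]
  omega

theorem partialSum_inl_of_total {g : Fin l ⊕ Fin m → ℚ} (h0 : ∀ i, g (Sum.inr i) = 0)
    (h : ∑ z, g z = 0) (u : Fin (2 * l)) :
    partialSum g (Sum.inl u) = - rightSum (fun j => g (Sum.inl j)) u := by
  rw [Fintype.sum_sum_type] at h
  simp only [h0, Finset.sum_const_zero, add_zero] at h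
  rw [eq_neg_iff_add_eq_zero, ← h]
  unfold partialSum rightSum
  rw [Finset.sum_filter, Fintype.sum_sum_type]
  simp only [h0, ite_self, Finset.sum_const_zero, add_zero]
  rw [← Finset.sum_add_distrib]
  refine Finset.sum_congr rfl fun j _ => ?_
  change ((if 2 * (j : ℕ) < (u : ℕ) then _ else 0) + _ : ℚ) = _
  by_cases hu : (u : ℕ) ≤ 2 * (j : ℕ)
  · rw [if_pos hu, if_neg (by omega), zero_add]
  · rw [if_neg hu, if_pos (by omega), add_zero]

theorem partialSum_inr_of_total {g : Fin l ⊕ Fin m → ℚ} (h0 : ∀ i, g (Sum.inr i) = 0)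
    (h : ∑ z, g z = 0) (i : Fin (2 * m)) : partialSum g (Sum.inr i) = 0 := by
  rw [← h]
  unfold partialSum
  rw [Finset.sum_filter]
  refine Finset.sum_congr rfl fun z _ => ?_
  rcases z with z | z
  · rw [if_pos]
    simp [pos]
    omega
  · rw [h0, ite_self]

/-- The differences of the functions on the closed curves are exactly the functions with
sum zero on every block of either diagram. Such a function is the difference of its partial sums,
which extend across both diagrams since these are non-crossing. -/
theorem map_difference {p : Diagram k l} {q : Diagram l m} (hp : p.IsNonCrossing)
    (hq : q.IsNonCrossing) :
    (blockFunctions (closedCurves p q)).map difference =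
      orthogonalFunctions (blockFunctions (topBlocks p m) ⊔ blockFunctions (bottomBlocks k q)) := by
  classical
  apply le_antisymm
  · rintro _ ⟨F, hF, rfl⟩
    have hglue : glue (outline p) (outline q) ≤ Setoid.ker F := le_sup_left.trans hF
    have hends : Setoid.ker base ≤ (Setoid.ker F).comap ends :=
      map_le_iff.1 (le_sup_right.trans hF)
    have h1 : ∀ i, difference F (Sum.inl i) = 0 := fun i =>
      sub_eq_zero.2 (hends (x := Sum.inl _) (y := Sum.inl _)
        (show base (secondCopy (Sum.inl i)) = base (firstCopy (Sum.inl i)) by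
          rw [base_firstCopy, base_secondCopy]))
    have h2 : ∀ i, difference F (Sum.inr (Sum.inr i)) = 0 := fun i =>
      sub_eq_zero.2 (hends (x := Sum.inr _) (y := Sum.inr _)
        (show base (firstCopy (Sum.inr i)) = base (secondCopy (Sum.inr i)) by
          rw [base_firstCopy, base_secondCopy]))
    rw [mem_orthogonalFunctions]
    intro f hf
    obtain ⟨f₁, hf₁, f₂, hf₂, rfl⟩ := Submodule.mem_sup.1 hf
    simp only [Pi.add_apply, add_mul, Finset.sum_add_distrib]
    have e1 : ∑ x, f₁ x * difference F x = 0 := by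
      have := sum_mul_difference (p := p) (f := fun z => f₁ (Sum.map id Sum.inl z))
        (h := fun u => F (Sum.map id Sum.inl u)) (map_le_iff.1 hf₁)
        (fun u v huv => hglue (glue_top _ _ huv))
      rw [Fintype.sum_sum_type] at this ⊢
      rw [Fintype.sum_sum_type]
      simp only [h2, mul_zero, Finset.sum_const_zero, add_zero]
      exact this
    have e2 : ∑ x, f₂ x * difference F x = 0 := by
      have := sum_mul_difference (p := q) (f := fun z => f₂ (Sum.inr z))
        (h := fun u => F (Sum.inr u)) (map_le_iff.1 hf₂)
        (fun u v huv => hglue (glue_bot _ _ huv))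
      rw [Fintype.sum_sum_type]
      simp only [h1, mul_zero, Finset.sum_const_zero, zero_add]
      rw [← neg_eq_zero, ← Finset.sum_neg_distrib, ← this]
      refine Finset.sum_congr rfl fun x _ => ?_
      rw [difference_apply, ← mul_neg, neg_sub]
      rfl
    rw [e1, e2, add_zero]
  · intro g hg
    have hg₁ : ∀ f ∈ blockFunctions (topBlocks p m), ∑ x, f x * g x = 0 := fun f hf =>
      hg f (Submodule.mem_sup_left hf)
    have hg₂ : ∀ f ∈ blockFunctions (bottomBlocks k q), ∑ x, f x * g x = 0 := fun f hf =>
      hg f (Submodule.mem_sup_right hf)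
    -- An outer point is a block by itself of one of the two partitions.
    have h1 : ∀ i, g (Sum.inl i) = 0 := by
      intro i
      have := hg₂ (fun x => if x = Sum.inl i then 1 else 0) (map_le_iff.2 fun x y _ => rfl)
      simpa using this
    have h2 : ∀ i, g (Sum.inr (Sum.inr i)) = 0 := by
      intro i
      have := hg₁ (fun x => if x = Sum.inr (Sum.inr i) then 1 else 0)
        (map_le_iff.2 fun x y _ => by rcases x with x | x <;> rcases y with y | y <;> rfl)
      simpa using this
    set g₁ : Fin k ⊕ Fin l → ℚ := fun z => g (Sum.map id Sum.inl z) with hg₁'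
    set g₂ : Fin l ⊕ Fin m → ℚ := fun z => g (Sum.inr z) with hg₂'
    have o1 : g₁ ∈ orthogonalFunctions (blockFunctions p) := by
      rw [mem_orthogonalFunctions]
      intro f hf
      have := hg₁ (Sum.elim (fun i => f (Sum.inl i)) (Sum.elim (fun j => f (Sum.inr j)) 0))
        (map_le_iff.2 fun x y hxy => by
          have : f x = f y := hf hxy
          rcases x with x | x <;> rcases y with y | y <;> exact this)
      rw [Fintype.sum_sum_type, Fintype.sum_sum_type] at this
      simp only [h2, mul_zero, Finset.sum_const_zero, add_zero] at this
      rw [Fintype.sum_sum_type]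
      exact this
    have o2 : g₂ ∈ orthogonalFunctions (blockFunctions q) := by
      rw [mem_orthogonalFunctions]
      intro f hf
      have := hg₂ (Sum.elim 0 f) (map_le_iff.2 fun x y hxy => hf hxy)
      rw [Fintype.sum_sum_type] at this
      simp only [h1, mul_zero, Finset.sum_const_zero, zero_add] at this
      exact this
    have htot : ∑ z, g₂ z = 0 := by
      have := mem_orthogonalFunctions.1 o2 (fun _ => 1) (fun _ _ _ => rfl)
      simpa using this
    have c1 := hp.partialSum_const o1
    have c2 := hq.partialSum_const o2
    set F : Fin (2 * k) ⊕ Fin (2 * l) ⊕ Fin (2 * m) → ℚ :=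
      Sum.elim 0 (Sum.elim (rightSum fun j => g (Sum.inr (Sum.inl j))) 0) with hF
    have f1 : ∀ u, F (Sum.map id Sum.inl u) = partialSum g₁ u := by
      rintro (u | u)
      · exact (partialSum_inl_of_zero (g := g₁) h1 u).symm
      · exact (partialSum_inr_of_zero (g := g₁) h1 u).symm
    have f2 : ∀ u, F (Sum.inr u) = - partialSum g₂ u := by
      rintro (u | u)
      · rw [partialSum_inl_of_total h2 htot u, neg_neg]
        rfl
      · rw [partialSum_inr_of_total h2 htot u, neg_zero]
        rfl
    refine ⟨F, sup_le (sup_le (map_le_iff.2 ?_) (map_le_iff.2 ?_)) (map_le_iff.2 ?_), ?_⟩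
    · intro u v huv
      change F _ = F _
      rw [f1, f1]
      exact c1 huv
    · intro u v huv
      change F _ = F _
      rw [f2, f2]
      exact congrArg _ (c2 huv)
    · rintro (u | u) (v | v) - <;> rfl
    · funext x
      rw [difference_apply]
      rcases x with x | x | x
      · rw [h1]
        exact sub_self 0
      · exact rightSum_sub (fun j => g (Sum.inr (Sum.inl j))) x
      · rw [h2]
        exact sub_self 0

/-- Euler's formula for a composition: the number of loops that arise in the composition of
the outlines, in terms of the numbers of blocks. -/
theorem loops_outline {p : Diagram k l} {q : Diagram l m} (hp : p.IsNonCrossing)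
    (hq : q.IsNonCrossing) :
    loops (outline p) (outline q) + p.classes.ncard + q.classes.ncard =
      2 * loops p q + (vcomp p q).classes.ncard + l := by
  have h1 := ncard_closedCurves hp hq
  have h2 := ncard_glue p q
  have h3 := finrank_orthogonalFunctions
    (blockFunctions (topBlocks p m) ⊔ blockFunctions (bottomBlocks k q))
  have h4 := Submodule.finrank_sup_add_finrank_inf_eq
    (blockFunctions (topBlocks p m)) (blockFunctions (bottomBlocks k q))
  rw [← blockFunctions_sup, finrank_blockFunctions, finrank_blockFunctions, finrank_blockFunctions,
    ncard_topBlocks, ncard_bottomBlocks] at h4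
  have h5 := LinearMap.finrank_range_add_finrank_ker
    ((difference : _ →ₗ[ℚ] (Fin k ⊕ Fin l ⊕ Fin m → ℚ)).domRestrict
      (blockFunctions (closedCurves p q)))
  have h6 : finrank ℚ (LinearMap.ker
      ((difference : _ →ₗ[ℚ] (Fin k ⊕ Fin l ⊕ Fin m → ℚ)).domRestrict
        (blockFunctions (closedCurves p q)))) = (glue p q).classes.ncard := by
    rw [LinearMap.ker_domRestrict, ← Submodule.finrank_map_subtype_eq,
      Submodule.map_comap_subtype, ker_difference, ← blockFunctions_sup, closedCurves_sup_ker,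
      finrank_blockFunctions, ncard_classes_comap fun x => ⟨_, base₃_rightCopy x⟩]
  rw [h6, LinearMap.range_domRestrict, map_difference hp hq, finrank_blockFunctions] at h5
  have h7 : (topBlocks p m ⊔ bottomBlocks k q).classes.ncard = (glue p q).classes.ncard := rfl
  simp only [Fintype.card_sum, Fintype.card_fin] at h3
  omega

end Diagram
end PartitionCat

namespace PartitionCat
namespace Diagram

variable {k l m k' l' : ℕ}

/-! ### Outlines of tensor products -/

/-- An order-preserving inclusion of the points whose image is a union of blocks preserves next
points. -/
theorem IsNext.map {p : Diagram k l} {q : Diagram k' l'} {f : Fin k ⊕ Fin l → Fin k' ⊕ Fin l'}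
    (hf : ∀ a b, pos (f a) < pos (f b) ↔ pos a < pos b) (hq : ∀ a b, q (f a) (f b) ↔ p a b)
    (hr : ∀ a b, q (f a) b → ∃ c, f c = b) {x y : Fin k ⊕ Fin l} (h : IsNext p x y) :
    IsNext q (f x) (f y) := by
  refine ⟨(hq x y).2 h.1, fun w hw => ?_⟩
  obtain ⟨z, rfl⟩ := hr x w hw
  have h1 := h.2 z ((hq x z).1 hw)
  have e1 := hf x y
  have e2 := hf x z
  have e3 := hf y z
  have e4 := hf z y
  have b1 := pos_lt x
  have b2 := pos_lt y
  have b3 := pos_lt z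
  have c1 := pos_lt (f x)
  have c2 := pos_lt (f y)
  have c3 := pos_lt (f z)
  rw [gap_eq, gap_eq] at *
  split_ifs at * <;> omega

theorem IsNext.inLeft {p : Diagram k l} {x y : Fin k ⊕ Fin l} (h : IsNext p x y)
    (p' : Diagram k' l') : IsNext (p.tensor p') (inLeft k k' l l' x) (inLeft k k' l l' y) := by
  refine h.map pos_inLeft (fun _ _ => tensor_left) fun a b hab => ?_
  rcases inLeft_cover b with hb | ⟨b, rfl⟩
  · exact hb
  · exact absurd hab tensor_cross

theorem IsNext.inRight {p' : Diagram k' l'} {x y : Fin k' ⊕ Fin l'} (h : IsNext p' x y)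
    (p : Diagram k l) : IsNext (p.tensor p') (inRight k k' l l' x) (inRight k k' l l' y) := by
  refine h.map pos_inRight (fun _ _ => tensor_right) fun a b hab => ?_
  rcases inLeft_cover b with ⟨b, rfl⟩ | hb
  · exact absurd hab tensor_cross'
  · exact hb

theorem IsPairing.comap_equiv {p : Diagram k l} (hp : p.IsPairing)
    (e : Fin k' ⊕ Fin l' ≃ Fin k ⊕ Fin l) : IsPairing (p.comap e) := by
  intro u
  rw [← hp (e u), ← Set.ncard_image_of_injective _ e.injective]
  refine congrArg Set.ncard (Set.ext fun w => ?_)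
  constructor
  · rintro ⟨v, hv, rfl⟩
    exact hv
  · intro hw
    refine ⟨e.symm w, ?_, e.apply_symm_apply w⟩
    change p (e u) (e (e.symm w))
    rwa [e.apply_symm_apply]

/-- The identification of the doubled points of a tensor product with the points of the tensor
product of the doubled diagrams. -/
def doubleTensorEquiv (k k' l l' : ℕ) :
    Fin (2 * k + 2 * k') ⊕ Fin (2 * l + 2 * l') ≃ Fin (2 * (k + k')) ⊕ Fin (2 * (l + l')) :=
  Equiv.sumCongr (finCongr (Nat.mul_add 2 k k').symm) (finCongr (Nat.mul_add 2 l l').symm)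

theorem outline_tensor (p : Diagram k l) (p' : Diagram k' l') :
    (outline p).tensor (outline p') =
      (outline (p.tensor p')).comap (doubleTensorEquiv k k' l l') := by
  refine ((isPairing_outline p).tensor (isPairing_outline p')).eq_of_le
    ((isPairing_outline _).comap_equiv _) ?_
  refine sup_le (map_le_iff.2 (outline_le.2 fun x y h => ?_))
    (map_le_iff.2 (outline_le.2 fun x y h => ?_))
  · have h1 : ∀ z, doubleTensorEquiv k k' l l' (inLeft (2 * k) (2 * k') (2 * l) (2 * l')
        (firstCopy z)) = firstCopy (inLeft k k' l l' z) := by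
      rintro (z | z) <;> rfl
    have h2 : ∀ z, doubleTensorEquiv k k' l l' (inLeft (2 * k) (2 * k') (2 * l) (2 * l')
        (secondCopy z)) = secondCopy (inLeft k k' l l' z) := by
      rintro (z | z) <;> rfl
    change outline (p.tensor p') (doubleTensorEquiv k k' l l' _) (doubleTensorEquiv k k' l l' _)
    rw [h1, h2]
    exact outline_rel (h.inLeft p')
  · have h1 : ∀ z, doubleTensorEquiv k k' l l' (inRight (2 * k) (2 * k') (2 * l) (2 * l')
        (firstCopy z)) = firstCopy (inRight k k' l l' z) := by
      rintro (z | z)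
      · exact congrArg Sum.inl (Fin.ext (Nat.mul_add 2 k z).symm)
      · exact congrArg Sum.inr (Fin.ext (show 2 * l + (2 * (z : ℕ) + 1) = 2 * (l + z) + 1 by omega))
    have h2 : ∀ z, doubleTensorEquiv k k' l l' (inRight (2 * k) (2 * k') (2 * l) (2 * l')
        (secondCopy z)) = secondCopy (inRight k k' l l' z) := by
      rintro (z | z)
      · exact congrArg Sum.inl (Fin.ext (show 2 * k + (2 * (z : ℕ) + 1) = 2 * (k + z) + 1 by omega))
      · exact congrArg Sum.inr (Fin.ext (Nat.mul_add 2 l z).symm)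
    change outline (p.tensor p') (doubleTensorEquiv k k' l l' _) (doubleTensorEquiv k k' l l' _)
    rw [h1, h2]
    exact outline_rel (h.inRight p)

theorem outline_tensor_cast (p : Diagram k l) (p' : Diagram k' l') :
    ((outline p).tensor (outline p')).map
        (Sum.map id (Fin.cast (Nat.mul_add 2 l l').symm)) =
      (outline (p.tensor p')).map (Sum.map (Fin.cast (Nat.mul_add 2 k k')) id) := by
  rw [outline_tensor, comap_equiv, map_map]
  refine map_congr _ fun x => ?_
  rcases x with x | x <;> rfl

/-! ### The weight of a partition -/

theorem sum_ncard_classes {X : Type*} [Fintype X] (S : Setoid X) :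
    ∑ c ∈ (Set.toFinite S.classes).toFinset, c.ncard = Fintype.card X := by
  classical
  have h := Finset.card_eq_sum_card_fiberwise (f := fun x => {y | S y x}) (s := Finset.univ)
    (t := (Set.toFinite S.classes).toFinset) (fun x _ => by
      simpa using S.mem_classes x)
  rw [← Finset.card_univ, h]
  refine Finset.sum_congr rfl fun c hc => ?_
  obtain ⟨z, rfl⟩ := (Set.Finite.mem_toFinset _).1 hc
  rw [Set.ncard_eq_toFinset_card']
  refine congrArg Finset.card (Finset.ext fun x => ?_)
  simp only [Set.mem_toFinset, Finset.mem_filter, Finset.mem_univ, true_and]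
  constructor
  · intro (h : S x z)
    ext y
    exact ⟨fun hy => S.trans' hy h, fun hy => S.trans' hy (S.symm' h)⟩
  · intro h
    exact h.le (S.refl' x)

theorem weight_eq {n : ℝ} (hn : 0 < n) (p : Diagram k l) :
    weight n p = n ^ ((p.classes.ncard : ℝ) - (k + l) / 2) := by
  have h := sum_ncard_classes p
  rw [Fintype.card_sum, Fintype.card_fin, Fintype.card_fin] at h
  rw [weight, finprod_mem_eq_finite_toFinset_prod _ (Set.toFinite _), ← Real.rpow_sum_of_pos hn,
    Finset.sum_sub_distrib, ← Finset.sum_div, ← Nat.cast_sum, h, Set.ncard_eq_toFinset_card _]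
  simp

theorem weight_id {n : ℝ} (hn : 0 < n) : weight n (idPart (Fin k)) = 1 := by
  have h : (idPart (Fin k)).classes.ncard = k := by
    have h1 : idPart (Fin k) = (⊥ : Setoid (Fin k)).comap (Sum.elim id id) := rfl
    rw [h1, ncard_classes_comap (fun x => ⟨Sum.inl x, rfl⟩), ncard_classes_bot,
      Nat.card_eq_fintype_card, Fintype.card_fin]
  rw [weight_eq hn, h, show (k : ℝ) - (k + k) / 2 = 0 by ring, Real.rpow_zero]

theorem weight_tensor {n : ℝ} (hn : 0 < n) (p : Diagram k l) (p' : Diagram k' l') :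
    weight n (p.tensor p') = weight n p * weight n p' := by
  have h : (p.tensor p').classes.ncard = p.classes.ncard + p'.classes.ncard :=
    ncard_classes_juxt inLeft_injective inRight_injective inLeft_ne_inRight inLeft_cover p p'
  rw [weight_eq hn, weight_eq hn, weight_eq hn, ← Real.rpow_add hn, h]
  push_cast
  congr 1
  ring

theorem weight_reflect {n : ℝ} (hn : 0 < n) (p : Diagram k l) :
    weight n (reflect p) = weight n p := by
  have h : (reflect p).classes.ncard = p.classes.ncard :=
    ncard_classes_comap Sum.swap_leftInverse.surjective p
  rw [weight_eq hn, weight_eq hn, h, add_comm (l : ℝ)]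

/-- The weights account for the difference between the loop factors `n` of the outlines and the
loop factors `n ^ 2` of the partitions. -/
theorem weight_vcomp {n : ℝ} (hn : 0 < n) {p : Diagram k l} {q : Diagram l m}
    (hp : p.IsNonCrossing) (hq : q.IsNonCrossing) :
    weight n p * weight n q * n ^ loops (outline p) (outline q) =
      (n ^ 2) ^ loops p q * weight n (vcomp p q : Diagram k m) := by
  have h : (loops (outline p) (outline q) : ℝ) + p.classes.ncard + q.classes.ncard =
      2 * loops p q + (vcomp p q).classes.ncard + l := by
    exact_mod_cast loops_outline hp hq
  rw [weight_eq hn, weight_eq hn, weight_eq hn, ← pow_mul, ← Real.rpow_natCast,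
    ← Real.rpow_natCast, ← Real.rpow_add hn, ← Real.rpow_add hn, ← Real.rpow_add hn]
  congr 1
  push_cast
  linarith

end Diagram
end PartitionCat

namespace PartitionCat

open CategoryTheory MonoidalCategory DiagramClass PartCat

/-! ### The functor -/

section Functor

variable {n : ℝ} {k l m k' l' : ℕ}

/-- The outline of a non-crossing partition as a non-crossing pairing. -/
def outlinePart (p : nonCrossing.Part k l) : nonCrossingPairing.Part (2 * k) (2 * l) :=
  ⟨p.1.outline, Diagram.isNonCrossing_outline p.2, Diagram.isPairing_outline p.1⟩

/-- The linear map that sends a non-crossing partition to the weighted multiple of its outline. -/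
noncomputable def outlineMap (n : ℝ) :
    nonCrossing.Mor k l →ₗ[ℂ] nonCrossingPairing.Mor (2 * k) (2 * l) :=
  Finsupp.linearCombination ℂ fun p => Finsupp.single (outlinePart p) (p.1.weight n : ℂ)

theorem outlineMap_single (p : nonCrossing.Part k l) (a : ℂ) :
    outlineMap n (Finsupp.single p a) = Finsupp.single (outlinePart p) (a * p.1.weight n) := by
  rw [outlineMap, Finsupp.linearCombination_single, Finsupp.smul_single, smul_eq_mul]

theorem outlineMap_one (hn : 0 < n) :
    outlineMap n (Finsupp.single (Part.one k) 1) = Finsupp.single (Part.one (2 * k)) 1 := by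
  have h : outlinePart (Part.one k) = Part.one (2 * k) := Subtype.ext Diagram.outline_id
  have h' : (Part.one k : nonCrossing.Part k k).1.weight n = 1 := Diagram.weight_id hn
  rw [outlineMap_single, h, h', Complex.ofReal_one, one_mul]

theorem outlineMap_comp (hn : 0 < n) (f : nonCrossing.Mor k l) (g : nonCrossing.Mor l m) :
    outlineMap n (nonCrossing.comp (n ^ 2) f g) =
      nonCrossingPairing.comp n (outlineMap n f) (outlineMap n g) := by
  induction f using Finsupp.induction_linear with
  | zero => simp
  | add f f' hf hf' => simp only [map_add, LinearMap.add_apply, hf, hf']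
  | single p a =>
  induction g using Finsupp.induction_linear with
  | zero => simp
  | add g g' hg hg' => simp only [map_add, hg, hg']
  | single q b =>
    rw [comp_single, outlineMap_single, outlineMap_single, outlineMap_single, comp_single]
    have h1 : (outlinePart p).comp (outlinePart q) = outlinePart (p.comp q) :=
      Subtype.ext (Diagram.outline_vcomp p.2 q.2)
    have h2 : ((p.1.weight n * q.1.weight n * n ^ loops p.1.outline q.1.outline : ℝ) : ℂ) =
        ((n ^ 2) ^ loops p.1 q.1 * (p.comp q).1.weight n : ℝ) :=
      congrArg _ (Diagram.weight_vcomp hn p.2 q.2)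
    push_cast at h2
    rw [h1]
    congr 1
    change _ = _ * (n : ℂ) ^ loops p.1.outline q.1.outline
    push_cast
    linear_combination (- a * b) * h2

theorem outlineMap_adj (hn : 0 < n) (f : nonCrossing.Mor k l) :
    outlineMap n (nonCrossing.adj f) = nonCrossingPairing.adj (outlineMap n f) := by
  induction f using Finsupp.induction_linear with
  | zero => rw [adj_zero, map_zero, map_zero, adj_zero]
  | add f f' hf hf' => rw [adj_add, map_add, map_add, adj_add, hf, hf']
  | single p a =>
    have h1 : outlinePart p.star = (outlinePart p).star := Subtype.ext (Diagram.outline_reflect p.1)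
    have h2 : p.star.1.weight n = p.1.weight n := Diagram.weight_reflect hn p.1
    rw [adj_single, outlineMap_single, outlineMap_single, adj_single, h1, h2, map_mul,
      Complex.conj_ofReal]

/-- The weighted multiple of the outline, as a map on the morphisms of the two categories. -/
noncomputable def outlineHom {X Y : NCPart (n ^ 2)} (f : X ⟶ Y) :
    (⟨2 * X.pts⟩ : NCPair n) ⟶ ⟨2 * Y.pts⟩ :=
  ofMor (outlineMap n f)

theorem outlineHom_single {X Y : NCPart (n ^ 2)} (p : nonCrossing.Part X.pts Y.pts) (a : ℂ) :
    outlineHom (ofMor (Finsupp.single p a) : X ⟶ Y) =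
      ofMor (Finsupp.single (outlinePart p) (a * p.1.weight n)) :=
  congrArg ofMor (outlineMap_single p a)

theorem outlineHom_add {X Y : NCPart (n ^ 2)} (f g : X ⟶ Y) :
    outlineHom (f + g) = outlineHom f + outlineHom g :=
  (outlineMap n).map_add f g

theorem outlineHom_zero {X Y : NCPart (n ^ 2)} : outlineHom (0 : X ⟶ Y) = 0 :=
  (outlineMap n).map_zero

theorem double_tensor (X Y : NCPart (n ^ 2)) :
    (⟨2 * X.pts⟩ ⊗ ⟨2 * Y.pts⟩ : NCPair n) = ⟨2 * (X ⊗ Y).pts⟩ :=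
  PartCat.ext (Nat.mul_add 2 X.pts Y.pts).symm

theorem outlineHom_tensorHom (hn : 0 < n) {X Y X' Y' : NCPart (n ^ 2)} (f : X ⟶ Y)
    (g : X' ⟶ Y') :
    (outlineHom f ⊗ₘ outlineHom g) ≫ eqToHom (double_tensor Y Y') =
      eqToHom (double_tensor X X') ≫ outlineHom (f ⊗ₘ g) := by
  induction f using hom_induction with
  | h0 => simp only [outlineHom_zero, zero_tensor, Limits.zero_comp, Limits.comp_zero]
  | hadd f f' hf hf' =>
    simp only [outlineHom_add, add_tensor, Preadditive.add_comp, Preadditive.comp_add, hf, hf']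
  | hs p a =>
  induction g using hom_induction with
  | h0 => simp only [outlineHom_zero, tensor_zero, Limits.zero_comp, Limits.comp_zero]
  | hadd f f' hf hf' =>
    simp only [outlineHom_add, tensor_add, Preadditive.add_comp, Preadditive.comp_add, hf, hf']
  | hs q b =>
    have h : (p.tensor q).1.weight n = p.1.weight n * q.1.weight n :=
      Diagram.weight_tensor hn p.1 q.1
    have e : a * p.1.weight n * (b * q.1.weight n) = a * b * (p.tensor q).1.weight n := by
      rw [h, Complex.ofReal_mul]
      ring
    rw [outlineHom_single, outlineHom_single, single_tensor_single, single_tensor_single]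
    refine Eq.trans ?_ (congrArg _ (outlineHom_single (p.tensor q) (a * b))).symm
    rw [← e]
    exact cast_natural (double_tensor X X') (double_tensor Y Y') _ _ _
      (Diagram.outline_tensor_cast p.1 q.1)

/-- The functor that sends a non-crossing partition to the weighted multiple of its outline. -/
noncomputable def outlineFunctor (hn : 0 < n) : NCPart (n ^ 2) ⥤ NCPairEven n where
  obj X := doubled n X.pts
  map {X Y} f := ObjectProperty.homMk
    (outlineHom f : (doubled n X.pts).obj ⟶ (doubled n Y.pts).obj)
  map_id _ := ObjectProperty.hom_ext _ (outlineMap_one hn)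
  map_comp f g := ObjectProperty.hom_ext _ (outlineMap_comp hn f g)

theorem outlineFunctor_obj (hn : 0 < n) (X : NCPart (n ^ 2)) :
    (outlineFunctor hn).obj X = doubled n X.pts := rfl

theorem outlineFunctor_obj_tensor (hn : 0 < n) (X Y : NCPart (n ^ 2)) :
    (outlineFunctor hn).obj X ⊗ (outlineFunctor hn).obj Y = (outlineFunctor hn).obj (X ⊗ Y) :=
  ObjectProperty.FullSubcategory.ext (PartCat.ext (Nat.mul_add 2 X.pts Y.pts).symm)

theorem outlineFunctor_obj_unit (hn : 0 < n) :
    𝟙_ (NCPairEven n) = (outlineFunctor hn).obj (𝟙_ (NCPart (n ^ 2))) := rfl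

theorem eqToHom_hom {X Y : NCPairEven n} (h : X = Y) :
    (eqToHom h).hom = eqToHom (congrArg ObjectProperty.FullSubcategory.obj h) := by
  subst h
  rfl

theorem dagger_eqToHom {X Y : NCPairEven n} (h : X = Y) :
    MonoidalStarCategory.dagger (eqToHom h) = eqToHom h.symm := by
  subst h
  exact MonoidalStarCategory.dagger_id X

theorem outlineFunctor_tensorHom (hn : 0 < n) {X Y X' Y' : NCPart (n ^ 2)} (f : X ⟶ Y)
    (g : X' ⟶ Y') :
    ((outlineFunctor hn).map f ⊗ₘ (outlineFunctor hn).map g) ≫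
        eqToHom (outlineFunctor_obj_tensor hn Y Y') =
      eqToHom (outlineFunctor_obj_tensor hn X X') ≫ (outlineFunctor hn).map (f ⊗ₘ g) := by
  apply ObjectProperty.hom_ext
  refine (congrArg (_ ≫ ·) (eqToHom_hom (outlineFunctor_obj_tensor hn Y Y'))).trans ?_
  refine Eq.trans ?_ (congrArg (· ≫ _) (eqToHom_hom (outlineFunctor_obj_tensor hn X X'))).symm
  exact outlineHom_tensorHom hn f g

theorem associator_eq (X Y Z : NCPairEven n) :
    (α_ X Y Z).hom = eqToHom (ObjectProperty.FullSubcategory.ext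
      (PartCat.ext (Nat.add_assoc X.obj.pts Y.obj.pts Z.obj.pts))) :=
  ObjectProperty.hom_ext _ (eqToHom_hom (X := (X ⊗ Y) ⊗ Z) (Y := X ⊗ Y ⊗ Z) _).symm

theorem leftUnitor_eq (X : NCPairEven n) :
    (λ_ X).hom = eqToHom (ObjectProperty.FullSubcategory.ext
      (PartCat.ext (Nat.zero_add X.obj.pts))) :=
  ObjectProperty.hom_ext _ (eqToHom_hom (X := 𝟙_ _ ⊗ X) (Y := X) _).symm

theorem rightUnitor_eq (X : NCPairEven n) :
    (ρ_ X).hom = eqToHom (ObjectProperty.FullSubcategory.ext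
      (PartCat.ext (Nat.add_zero X.obj.pts))) :=
  ObjectProperty.hom_ext _ (eqToHom_hom (X := X ⊗ 𝟙_ _) (Y := X) _).symm

/-- The strict monoidal structure of the outline functor. -/
noncomputable def outlineCoreMonoidal (hn : 0 < n) : (outlineFunctor hn).CoreMonoidal where
  εIso := eqToIso (outlineFunctor_obj_unit hn)
  μIso X Y := eqToIso (outlineFunctor_obj_tensor hn X Y)
  μIso_hom_natural_left f X' := by
    rw [← tensorHom_id, ← tensorHom_id, ← (outlineFunctor hn).map_id]
    exact outlineFunctor_tensorHom hn f (𝟙 X')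
  μIso_hom_natural_right X' f := by
    rw [← id_tensorHom, ← id_tensorHom, ← (outlineFunctor hn).map_id]
    exact outlineFunctor_tensorHom hn (𝟙 X') f
  associativity X Y Z := by
    rw [associator_eq, associator_hom, eqToHom_map]
    simp only [eqToIso.hom, eqToHom_whiskerRight, whiskerLeft_eqToHom, eqToHom_trans]
  left_unitality X := by
    rw [leftUnitor_eq, leftUnitor_hom, eqToHom_map]
    simp only [eqToIso.hom, eqToHom_whiskerRight, eqToHom_trans]
  right_unitality X := by
    rw [rightUnitor_eq, rightUnitor_hom, eqToHom_map]
    simp only [eqToIso.hom, whiskerLeft_eqToHom, eqToHom_trans]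

noncomputable instance (hn : 0 < n) : (outlineFunctor hn).Monoidal :=
  (outlineCoreMonoidal hn).toMonoidal

end Functor

end PartitionCat

open CategoryTheory PartitionCat
theorem theorem5p1 (n : ℝ) (hn : 0 < n) :
    ∃ (F : NCPart (n ^ 2) ⥤ NCPairEven n) (_ : F.Monoidal),
      IsUnitaryMonoidal F ∧ IsStrictMonoidal F ∧
      ∃ hF : ∀ X : NCPart (n ^ 2), F.obj X = doubled n X.pts,
        ∀ (X Y : NCPart (n ^ 2)) (p : nonCrossing.Part X.pts Y.pts),
          ∃ hp : nonCrossingPairing.mem p.1.outline,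
            F.map (PartCat.ofPart p : X ⟶ Y) =
              eqToHom (hF X) ≫
                ((p.1.weight n : ℂ) •
                  (ObjectProperty.homMk (PartCat.ofPart ⟨p.1.outline, hp⟩) :
                    doubled n X.pts ⟶ doubled n Y.pts)) ≫
                eqToHom (hF Y).symm := by
  refine ⟨outlineFunctor hn, inferInstance, ?_, ?_, outlineFunctor_obj hn, ?_⟩
  · exact
      { map_add := fun f g => ObjectProperty.hom_ext _ ((outlineMap n).map_add f g)
        map_smul := fun r f => ObjectProperty.hom_ext _ ((outlineMap n).map_smul r f)
        map_dagger := fun f => ObjectProperty.hom_ext _ (outlineMap_adj hn f)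
        dagger_ε := dagger_eqToHom (outlineFunctor_obj_unit hn)
        dagger_μ := fun X Y => dagger_eqToHom (outlineFunctor_obj_tensor hn X Y) }
  · exact
      { ε_eq := ⟨outlineFunctor_obj_unit hn, rfl⟩
        μ_eq := fun X Y => ⟨outlineFunctor_obj_tensor hn X Y, rfl⟩ }
  · intro X Y p
    refine ⟨(outlinePart p).2, ?_⟩
    refine Eq.trans ?_ ((Category.id_comp _).trans (Category.comp_id _)).symm
    apply ObjectProperty.hom_ext
    refine (outlineMap_single p 1).trans ?_
    refine Eq.trans ?_ (Finsupp.smul_single (p.1.weight n : ℂ) (outlinePart p) (1 : ℂ)).symm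
    rw [one_mul, smul_eq_mul, mul_one]
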